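/- Let $\ell$ be a prime number and let $K_v$ be a field complete for a discrete valuation $v$, normalised by $v(K_v^{*})=\mathbb{Z}$, with perfect residue field of characteristic $\ell$, such that $v(\ell)$ is finite (i.e. $\ell\neq 0$ in $K_v$); put $e:=v(\ell)$, the ramification index of $K_v$. Let $K_\infty/K_v$ be a totally ramified Galois extension whose Galois group is topologically isomorphic to $\mathbb{Z}_\ell$, and for $n\ge 0$ let $K_n$ be the subfield of $K_\infty$ fixed by $\ell^n\mathbb{Z}_\ell$. Let $\mathfrak{d}_{K_n/K_v}$ be the different of $K_n/K_v$, and let $v(\mathfrak{d}_{K_n/K_v})$ be its valuation for the unique extension of $v$ to $K_n$. Then for every $n\ge 0$ $$v(\mathfrak{d}_{K_n/K_v})=en+c_1+\ell^{-n}c_2,$$ where $c_1=c_1(n)$ and $c_2=c_2(n)$ are real numbers with $$|c_1|\le 6e^2,\qquad |c_2|\le 2\left(\frac{\ell e}{\ell-1}\right)^2-1\le 8e^2,$$ and these can be chosen so that, for some integer $\kappa\ge 0$ with $\ell^{\kappa}\le \frac{\ell e}{\ell-1}$, the numbers $c_1(n)$ and $c_2(n)$ do not depend on $n$ for $n\ge\kappa$.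 -/

import Mathlib

namespace RamifiedTower

section

variable (R : Type*) [CommRing R] [IsDomain R] [IsDiscreteValuationRing R]

/-- For an `R`-algebra `B` (in practice the integral closure of the complete discrete valuation
ring `R` in a finite extension) and a nonzero prime `P` of `B` over the maximal ideal of `R`, the
valuation `v` of an ideal `I` of `B`, where `v` extends the valuation of `R` normalised by
`v (uniformizer of R) = 1`: the exponent of `P` in `I`, divided by the ramification index of `P`
over `R`. -/
noncomputable def idealVal {B : Type*} [CommRing B] [Algebra R B] (P I : Ideal B) : ℝ :=
  (multiplicity P I : ℝ) / (P.ramificationIdx R : ℝ)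

/-- An algebraic extension `L` of `K = Frac R` is totally ramified if every finite subextension
`F / K` has ramification index equal to its degree `[F : K]`. -/
def IsTotallyRamified (K L : Type*) [Field K] [Algebra R K] [Field L] [Algebra K L]
    [Algebra R L] [IsScalarTower R K L] : Prop :=
  ∀ F : IntermediateField K L, FiniteDimensional K F →
    ∀ P : Ideal (integralClosure R F), P.IsPrime →
      P.LiesOver (IsLocalRing.maximalIdeal R) →
        P.ramificationIdx R = Module.finrank K F

end

section

variable {ℓ : ℕ} [Fact ℓ.Prime] {K L : Type*} [Field K] [Field L] [Algebra K L]

/-- The subgroup of the Galois group which corresponds to `ℓ ^ n ℤ_ℓ` under a given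
identification `φ` of the Galois group with `ℤ_ℓ`. -/
noncomputable def layerSubgroup (φ : Gal(L/K) ≃ₜ* Multiplicative ℤ_[ℓ]) (n : ℕ) :
    Subgroup Gal(L/K) :=
  (AddSubgroup.toSubgroup
    (Ideal.span {(ℓ : ℤ_[ℓ]) ^ n}).toAddSubgroup).comap φ.toMulEquiv.toMonoidHom

/-- The layer `K_n` of a `ℤ_ℓ`-extension: the fixed field of the subgroup `ℓ ^ n ℤ_ℓ`. -/
noncomputable def layer (φ : Gal(L/K) ≃ₜ* Multiplicative ℤ_[ℓ]) (n : ℕ) :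
    IntermediateField K L :=
  IntermediateField.fixedField (layerSubgroup φ n)

theorem isOpen_layerSubgroup (φ : Gal(L/K) ≃ₜ* Multiplicative ℤ_[ℓ]) (n : ℕ) :
    IsOpen (layerSubgroup φ n : Set Gal(L/K)) := by
  have h : (layerSubgroup φ n : Set Gal(L/K)) =
      (fun g => (φ g).toAdd) ⁻¹' Metric.closedBall (0 : ℤ_[ℓ]) ((ℓ : ℝ) ^ (-n : ℤ)) := by
    ext g
    rw [Set.mem_preimage, mem_closedBall_zero_iff, PadicInt.norm_le_pow_iff_mem_span_pow]
    rfl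
  have hp : (0 : ℝ) < ℓ := by exact_mod_cast (Fact.out : ℓ.Prime).pos
  rw [h]
  exact (IsUltrametricDist.isOpen_closedBall (0 : ℤ_[ℓ]) (zpow_pos hp _).ne').preimage
    (continuous_toAdd.comp φ.continuous)

instance finiteDimensional_layer [IsGalois K L] (φ : Gal(L/K) ≃ₜ* Multiplicative ℤ_[ℓ]) (n : ℕ) :
    FiniteDimensional K (layer φ n) := by
  have h := isOpen_layerSubgroup φ n
  rw [← InfiniteGalois.isOpen_iff_finite]
  exact Subgroup.isOpen_mono
    (IntermediateField.le_iff_le (layerSubgroup φ n) (layer φ n) |>.mp le_rfl) h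

instance isDedekindDomain_layer (R : Type*) [CommRing R] [IsDomain R] [IsDiscreteValuationRing R]
    [Algebra R K] [IsFractionRing R K] [Algebra R L] [IsScalarTower R K L] [IsGalois K L]
    (φ : Gal(L/K) ≃ₜ* Multiplicative ℤ_[ℓ]) (n : ℕ) :
    IsDedekindDomain (integralClosure R (layer φ n)) :=
  integralClosure.isDedekindDomain R K (layer φ n)

instance isTorsionFree_layer (R : Type*) [CommRing R] [IsDomain R] [IsDiscreteValuationRing R]
    [Algebra R K] [IsFractionRing R K] [Algebra R L] [IsScalarTower R K L]
    (φ : Gal(L/K) ≃ₜ* Multiplicative ℤ_[ℓ]) (n : ℕ) :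
    Module.IsTorsionFree R (integralClosure R (layer φ n)) := by
  have : Module.IsTorsionFree R K := inferInstance
  have : Module.IsTorsionFree R (layer φ n) := Module.IsTorsionFree.trans_faithfulSMul R K _
  exact IsIntegralClosure.isTorsionFree R (layer φ n)

end

end RamifiedTower

/-!
The valuation of the different of `K_n / K` is a sum over the ramification breaks of `L / K`, so
that everything comes down to the growth of these breaks.

By Hilbert's formula, `Tower.ordEq_prod_sub`, the valuation of the different of `K_n` is
`∑_{j < n} (ℓ - 1) (l j + 1) / ℓ ^ (j + 1)`, where `l j` are the lower breaks
(`multiplicity_differentIdeal`, `exists_breaks`). In terms of the upper breaks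
`u n = l n / ℓ ^ n + ∑_{j < n} (ℓ - 1) l j / ℓ ^ (j + 1)` it is `u n + 1 - (l n + 1) / ℓ ^ n`
(`differentValue_eq`). There are three facts about the breaks:

* `(ℓ - 1) l n ≤ e ℓ ^ (n + 1)` (`Tower.mul_lam_le`);
* `min (ℓ u_n) (u_n + e) ≤ u_{n+1}` (`Tower.min_le_upperBreak_of_perfect`);
* if `e ≤ (ℓ - 1) u_n`, then `u_{n+1} ≤ u_n + e` (`Tower.upperBreak_succ_le_of_perfect`).

Hence the upper breaks are multiplied by at least `ℓ` at each step until they reach `e / (ℓ - 1)`,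
which takes a number `κ` of steps with `ℓ ^ κ ≤ ℓ e / (ℓ - 1)`, and form an arithmetic progression
with difference `e` from there on. The constants are read off from this in `exists_constants`.

The bounds for the growth of the upper breaks are usually drawn from local class field theory, in
which `u_n` is the largest level of a one-unit of `K` which is not a norm from `K_{n+1}`. Only this
property of norm groups is needed, and it has a direct proof. In a step of degree `ℓ` with break `t`
the norm of `1 + x` is `1 + Tr x + N x` up to a small error (`Step.nmProd_expansion`). Therefore
one-units beyond `t` are norms if the field is complete (`Step.exists_nmProd_eq`), and at `t` the
norm induces an additive polynomial on the residue field, which is an Artin–Schreier polynomial up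
to scaling. If that is not onto, there is a one-unit of level `t` which is not a norm
(`Step.exists_not_nmProd`). Going down the tower with the help of Hilbert 90
(`exists_mul_map_eq`), one gets a one-unit of `K` of level `u_n` which is not a norm from `K_{n+1}`
(`Tower.exists_not_nmProd`), while all one-units of larger level are norms
(`Tower.exists_nmProd_eq`). The two inequalities follow by comparison with the `ℓ`-th power map on
one-units, as an element of `K` is a norm from `K_{n+1}` if its `ℓ`-th power is one from `K_{n+2}`
(`exists_nmProd_of_pow`), the converse being clear.

The residue field of `K` may be algebraically closed, in which case there is no Artin–Schreier
extension and all units are norms. The residue field `k` is therefore enlarged first, to the field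
of fractions of the monoid algebra `k[T ^ ℚ]`. It is perfect, and `a ^ ℓ - a = T` has no solution in
it (`not_artinSchreier`). It is the residue field of the completion of the field of fractions of
`K_n[T ^ ℚ]` for the Gauss valuation, to which the Galois group of `K_n / K` extends with the same
breaks (`Tower.exists_complete_artinSchreier`).

Throughout, a cyclic extension is given by its top field with an automorphism `σ` and a valuation
which is normalised there. The layers are the fixed fields of the powers of `σ`, but are not turned
into types, and norms to them are the products `nmProd` over powers of `σ`.
-/

/-! ### Orders with respect to a discrete valuation -/

namespace RamifiedTower

open WithZero Finset

section Ord

variable {L : Type*} [Field L] (v : Valuation L ℤᵐ⁰)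

/-- The additive order of `x` at the discrete valuation `v` is at least `n`. -/
def OrdGE (n : ℤ) (x : L) : Prop := v x ≤ exp (-n)

/-- The additive order of `x` at the discrete valuation `v` is exactly `n`; in particular
`x ≠ 0`. -/
def OrdEq (n : ℤ) (x : L) : Prop := v x = exp (-n)

variable {v} {m n : ℤ} {x y : L}

theorem ordGE_zero (n : ℤ) : OrdGE v n 0 := by simp [OrdGE]

theorem OrdGE.mono (h : OrdGE v n x) (hmn : m ≤ n) : OrdGE v m x :=
  le_trans h (exp_le_exp.2 (by omega))

theorem OrdGE.add (hx : OrdGE v n x) (hy : OrdGE v n y) : OrdGE v n (x + y) :=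
  v.map_add_le hx hy

theorem OrdGE.neg (hx : OrdGE v n x) : OrdGE v n (-x) := by
  simpa [OrdGE, Valuation.map_neg] using hx

theorem OrdGE.sub (hx : OrdGE v n x) (hy : OrdGE v n y) : OrdGE v n (x - y) :=
  v.map_sub_le hx hy

theorem OrdGE.sub_swap (hx : OrdGE v n (x - y)) : OrdGE v n (y - x) := by
  simpa using hx.neg

theorem OrdGE.mul (hx : OrdGE v m x) (hy : OrdGE v n y) : OrdGE v (m + n) (x * y) := by
  unfold OrdGE at *
  rw [map_mul, neg_add, exp_add]
  exact mul_le_mul' hx hy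

theorem OrdEq.mul (hx : OrdEq v m x) (hy : OrdEq v n y) : OrdEq v (m + n) (x * y) := by
  unfold OrdEq at *
  rw [map_mul, neg_add, exp_add, hx, hy]

theorem ordEq_one : OrdEq v 0 1 := by simp [OrdEq]

theorem OrdEq.ge (h : OrdEq v n x) : OrdGE v n x := le_of_eq h

theorem OrdEq.ne_zero (h : OrdEq v n x) : x ≠ 0 := by
  rintro rfl
  exact exp_ne_zero (h.symm.trans (map_zero v))

theorem OrdEq.inv (hx : OrdEq v m x) : OrdEq v (-m) x⁻¹ := by
  unfold OrdEq at *
  rw [map_inv₀, hx, exp_neg, inv_inv, neg_neg]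

theorem OrdEq.div (hx : OrdEq v m x) (hy : OrdEq v n y) : OrdEq v (m - n) (x / y) := by
  rw [div_eq_mul_inv, sub_eq_add_neg]
  exact hx.mul hy.inv

theorem OrdGE.div (hx : OrdGE v m x) (hy : OrdEq v n y) : OrdGE v (m - n) (x / y) := by
  rw [div_eq_mul_inv, sub_eq_add_neg]
  exact hx.mul hy.inv.ge

theorem OrdEq.pow (hx : OrdEq v m x) (k : ℕ) : OrdEq v (k * m) (x ^ k) := by
  induction k with
  | zero => simpa using ordEq_one
  | succ k ih =>
    rw [pow_succ]
    convert ih.mul hx using 1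
    push_cast; ring

theorem OrdGE.pow (hx : OrdGE v m x) (k : ℕ) : OrdGE v (k * m) (x ^ k) := by
  induction k with
  | zero => simpa using ordEq_one.ge
  | succ k ih =>
    rw [pow_succ]
    convert ih.mul hx using 1
    push_cast; ring

theorem OrdEq.neg (hx : OrdEq v m x) : OrdEq v m (-x) := by
  simpa [OrdEq, Valuation.map_neg] using hx

theorem OrdGE.sum {ι : Type*} {s : Finset ι} {f : ι → L} (h : ∀ i ∈ s, OrdGE v n (f i)) :
    OrdGE v n (∑ i ∈ s, f i) := v.map_sum_le h

theorem OrdGE.prod {ι : Type*} {s : Finset ι} {f : ι → L} (h : ∀ i ∈ s, OrdGE v n (f i)) :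
    OrdGE v (s.card * n) (∏ i ∈ s, f i) := by
  classical
  induction s using Finset.induction_on with
  | empty => simpa using ordEq_one.ge
  | insert a s ha ih =>
    rw [prod_insert ha, card_insert_of_notMem ha]
    convert (h a (mem_insert_self a s)).mul (ih fun i hi => h i (mem_insert_of_mem hi)) using 1
    push_cast; ring

theorem OrdEq.prod {ι : Type*} {s : Finset ι} {f : ι → L} (h : ∀ i ∈ s, OrdEq v n (f i)) :
    OrdEq v (s.card * n) (∏ i ∈ s, f i) := by
  classical
  induction s using Finset.induction_on with
  | empty => simpa using ordEq_one
  | insert a s ha ih =>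
    rw [prod_insert ha, card_insert_of_notMem ha]
    convert (h a (mem_insert_self a s)).mul (ih fun i hi => h i (mem_insert_of_mem hi)) using 1
    push_cast; ring

theorem OrdEq.unique (hx : OrdEq v m x) (hx' : OrdEq v n x) : m = n := by
  have := hx.symm.trans hx'
  simpa using this

theorem OrdEq.le_of_ge (hx : OrdEq v n x) (hx' : OrdGE v m x) : m ≤ n := by
  unfold OrdEq OrdGE at *
  rw [hx, exp_le_exp] at hx'
  omega

theorem exists_ordEq (v : Valuation L ℤᵐ⁰) (hx : x ≠ 0) : ∃ n, OrdEq v n x :=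
  ⟨-log (v x), by rw [OrdEq, neg_neg, exp_log (v.ne_zero_iff.2 hx)]⟩

theorem OrdGE.lt_or_eq (h : OrdGE v n x) : OrdGE v (n + 1) x ∨ OrdEq v n x := by
  rcases eq_or_ne x 0 with rfl | hx
  · exact Or.inl (ordGE_zero _)
  · obtain ⟨m, hm⟩ := exists_ordEq v hx
    have := hm.le_of_ge h
    rcases eq_or_lt_of_le this with rfl | h1
    · exact Or.inr hm
    · exact Or.inl (hm.ge.mono h1)

theorem OrdEq.add_ge (hx : OrdEq v n x) (hy : OrdGE v (n + 1) y) : OrdEq v n (x + y) := by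
  have : v y < v x := by
    rw [OrdEq] at hx
    rw [hx]
    exact lt_of_le_of_lt hy (exp_lt_exp.2 (by omega))
  rw [OrdEq, Valuation.map_add_eq_of_lt_left v this, hx]

theorem OrdEq.of_sub (hx : OrdEq v n x) (hy : OrdGE v (n + 1) (y - x)) : OrdEq v n y := by
  simpa using hx.add_ge hy

theorem OrdGE.of_sub (hx : OrdGE v n x) (hy : OrdGE v n (y - x)) : OrdGE v n y := by
  simpa using hx.add hy

theorem ordGE_natCast (v : Valuation L ℤᵐ⁰) (k : ℕ) : OrdGE v 0 (k : L) := by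
  induction k with
  | zero => simpa using ordGE_zero 0
  | succ k ih => simpa using ih.add ordEq_one.ge

theorem eq_zero_of_forall_ordGE (h : ∀ n : ℤ, OrdGE v n x) : x = 0 := by
  by_contra hx
  obtain ⟨n, hn⟩ := exists_ordEq v hx
  have := hn.le_of_ge (h (n + 1))
  omega

/-- Integers prime to the residue characteristic are units. -/
theorem ordEq_natCast {ℓ : ℕ} (hp : ℓ.Prime) (hℓ : OrdGE v 1 (ℓ : L)) {k : ℕ} (hk : ¬ ℓ ∣ k) :
    OrdEq v 0 (k : L) := by
  refine (ordGE_natCast v k).lt_or_eq.resolve_left fun h => ?_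
  have hc : IsCoprime (k : ℤ) (ℓ : ℤ) :=
    Nat.isCoprime_iff_coprime.2 ((Nat.Prime.coprime_iff_not_dvd hp).2 hk).symm
  obtain ⟨a, b, hab⟩ := hc
  have hint : ∀ a : ℤ, OrdGE v 0 (a : L) := by
    intro a
    obtain ⟨n, rfl | rfl⟩ := a.eq_nat_or_neg
    · simpa using ordGE_natCast v n
    · simpa using (ordGE_natCast v n).neg
  have h1 : OrdGE v 1 (1 : L) := by
    have : (1 : L) = a * k + b * ℓ := by
      have := congrArg (Int.cast : ℤ → L) hab
      push_cast at this
      exact this.symm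
    rw [this]
    exact ((hint a).mul h).add ((hint b).mul hℓ)
  have := (ordEq_one (v := v)).le_of_ge h1
  omega

/-- Second-order expansion of a power of a one-unit. -/
theorem exists_one_add_pow {w : L} (hw : OrdGE v 0 w) (k : ℕ) :
    ∃ r, OrdGE v 0 r ∧ (1 + w) ^ k = 1 + k * w + w ^ 2 * r := by
  induction k with
  | zero => exact ⟨0, ordGE_zero _, by simp⟩
  | succ k ih =>
    obtain ⟨r, hr, h⟩ := ih
    refine ⟨k + r + w * r, ((ordGE_natCast v k).add hr).add (by simpa using hw.mul hr), ?_⟩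
    rw [pow_succ, h]
    push_cast; ring

theorem OrdEq.one_add (hx : OrdGE v 1 x) : OrdEq v 0 (1 + x) := ordEq_one.add_ge hx

theorem OrdEq.of_sub_one (hx : OrdGE v 1 (x - 1)) : OrdEq v 0 x := ordEq_one.of_sub hx

/-- The one-units of level `n` are closed under multiplication. -/
theorem OrdGE.mul_sub_one (hn : 0 ≤ n) (hx : OrdGE v n (x - 1)) (hy : OrdGE v n (y - 1)) :
    OrdGE v n (x * y - 1) := by
  have : x * y - 1 = (x - 1) * (y - 1) + ((x - 1) + (y - 1)) := by ring
  rw [this]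
  exact ((hx.mul hy).mono (by omega)).add (hx.add hy)

theorem OrdGE.prod_sub_one {ι : Type*} {s : Finset ι} {f : ι → L} (hn : 0 ≤ n)
    (h : ∀ i ∈ s, OrdGE v n (f i - 1)) : OrdGE v n (∏ i ∈ s, f i - 1) := by
  classical
  induction s using Finset.induction_on with
  | empty => simpa using ordGE_zero n
  | insert a s ha ih =>
    rw [prod_insert ha]
    exact (h a (mem_insert_self a s)).mul_sub_one hn (ih fun i hi => h i (mem_insert_of_mem hi))

end Ord

end RamifiedTower

/-! ### Partial traces and norms of an automorphism -/

namespace RamifiedTower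

open WithZero Finset

section Norms

variable {L : Type*} [Field L]

/-- The partial trace `x + τ x + ⋯ + τ ^ (n - 1) x`; the trace of the cyclic extension cut out by
`τ` in degree `n` when `τ ^ n` fixes `x`. -/
def trSum (τ : L ≃+* L) (n : ℕ) (x : L) : L := ∑ i ∈ range n, (τ ^ i) x

/-- The partial norm `x * τ x * ⋯ * τ ^ (n - 1) x`; the norm of the cyclic extension cut out by
`τ` in degree `n` when `τ ^ n` fixes `x`. -/
def nmProd (τ : L ≃+* L) (n : ℕ) (x : L) : L := ∏ i ∈ range n, (τ ^ i) x

variable (τ : L ≃+* L) (n : ℕ)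

theorem pow_succ_apply' (x : L) : (τ ^ (n + 1)) x = τ ((τ ^ n) x) := by
  rw [pow_succ', RingAut.mul_apply]

theorem pow_add_apply' (m : ℕ) (x : L) : (τ ^ (m + n)) x = (τ ^ m) ((τ ^ n) x) := by
  rw [pow_add, RingAut.mul_apply]

theorem pow_apply_comm (m : ℕ) (x : L) : (τ ^ m) ((τ ^ n) x) = (τ ^ n) ((τ ^ m) x) := by
  rw [← pow_add_apply', add_comm, pow_add_apply']

theorem pow_apply_eq_self {x : L} (h : τ x = x) : (τ ^ n) x = x := by
  induction n with
  | zero => simp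
  | succ n ih => rw [pow_succ_apply', ih, h]

theorem nmProd_mul (x y : L) : nmProd τ n (x * y) = nmProd τ n x * nmProd τ n y := by
  simp [nmProd, prod_mul_distrib]

theorem nmProd_one : nmProd τ n (1 : L) = 1 := by simp [nmProd]

theorem nmProd_div (x y : L) : nmProd τ n (x / y) = nmProd τ n x / nmProd τ n y := by
  simp [nmProd, prod_div_distrib]

theorem nmProd_pow (x : L) (k : ℕ) : nmProd τ n (x ^ k) = nmProd τ n x ^ k := by
  simp [nmProd, prod_pow]

theorem nmProd_ne_zero {x : L} (hx : x ≠ 0) : nmProd τ n x ≠ 0 :=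
  prod_ne_zero_iff.2 fun i _ => (map_ne_zero_iff _ (τ ^ i).injective).2 hx

theorem nmProd_of_fixed {x : L} (h : τ x = x) : nmProd τ n x = x ^ n := by
  simp [nmProd, pow_apply_eq_self τ _ h]

theorem trSum_add (x y : L) : trSum τ n (x + y) = trSum τ n x + trSum τ n y := by
  simp [trSum, sum_add_distrib]

theorem trSum_fixed_mul {c : L} (h : τ c = c) (x : L) : trSum τ n (c * x) = c * trSum τ n x := by
  simp only [trSum, map_mul, pow_apply_eq_self τ _ h, mul_sum]

theorem trSum_of_fixed {x : L} (h : τ x = x) : trSum τ n x = n * x := by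
  simp [trSum, pow_apply_eq_self τ _ h]

variable {τ n}

theorem map_trSum {x : L} (h : (τ ^ n) x = x) : τ (trSum τ n x) = trSum τ n x := by
  have h1 := sum_range_succ (fun i => (τ ^ i) x) n
  rw [sum_range_succ'] at h1
  simp only [h, pow_zero, RingAut.one_apply, pow_succ_apply'] at h1
  simpa [trSum, map_sum] using h1

theorem map_nmProd {x : L} (h : (τ ^ n) x = x) : τ (nmProd τ n x) = nmProd τ n x := by
  rcases eq_or_ne x 0 with rfl | hx
  · rcases n with _ | n <;> simp [nmProd]
  have h1 := prod_range_succ (fun i => (τ ^ i) x) n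
  rw [prod_range_succ'] at h1
  simp only [h, pow_zero, RingAut.one_apply, pow_succ_apply'] at h1
  simpa [nmProd, map_prod, hx] using h1

/-- An automorphism commutes with the partial norms of its powers. -/
theorem pow_map_nmProd (σ : L ≃+* L) (m k j : ℕ) (x : L) :
    (σ ^ k) (nmProd (σ ^ m) j x) = nmProd (σ ^ m) j ((σ ^ k) x) := by
  simp only [nmProd, map_prod, ← pow_mul]
  exact prod_congr rfl fun i _ => pow_apply_comm σ _ _ x

/-- Transitivity of norms in a cyclic tower. -/
theorem nmProd_nmProd (σ : L ≃+* L) (m k : ℕ) (x : L) :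
    nmProd σ m (nmProd (σ ^ m) k x) = nmProd σ (m * k) x := by
  induction k with
  | zero => simp [nmProd]
  | succ k ih =>
    have h1 : nmProd (σ ^ m) (k + 1) x = nmProd (σ ^ m) k x * (σ ^ (m * k)) x := by
      rw [nmProd, prod_range_succ, ← pow_mul]; rfl
    rw [h1, nmProd_mul, ih, Nat.mul_succ, nmProd, nmProd, nmProd, prod_range_add]
    congr 1
    exact prod_congr rfl fun i _ => by rw [add_comm, pow_add_apply']

/-- The difference operator `τ - 1`. -/
def delta (τ : L ≃+* L) (x : L) : L := τ x - x

theorem delta_add (x y : L) : delta τ (x + y) = delta τ x + delta τ y := by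
  rw [delta, delta, delta, map_add]; ring

theorem delta_fixed_mul {c : L} (hc : τ c = c) (x : L) : delta τ (c * x) = c * delta τ x := by
  rw [delta, delta, map_mul, hc, mul_sub]

theorem pow_map_delta (k : ℕ) (x : L) : (τ ^ k) (delta τ x) = delta τ ((τ ^ k) x) := by
  rw [delta, map_sub, delta, ← pow_succ_apply', pow_succ, RingAut.mul_apply]

theorem pow_map_delta_iterate {m : ℕ} {x : L} (h : (τ ^ m) x = x) (k : ℕ) :
    (τ ^ m) ((delta τ)^[k] x) = (delta τ)^[k] x := by
  induction k with
  | zero => simpa using h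
  | succ k ih => rw [Function.iterate_succ_apply', pow_map_delta, ih]

/-- The partial trace as a polynomial in the difference operator. -/
theorem trSum_eq_sum_delta (τ : L ≃+* L) (n : ℕ) (x : L) :
    trSum τ n x = ∑ k ∈ range n, (n.choose (k + 1) : L) * (delta τ)^[k] x := by
  let T : Module.End ℤ L := (τ : L →+* L).toAddMonoidHom.toIntLinearMap
  have hT : ∀ i y, (T ^ i) y = (τ ^ i) y := by
    intro i y
    induction i with
    | zero => simp
    | succ i ih => rw [pow_succ', Module.End.mul_apply, ih, pow_succ_apply']; rfl
  have hD : ∀ k y, ((T - 1) ^ k) y = (delta τ)^[k] y := by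
    intro k y
    rw [Module.End.pow_apply]
    rfl
  have h := congrArg (Polynomial.aeval (T - 1)) (Polynomial.geom_sum_X_comp_X_add_one_eq_sum (R := ℤ) n)
  rw [Polynomial.aeval_comp] at h
  simp only [map_add, map_sum, map_pow, Polynomial.aeval_X, map_one, sub_add_cancel, map_mul,
    map_natCast] at h
  have h2 := LinearMap.congr_fun h x
  simp only [LinearMap.sum_apply, Module.End.mul_apply, hT, hD, Module.End.natCast_apply,
    nsmul_eq_mul] at h2
  exact h2

end Norms

section Symmetric

variable {L : Type*} [Field L]

/-- The elementary symmetric polynomial of degree `k` at the conjugates of `x`. -/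
def esymmConj (τ : L ≃+* L) (n : ℕ) (x : L) (k : ℕ) : L :=
  ∑ t ∈ powersetCard k (range n), ∏ i ∈ t, (τ ^ i) x

variable (τ : L ≃+* L) (n : ℕ) (x : L)

theorem nmProd_one_add : nmProd τ n (1 + x) = ∑ k ∈ range (n + 1), esymmConj τ n x k := by
  simp only [nmProd, map_add, map_one, prod_one_add]
  rw [sum_powerset, card_range]
  rfl

theorem esymmConj_zero : esymmConj τ n x 0 = 1 := by simp [esymmConj]

theorem esymmConj_self : esymmConj τ n x n = nmProd τ n x := by
  have := powersetCard_self (range n)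
  rw [card_range] at this
  simp [esymmConj, this, nmProd]

theorem esymmConj_one : esymmConj τ n x 1 = trSum τ n x := by
  simp [esymmConj, powersetCard_one, trSum]

theorem mul_esymmConj (k : ℕ) : (k : L) * esymmConj τ n x k = (-1) ^ (k + 1) *
    ∑ a ∈ antidiagonal k with a.1 < k, (-1) ^ a.1 * esymmConj τ n x a.1 * trSum τ n (x ^ a.2) := by
  have h := congrArg (MvPolynomial.aeval (fun i : Fin n => (τ ^ (i : ℕ)) x))
    (MvPolynomial.mul_esymm_eq_sum (Fin n) ℤ k)
  have he : ∀ k, MvPolynomial.aeval (fun i : Fin n => (τ ^ (i : ℕ)) x)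
      (MvPolynomial.esymm (Fin n) ℤ k) = esymmConj τ n x k := by
    intro k
    simp only [MvPolynomial.esymm, map_sum, map_prod, MvPolynomial.aeval_X, esymmConj]
    have : powersetCard k (range n) =
        (powersetCard k (univ : Finset (Fin n))).map (mapEmbedding Fin.valEmbedding).toEmbedding := by
      rw [← powersetCard_map, Fin.map_valEmbedding_univ, Nat.Iio_eq_range]
    rw [this, sum_map]
    refine sum_congr rfl fun t _ => ?_
    simp [mapEmbedding_apply, prod_map]
  have hp : ∀ k, MvPolynomial.aeval (fun i : Fin n => (τ ^ (i : ℕ)) x)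
      (MvPolynomial.psum (Fin n) ℤ k) = trSum τ n (x ^ k) := by
    intro k
    simp only [MvPolynomial.psum, map_sum, map_pow, MvPolynomial.aeval_X, trSum]
    rw [Fin.sum_univ_eq_sum_range (fun i => ((τ ^ i) x) ^ k) n]
  simpa only [map_mul, map_natCast, map_sum, map_pow, map_neg, map_one, he, hp] using h

end Symmetric

end RamifiedTower

/-! ### Totally ramified cyclic extensions of prime degree -/

namespace RamifiedTower

open WithZero Finset

/-- A totally ramified cyclic step of prime degree `ℓ`, inside an ambient discretely valued field
`L`. The upper field is the fixed field of `τ ^ ℓ`, the lower one the fixed field of `τ`; neither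
is given as a type. The orders of the upper field are the multiples of `d`, attained by `π`, and
`t` is the ramification break of the step. -/
structure Step {L : Type*} [Field L] (v : Valuation L ℤᵐ⁰) (τ : L ≃+* L) (ℓ d t : ℕ) (π : L) :
    Prop where
  prime : ℓ.Prime
  d_pos : 0 < d
  t_pos : 0 < t
  natCast_ge : OrdGE v 1 (ℓ : L)
  map : ∀ x, v (τ x) = v x
  resid : ∀ x, OrdGE v 0 x → ∃ a, τ a = a ∧ OrdGE v 1 (x - a)
  dvd : ∀ x n, (τ ^ ℓ) x = x → OrdEq v n x → (d : ℤ) ∣ n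
  unif_fix : (τ ^ ℓ) π = π
  unif : OrdEq v d π
  brk : OrdEq v (d * (t + 1)) (delta τ π)

namespace Step

variable {L : Type*} [Field L] {v : Valuation L ℤᵐ⁰} {τ : L ≃+* L} {ℓ d t : ℕ} {π : L}
variable (h : Step v τ ℓ d t π)
include h

theorem pow_map (i : ℕ) (x : L) : v ((τ ^ i) x) = v x := by
  induction i with
  | zero => simp
  | succ i ih => rw [pow_succ_apply', h.map, ih]

theorem ordGE_pow {n : ℤ} {x : L} (hx : OrdGE v n x) (i : ℕ) : OrdGE v n ((τ ^ i) x) := by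
  rw [OrdGE, h.pow_map]; exact hx

theorem ordEq_pow {n : ℤ} {x : L} (hx : OrdEq v n x) (i : ℕ) : OrdEq v n ((τ ^ i) x) := by
  rw [OrdEq, h.pow_map]; exact hx

/-- Orders in the upper field can be rounded up to multiples of `d`. -/
theorem ordGE_round {i : ℤ} {x : L} (hx : (τ ^ ℓ) x = x) (ho : OrdGE v (d * i + 1) x) :
    OrdGE v (d * (i + 1)) x := by
  rcases eq_or_ne x 0 with rfl | hx0
  · exact ordGE_zero _
  obtain ⟨n, hn⟩ := exists_ordEq v hx0
  obtain ⟨k, rfl⟩ := h.dvd x n hx hn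
  have h1 := hn.le_of_ge ho
  have hd := h.d_pos
  have : i < k := by
    by_contra hc
    push Not at hc
    nlinarith
  refine hn.ge.mono ?_
  have : i + 1 ≤ k := this
  exact mul_le_mul_of_nonneg_left this (by positivity)

theorem exists_coeff (i : ℕ) {x : L} (hx : (τ ^ ℓ) x = x) (ho : OrdGE v (d * i) x) :
    ∃ c, τ c = c ∧ OrdGE v 0 c ∧ OrdGE v (d * (i + 1)) (x - c * π ^ i) := by
  have hp := h.unif.pow i
  have h0 : OrdGE v 0 (x / π ^ i) := (ho.div hp).mono (by linarith)
  obtain ⟨c, hc, hxc⟩ := h.resid _ h0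
  refine ⟨c, hc, ?_, ?_⟩
  · exact OrdGE.of_sub h0 (hxc.sub_swap.mono (by omega))
  · apply h.ordGE_round
    · simp only [map_sub, map_mul, map_pow, hx, h.unif_fix, pow_apply_eq_self τ ℓ hc]
    · have : x - c * π ^ i = (x / π ^ i - c) * π ^ i := by
        have := hp.ne_zero
        field_simp
      rw [this]
      exact (hxc.mul hp.ge).mono (by linarith)

theorem exists_mul_add (i : ℕ) :
    ∃ r, OrdGE v 0 r ∧ delta τ (π ^ i) = π ^ i * ((delta τ π / π) * (i + (delta τ π / π) * r)) := by
  have h0 := h.unif.ne_zero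
  have hw : OrdGE v 0 (delta τ π / π) := (h.brk.ge.div h.unif).mono (by
    have : (0 : ℤ) ≤ d * t := by positivity
    linarith)
  obtain ⟨r, hr, he⟩ := exists_one_add_pow hw i
  refine ⟨r, hr, ?_⟩
  have h1 : τ π = π * (1 + delta τ π / π) := by
    rw [delta]; field_simp; ring
  rw [delta, map_pow, h1, mul_pow, he]
  ring

theorem break_div : OrdEq v (d * t) (delta τ π / π) := by
  have := h.brk.div h.unif
  convert this using 1
  ring

theorem delta_pow_ge (i : ℕ) : OrdGE v (d * (i + t)) (delta τ (π ^ i)) := by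
  obtain ⟨r, hr, he⟩ := h.exists_mul_add i
  rw [he]
  have h1 := (ordGE_natCast v i).add ((h.break_div.ge.mul hr).mono (m := 0) (by positivity))
  refine ((h.unif.pow i).ge.mul (h.break_div.ge.mul h1)).mono ?_
  linarith

theorem delta_pow_eq {i : ℕ} (hi : ¬ ℓ ∣ i) : OrdEq v (d * (i + t)) (delta τ (π ^ i)) := by
  obtain ⟨r, hr, he⟩ := h.exists_mul_add i
  rw [he]
  have hdt : (0 : ℤ) < d * t := by exact_mod_cast Nat.mul_pos h.d_pos h.t_pos
  have h1 := (ordEq_natCast h.prime h.natCast_ge hi).add_ge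
    ((h.break_div.ge.mul hr).mono (m := 0 + 1) (by linarith))
  convert (h.unif.pow i).mul (h.break_div.mul h1) using 1
  ring

/-- The difference operator raises orders in the upper field by at least the break. -/
theorem delta_ge (i : ℕ) {x : L} (hx : (τ ^ ℓ) x = x) (ho : OrdGE v (d * i) x) :
    OrdGE v (d * (i + t)) (delta τ x) := by
  -- raise the bound one unit at a time: `x` is `c * π ^ i` with `c` in the lower field, for which
  -- the claim holds outright, up to an element of order at least `d * (i + 1)`
  suffices H : ∀ m : ℕ, m ≤ t → ∀ i : ℕ, ∀ x, (τ ^ ℓ) x = x → OrdGE v (d * i) x →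
      OrdGE v (d * (i + m)) (delta τ x) from H t le_rfl i x hx ho
  intro m
  induction m with
  | zero =>
    intro _ i x hx ho
    have := h.ordGE_pow ho 1
    rw [pow_one] at this
    rw [Nat.cast_zero, add_zero]
    exact this.sub ho
  | succ m ih =>
    intro hm i x hx ho
    obtain ⟨c, hc, hc0, hxc⟩ := h.exists_coeff i hx ho
    have hfix : (τ ^ ℓ) (x - c * π ^ i) = x - c * π ^ i := by
      simp only [map_sub, map_mul, map_pow, hx, h.unif_fix, pow_apply_eq_self τ ℓ hc]
    have h1 := ih (by omega) (i + 1) _ hfix (by push_cast; exact hxc)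
    have h2 := (hc0.mul (h.delta_pow_ge i))
    rw [← delta_fixed_mul hc] at h2
    have h3 : delta τ x = delta τ (x - c * π ^ i) + delta τ (c * π ^ i) := by
      rw [← delta_add, sub_add_cancel]
    rw [h3]
    have hm' : (m : ℤ) + 1 ≤ t := by exact_mod_cast hm
    refine (h1.mono ?_).add (h2.mono ?_)
    · push_cast; linarith
    · push_cast
      have : (d : ℤ) * (i + (m + 1)) ≤ d * (i + t) :=
        mul_le_mul_of_nonneg_left (by linarith) (by positivity)
      linarith

/-- The difference operator raises the orders prime to `ℓ` exactly by the break. -/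
theorem delta_eq {i : ℕ} (hi : ¬ ℓ ∣ i) {x : L} (hx : (τ ^ ℓ) x = x) (ho : OrdEq v (d * i) x) :
    OrdEq v (d * (i + t)) (delta τ x) := by
  obtain ⟨c, hc, hc0, hxc⟩ := h.exists_coeff i hx ho.ge
  have hfix : (τ ^ ℓ) (x - c * π ^ i) = x - c * π ^ i := by
    simp only [map_sub, map_mul, map_pow, hx, h.unif_fix, pow_apply_eq_self τ ℓ hc]
  have h1 := h.delta_ge (i + 1) hfix (by push_cast; exact hxc)
  have h3 : delta τ x = delta τ (c * π ^ i) + delta τ (x - c * π ^ i) := by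
    rw [← delta_add]; congr 1; ring
  have hd : (1 : ℤ) ≤ d := by exact_mod_cast h.d_pos
  have hcπ : OrdEq v (d * i) (c * π ^ i) :=
    ho.of_sub (hxc.sub_swap.mono (by linarith))
  have hc1 : OrdEq v 0 c := by
    convert hcπ.div (h.unif.pow i) using 1
    · ring
    · rw [mul_div_cancel_right₀ _ (h.unif.pow i).ne_zero]
  rw [h3, delta_fixed_mul hc]
  refine (by simpa using hc1.mul (h.delta_pow_eq hi) : OrdEq v _ _).add_ge (h1.mono ?_)
  push_cast
  linarith

/-- The orders of the lower field are multiples of `d * ℓ`: the step is totally ramified. -/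
theorem dvd_fixed {x : L} {n : ℤ} (hx : τ x = x) (ho : OrdEq v n x) : ((d * ℓ : ℕ) : ℤ) ∣ n := by
  -- it suffices to treat elements of nonnegative order, as one may pass to the inverse
  have key : ∀ (m : ℕ) (x : L), τ x = x → OrdEq v (d * m) x → ℓ ∣ m := by
    intro m x hx ho
    by_contra hm
    have := (h.delta_eq hm (pow_apply_eq_self τ ℓ hx) ho).ne_zero
    exact this (by rw [delta, hx, sub_self])
  obtain ⟨k, rfl⟩ := h.dvd x n (pow_apply_eq_self τ ℓ hx) ho
  obtain ⟨m, rfl | rfl⟩ := k.eq_nat_or_neg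
  · obtain ⟨j, rfl⟩ := key m x hx ho
    exact ⟨j, by push_cast; ring⟩
  · obtain ⟨j, rfl⟩ := key m x⁻¹ (by rw [map_inv₀, hx]) (by simpa using ho.inv)
    exact ⟨-j, by push_cast; ring⟩

theorem ordGE_round_fixed {i : ℤ} {x : L} (hx : τ x = x) (ho : OrdGE v (d * ℓ * i + 1) x) :
    OrdGE v (d * ℓ * (i + 1)) x := by
  rcases eq_or_ne x 0 with rfl | hx0
  · exact ordGE_zero _
  obtain ⟨n, hn⟩ := exists_ordEq v hx0
  obtain ⟨k, rfl⟩ := h.dvd_fixed hx hn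
  have h1 := hn.le_of_ge ho
  have hd : 0 < d * ℓ := Nat.mul_pos h.d_pos h.prime.pos
  have : i < k := by
    by_contra hc
    push Not at hc
    push_cast at h1
    have : (0 : ℤ) < d * ℓ := by exact_mod_cast hd
    nlinarith
  refine hn.ge.mono ?_
  push_cast
  have : i + 1 ≤ k := this
  exact mul_le_mul_of_nonneg_left this (by positivity)

theorem delta_iterate_ge (i k : ℕ) {x : L} (hx : (τ ^ ℓ) x = x) (ho : OrdGE v (d * i) x) :
    OrdGE v (d * (i + k * t)) ((delta τ)^[k] x) := by
  induction k with
  | zero => simpa using ho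
  | succ k ih =>
    rw [Function.iterate_succ_apply']
    have := h.delta_ge (i + k * t) (pow_map_delta_iterate hx k) (by push_cast; exact ih)
    convert this using 1
    push_cast; ring

theorem delta_iterate_eq (i k : ℕ) (hik : ∀ j < k, ¬ ℓ ∣ i + j * t) {x : L} (hx : (τ ^ ℓ) x = x)
    (ho : OrdEq v (d * i) x) : OrdEq v (d * (i + k * t)) ((delta τ)^[k] x) := by
  induction k with
  | zero => simpa using ho
  | succ k ih =>
    rw [Function.iterate_succ_apply']
    have := h.delta_eq (hik k (by omega)) (pow_map_delta_iterate hx k)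
      (by push_cast; exact ih fun j hj => hik j (by omega))
    convert this using 1
    push_cast; ring

/-- The partial trace is `(τ - 1) ^ (ℓ - 1)` up to `ℓ` times an integral operator whose leading
term is the identity. -/
theorem trSum_decomp (i : ℕ) {x : L} (hx : (τ ^ ℓ) x = x) (ho : OrdGE v (d * i) x) :
    ∃ r, OrdGE v (d * i + 1) r ∧ trSum τ ℓ x = (delta τ)^[ℓ - 1] x + ℓ * (x + r) := by
  have hp := h.prime.two_le
  have hdt : (1 : ℤ) ≤ d * t := by exact_mod_cast Nat.mul_pos h.d_pos h.t_pos
  obtain ⟨m, rfl⟩ : ∃ m, ℓ = m + 2 := ⟨ℓ - 2, by omega⟩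
  have hdiv : ∀ k ∈ range m, ∃ a : ℕ, (m + 2).choose (k + 1 + 1) = (m + 2) * a := by
    intro k hk
    rw [mem_range] at hk
    exact h.prime.dvd_choose_self (by omega) (by omega)
  choose! a ha using hdiv
  refine ⟨∑ k ∈ range m, a k * (delta τ)^[k + 1] x, ?_, ?_⟩
  · refine OrdGE.sum fun k _ => ?_
    refine ((ordGE_natCast v _).mul (h.delta_iterate_ge i (k + 1) hx ho)).mono ?_
    push_cast
    have : (0 : ℤ) ≤ d * t * k := by positivity
    linarith
  · rw [trSum_eq_sum_delta, sum_range_succ, sum_range_succ']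
    have : ∑ k ∈ range m, ((m + 2).choose (k + 1 + 1) : L) * (delta τ)^[k + 1] x =
        ((m + 2 : ℕ) : L) * ∑ k ∈ range m, a k * (delta τ)^[k + 1] x := by
      rw [mul_sum]
      refine sum_congr rfl fun k hk => ?_
      rw [ha k hk]; push_cast; ring
    rw [this]
    simp only [zero_add, Nat.choose_one_right, Function.iterate_zero, id_eq, Nat.choose_self,
      Nat.cast_one, one_mul, show m + 2 - 1 = m + 1 from rfl]
    ring

theorem cast_sub_one : ((ℓ - 1 : ℕ) : ℤ) = ℓ - 1 := by
  have := h.prime.pos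
  omega

/-- The break of a wild cyclic step is bounded in terms of the ramification index of `ℓ`. -/
theorem natCast_prime_ge : OrdGE v (d * ((ℓ - 1) * t)) (ℓ : L) := by
  rcases eq_or_ne (ℓ : L) 0 with h0 | h0
  · rw [h0]; exact ordGE_zero _
  obtain ⟨n, hn⟩ := exists_ordEq v h0
  obtain ⟨k, rfl⟩ := h.dvd_fixed (by simp) hn
  refine hn.ge.mono ?_
  by_contra hlt
  push Not at hlt
  obtain ⟨r, hr, htr⟩ := h.trSum_decomp 1 h.unif_fix (by simpa using h.unif.ge)
  have h1 := h.delta_iterate_ge 1 (ℓ - 1) h.unif_fix (by simpa using h.unif.ge)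
  rw [h.cast_sub_one] at h1
  have h2 := hn.mul (h.unif.add_ge (hr.mono (by simp)))
  have h3 := h2.add_ge (h1.mono (m := _ + 1) (by push_cast at *; linarith))
  rw [add_comm (_ * _) (_ : L), ← htr] at h3
  -- the trace of the uniformizer would have an order that is impossible in the lower field
  obtain ⟨j, hj⟩ := h.dvd_fixed (map_trSum h.unif_fix) h3
  have hd : (d : ℤ) ≠ 0 := by exact_mod_cast h.d_pos.ne'
  have h4 : (ℓ : ℤ) * (j - k) = 1 := by
    apply mul_left_cancel₀ hd
    push_cast at hj
    linarith
  have h5 : (ℓ : ℤ) ∣ 1 := ⟨_, h4.symm⟩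
  have h6 := Int.le_of_dvd one_pos h5
  have := h.prime.two_le
  omega

theorem trSum_ge (i : ℕ) {x : L} (hx : (τ ^ ℓ) x = x) (ho : OrdGE v (d * i) x) :
    OrdGE v (d * (i + (ℓ - 1) * t)) (trSum τ ℓ x) := by
  obtain ⟨r, hr, htr⟩ := h.trSum_decomp i hx ho
  have h1 := h.delta_iterate_ge i (ℓ - 1) hx ho
  rw [h.cast_sub_one] at h1
  rw [htr]
  refine h1.add ((h.natCast_prime_ge.mul (ho.add (hr.mono (by omega)))).mono ?_)
  linarith

theorem nmProd_eq {i : ℤ} {x : L} (ho : OrdEq v i x) : OrdEq v (ℓ * i) (nmProd τ ℓ x) := by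
  have := OrdEq.prod (s := range ℓ) (f := fun j => (τ ^ j) x) fun j _ => h.ordEq_pow ho j
  rw [card_range] at this
  exact this

theorem nmProd_ge {i : ℤ} {x : L} (ho : OrdGE v i x) : OrdGE v (ℓ * i) (nmProd τ ℓ x) := by
  have := OrdGE.prod (s := range ℓ) (f := fun j => (τ ^ j) x) fun j _ => h.ordGE_pow ho j
  rw [card_range] at this
  exact this

/-- An element of order `t` in the upper field at which the bound of `trSum_ge` is attained. -/
theorem exists_trSum_eq : ∃ θ, (τ ^ ℓ) θ = θ ∧ OrdEq v (d * t) θ ∧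
    OrdEq v (d * ℓ * t) (trSum τ ℓ θ) := by
  have hp := h.prime.two_le
  rcases h.natCast_prime_ge.lt_or_eq with hlt | heq
  · -- the operator `(τ - 1) ^ (ℓ - 1)` dominates the trace
    have hdom : ∀ (i : ℕ) x, (τ ^ ℓ) x = x → OrdEq v (d * i) x →
        OrdEq v (d * (i + (ℓ - 1 : ℕ) * t)) ((delta τ)^[ℓ - 1] x) →
        OrdEq v (d * (i + (ℓ - 1) * t)) (trSum τ ℓ x) := by
      intro i x hx ho hD
      obtain ⟨r, hr, htr⟩ := h.trSum_decomp i hx ho.ge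
      rw [htr]
      rw [h.cast_sub_one] at hD
      refine hD.add_ge ((hlt.mul (ho.ge.add (hr.mono (by omega)))).mono ?_)
      linarith
    -- if `ℓ ∣ t`, the trace of `π` would have an order not divisible by `d * ℓ`
    have hnt : ¬ ℓ ∣ t := by
      intro hdvd
      have h1 := h.delta_iterate_eq 1 (ℓ - 1) (fun j _ hj => by
        rw [← Nat.dvd_add_iff_left (hdvd.mul_left j)] at hj
        have := Nat.le_of_dvd one_pos hj
        omega) h.unif_fix (by simpa using h.unif)
      obtain ⟨k, hk⟩ := h.dvd_fixed (map_trSum h.unif_fix)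
        (hdom 1 π h.unif_fix (by simpa using h.unif) h1)
      obtain ⟨s, rfl⟩ := hdvd
      have hd : (d : ℤ) ≠ 0 := by exact_mod_cast h.d_pos.ne'
      have h4 : (ℓ : ℤ) * (k - (ℓ - 1) * s) = 1 := by
        apply mul_left_cancel₀ hd
        push_cast at hk
        linarith
      have h6 := Int.le_of_dvd one_pos ⟨_, h4.symm⟩
      omega
    have hfix : (τ ^ ℓ) (π ^ t) = π ^ t := by rw [map_pow, h.unif_fix]
    have ho : OrdEq v (d * t) (π ^ t) := by
      convert h.unif.pow t using 1
      ring
    -- the orders `t, 2 t, …, (ℓ - 1) t` are all prime to `ℓ`, so that every application of `τ - 1`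
    -- raises the order by exactly `d * t`
    refine ⟨π ^ t, hfix, ho, ?_⟩
    convert hdom t _ hfix ho (h.delta_iterate_eq t (ℓ - 1) (fun j hj hd => ?_) hfix ho) using 1
    · ring
    · rw [show t + j * t = (j + 1) * t by ring, h.prime.dvd_mul] at hd
      rcases hd with hd | hd
      · have := Nat.le_of_dvd (by omega) hd
        omega
      · exact hnt hd
  -- `ℓ` has the smallest possible order; then `ℓ ∣ t`, and an element of the lower field will do,
  -- on which the trace is multiplication by `ℓ`
  · have hdvd : ℓ ∣ t := by
      obtain ⟨k, hk⟩ := h.dvd_fixed (by simp) heq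
      have hd : (d : ℤ) ≠ 0 := by exact_mod_cast h.d_pos.ne'
      have h4 : (t : ℤ) = ℓ * (t - k) := by
        apply mul_left_cancel₀ hd
        push_cast at hk
        linarith
      exact Int.natCast_dvd_natCast.1 ⟨_, h4⟩
    obtain ⟨s, rfl⟩ := hdvd
    have hfix := map_nmProd h.unif_fix
    refine ⟨nmProd τ ℓ π ^ s, ?_, ?_, ?_⟩
    · exact pow_apply_eq_self τ ℓ (by rw [map_pow, hfix])
    · convert (h.nmProd_eq h.unif).pow s using 1
      push_cast; ring
    · rw [trSum_of_fixed _ _ (by rw [map_pow, hfix])]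
      convert heq.mul ((h.nmProd_eq h.unif).pow s) using 1
      push_cast; ring

end Step

end RamifiedTower

/-! ### The norm map on one-units in a step of prime degree -/

namespace RamifiedTower

open WithZero Finset

section

variable {L : Type*} [Field L] {v : Valuation L ℤᵐ⁰}

theorem OrdGE.prod_sub_prod {ι : Type*} {s : Finset ι} {f g : ι → L}
    (hf : ∀ i ∈ s, OrdGE v 0 (f i)) (hg : ∀ i ∈ s, OrdGE v 0 (g i))
    (h : ∀ i ∈ s, OrdGE v 1 (f i - g i)) : OrdGE v 1 (∏ i ∈ s, f i - ∏ i ∈ s, g i) := by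
  classical
  induction s using Finset.induction_on with
  | empty => simpa using ordGE_zero 1
  | insert a s ha ih =>
    have hs := fun i (hi : i ∈ s) => mem_insert_of_mem (b := a) hi
    have h1 := ih (fun i hi => hf i (hs i hi)) (fun i hi => hg i (hs i hi))
      (fun i hi => h i (hs i hi))
    have h2 := OrdGE.prod (fun i hi => hg i (hs i hi))
    have ha' := mem_insert_self a s
    rw [prod_insert ha, prod_insert ha]
    have : f a * ∏ i ∈ s, f i - g a * ∏ i ∈ s, g i =
      f a * (∏ i ∈ s, f i - ∏ i ∈ s, g i) + (f a - g a) * ∏ i ∈ s, g i := by ring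
    rw [this]
    exact (((hf a ha').mul h1).mono (by omega)).add (((h a ha').mul h2).mono (by simp))

/-- The Frobenius map is additive on the residue ring. -/
theorem OrdGE.add_pow_prime {ℓ : ℕ} (hp : ℓ.Prime) (hℓ : OrdGE v 1 (ℓ : L)) {a b : L}
    (ha : OrdGE v 0 a) (hb : OrdGE v 0 b) : OrdGE v 1 ((a + b) ^ ℓ - (a ^ ℓ + b ^ ℓ)) := by
  have key : ∀ a b : v.integer, OrdGE v 1 (((a : L) + b) ^ ℓ - ((a : L) ^ ℓ + (b : L) ^ ℓ)) := by
    intro a b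
    obtain ⟨r, hr⟩ := exists_add_pow_prime_eq hp a b
    have h1 := congrArg (Subtype.val : v.integer → L) hr
    push_cast at h1
    rw [h1]
    have hi : ∀ c : v.integer, OrdGE v 0 (c : L) := fun c => by
      have := c.2
      rw [Valuation.mem_integer_iff] at this
      simpa [OrdGE] using this
    have := ((hℓ.mul (hi a)).mul (hi b)).mul (hi r)
    rw [add_sub_cancel_left]
    exact this.mono (by norm_num)
  have hi : ∀ c : L, OrdGE v 0 c → c ∈ v.integer := fun c hc => by
    rw [Valuation.mem_integer_iff]; simpa [OrdGE] using hc
  exact key ⟨a, hi a ha⟩ ⟨b, hi b hb⟩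

theorem OrdGE.sub_pow_prime {ℓ : ℕ} (hp : ℓ.Prime) (hℓ : OrdGE v 1 (ℓ : L)) {a b : L}
    (ha : OrdGE v 0 a) (hb : OrdGE v 0 b) : OrdGE v 1 ((a - b) ^ ℓ - (a ^ ℓ - b ^ ℓ)) := by
  have h1 := (OrdGE.add_pow_prime hp hℓ (ha.sub hb) hb).neg
  convert h1 using 1
  rw [sub_add_cancel]
  ring

theorem OrdGE.of_pow {k : ℕ} {a : L} (hk : k ≠ 0) (h : OrdGE v 1 (a ^ k)) : OrdGE v 1 a := by
  rcases eq_or_ne a 0 with rfl | ha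
  · exact ordGE_zero _
  obtain ⟨n, hn⟩ := exists_ordEq v ha
  have h1 := (hn.pow k).le_of_ge h
  refine hn.ge.mono ?_
  by_contra hc
  have : n ≤ 0 := by omega
  have : (k : ℤ) * n ≤ 0 := mul_nonpos_of_nonneg_of_nonpos (by positivity) this
  omega

/-- On residues, `a ^ ℓ` determines `a`. -/
theorem OrdGE.of_pow_sub_pow {ℓ : ℕ} (hp : ℓ.Prime) (hℓ : OrdGE v 1 (ℓ : L)) {a b : L}
    (ha : OrdGE v 0 a) (hb : OrdGE v 0 b) (h : OrdGE v 1 (a ^ ℓ - b ^ ℓ)) : OrdGE v 1 (a - b) :=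
  OrdGE.of_pow hp.ne_zero (h.of_sub (OrdGE.sub_pow_prime hp hℓ ha hb))

theorem OrdGE.pow_sub_pow {k : ℕ} {a b : L} (ha : OrdGE v 0 a) (hb : OrdGE v 0 b)
    (h : OrdGE v 1 (a - b)) : OrdGE v 1 (a ^ k - b ^ k) := by
  have := OrdGE.prod_sub_prod (s := range k) (f := fun _ => a) (g := fun _ => b)
    (fun _ _ => ha) (fun _ _ => hb) (fun _ _ => h)
  simpa using this

/-- Completeness of the valuation `v`, in terms of sequences. -/
def IsVComplete (v : Valuation L ℤᵐ⁰) : Prop :=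
  ∀ f : ℕ → L, (∀ n : ℕ, OrdGE v n (f (n + 1) - f n)) → ∃ x, ∀ n : ℕ, OrdGE v n (x - f n)

/-- Successive approximation: a multiplicative map `f` which is compatible with the filtration of
one-units and onto one-units to first order is onto. The solution is sought among the elements
fixed by an isometry `ρ`. -/
theorem exists_eq_of_approx (hc : IsVComplete v) (ρ : L ≃+* L) (hρ : ∀ x, v (ρ x) = v x)
    (f : L → L) (hmul : ∀ x y, f (x * y) = f x * f y) (hone : f 1 = 1)
    (hcont : ∀ x, ∀ n : ℤ, 1 ≤ n → OrdGE v n (x - 1) → OrdGE v n (f x - 1))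
    (Y : L → Prop) (hY : ∀ y z, Y y → ρ z = z → Y (y / f z)) (n₀ c : ℤ) (h1 : 1 ≤ n₀ - c)
    (hc0 : 0 ≤ c)
    (step : ∀ n y, n₀ ≤ n → Y y → OrdGE v n (y - 1) →
      ∃ z, ρ z = z ∧ OrdGE v (n - c) (z - 1) ∧ OrdGE v (n + 1) (y / f z - 1))
    (y : L) (hy : Y y) (hyn : OrdGE v n₀ (y - 1)) :
    ∃ z, ρ z = z ∧ OrdGE v (n₀ - c) (z - 1) ∧ f z = y := by
  -- pairs (accumulated solution, remaining quotient)
  have hstep : ∀ (k : ℕ) (p : {p : L × L // ρ p.1 = p.1 ∧ OrdGE v (n₀ - c) (p.1 - 1) ∧ Y p.2 ∧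
      OrdGE v (n₀ + k) (p.2 - 1) ∧ f p.1 * p.2 = y}),
      ∃ q : {p : L × L // ρ p.1 = p.1 ∧ OrdGE v (n₀ - c) (p.1 - 1) ∧ Y p.2 ∧
      OrdGE v (n₀ + (k + 1 : ℕ)) (p.2 - 1) ∧ f p.1 * p.2 = y},
      OrdGE v k (q.1.1 - p.1.1) := by
    rintro k ⟨⟨w, u⟩, hw, hw1, hu, hun, he⟩
    obtain ⟨z, hz, hz1, hzu⟩ := step (n₀ + k) u (by omega) hu hun
    have hz0 := OrdEq.of_sub_one (hz1.mono (m := 1) (by omega))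
    have hw0 := OrdEq.of_sub_one (hw1.mono (m := 1) (by omega))
    have hfz := OrdEq.of_sub_one (hcont z _ le_rfl (hz1.mono (m := 1) (by omega)))
    refine ⟨⟨(w * z, u / f z), ?_, ?_, hY u z hu hz, ?_, ?_⟩, ?_⟩
    · simp only [map_mul] at *; rw [hw, hz]
    · exact hw1.mul_sub_one (by omega) (hz1.mono (by omega))
    · push_cast; rw [← add_assoc]; exact hzu
    · have := hfz.ne_zero
      rw [hmul]; field_simp; exact he
    · have : w * z - w = w * (z - 1) := by ring
      simp only [this]
      exact (hw0.ge.mul hz1).mono (by omega)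
  choose next hnext using hstep
  let p : (k : ℕ) → {p : L × L // ρ p.1 = p.1 ∧ OrdGE v (n₀ - c) (p.1 - 1) ∧ Y p.2 ∧
      OrdGE v (n₀ + k) (p.2 - 1) ∧ f p.1 * p.2 = y} := fun k =>
    Nat.rec ⟨(1, y), map_one ρ, by simpa using ordGE_zero _, hy, by simpa using hyn,
      by rw [hone, one_mul]⟩ (fun k q => next k q) k
  obtain ⟨w, hw⟩ := hc (fun k => (p k).1.1) (fun k => hnext k (p k))
  have hw1 : OrdGE v (n₀ - c) (w - 1) := by
    have h2 := ((hw (n₀ - c).toNat).mono (m := n₀ - c) (by omega)).add (p (n₀ - c).toNat).2.2.1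
    simpa using h2
  have hw0 := OrdEq.of_sub_one (hw1.mono (m := 1) (by omega))
  refine ⟨w, ?_, hw1, ?_⟩
  · -- the limit is fixed by `ρ`, like its approximations
    rw [← sub_eq_zero]
    refine eq_zero_of_forall_ordGE (v := v) fun n => ?_
    have h2 := (hw n.toNat).mono (m := n) (by omega)
    have h3 : OrdGE v n (ρ (w - (p n.toNat).1.1)) := by rw [OrdGE, hρ]; exact h2
    rw [map_sub, (p n.toNat).2.1] at h3
    convert h3.sub h2 using 1
    ring
  · -- the limit is a solution: `y / f w` is the product of `f (w_k / w)` and the `k`-th remaining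
    -- quotient, which both tend to one
    have hfw := OrdEq.of_sub_one (hcont w 1 le_rfl (hw1.mono (by omega)))
    suffices y / f w - 1 = 0 by
      rw [sub_eq_zero, div_eq_one_iff_eq hfw.ne_zero] at this
      exact this.symm
    refine eq_zero_of_forall_ordGE (v := v) fun n => ?_
    set k := (max n 1).toNat with hk
    have hpk := (p k).2
    set q := (p k).1 with hq
    have hq0 := OrdEq.of_sub_one (hpk.2.1.mono (m := 1) (by omega))
    have h2 : OrdGE v (max n 1) (q.1 / w - 1) := by
      have h3 := ((hw k).sub_swap.mul hw0.inv.ge).mono (m := max n 1) (by omega)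
      convert h3 using 1
      have := hw0.ne_zero
      field_simp
      rfl
    have h3 := hcont _ _ (le_max_right _ _) h2
    have h4 : f (q.1 / w) = f q.1 / f w := by
      rw [eq_div_iff hfw.ne_zero, ← hmul, div_mul_cancel₀ _ hw0.ne_zero]
    rw [h4] at h3
    have h5 := (h3.mul_sub_one (by omega) (hpk.2.2.2.1.mono (by omega))).mono (le_max_left n 1)
    convert h5 using 2
    rw [div_mul_eq_mul_div, hpk.2.2.2.2]

end

namespace Step

variable {L : Type*} [Field L] {v : Valuation L ℤᵐ⁰} {τ : L ≃+* L} {ℓ d t : ℕ} {π : L}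
variable (h : Step v τ ℓ d t π)
include h

theorem esymmConj_ge_trivial {i : ℤ} {x : L} (ho : OrdGE v i x) (k : ℕ) :
    OrdGE v (k * i) (esymmConj τ ℓ x k) := by
  refine OrdGE.sum fun s hs => ?_
  have := OrdGE.prod (s := s) (f := fun j => (τ ^ j) x) fun j _ => h.ordGE_pow ho j
  rwa [(mem_powersetCard.1 hs).2] at this

/-- The middle coefficients of the norm form are, by Newton's identities, as divisible as
traces. -/
theorem esymmConj_ge (i : ℕ) {x : L} (hx : (τ ^ ℓ) x = x) (ho : OrdGE v (d * i) x) {k : ℕ}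
    (hk : k ≠ 0) (hkℓ : k < ℓ) : OrdGE v (d * (k * i + (ℓ - 1) * t)) (esymmConj τ ℓ x k) := by
  have hu := ordEq_natCast h.prime h.natCast_ge (k := k) fun hd =>
    absurd (Nat.le_of_dvd (by omega) hd) (by omega)
  have hs : OrdGE v (d * (k * i + (ℓ - 1) * t)) ((k : L) * esymmConj τ ℓ x k) := by
    have hsign : ∀ m : ℕ, OrdGE v 0 ((-1 : L) ^ m) := fun m => by
      simpa using ((ordEq_one (v := v)).neg.pow m).ge
    rw [mul_esymmConj]
    refine ((hsign _).mul (OrdGE.sum (n := d * (k * i + (ℓ - 1) * t)) fun a ha => ?_)).mono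
      (by omega)
    simp only [mem_filter, HasAntidiagonal.mem_antidiagonal] at ha
    have h1 := h.trSum_ge (a.2 * i) (x := x ^ a.2) (by rw [map_pow, hx])
      ((ho.pow a.2).mono (by push_cast; linarith))
    refine (((hsign _).mul (h.esymmConj_ge_trivial ho a.1)).mul h1).mono ?_
    rw [← ha.1]
    push_cast
    linarith
  have := hs.div hu
  rw [mul_div_cancel_left₀ _ hu.ne_zero] at this
  exact this.mono (by omega)

/-- First-order expansion of the norm on one-units. -/
theorem nmProd_expansion (i : ℕ) {x : L} (hx : (τ ^ ℓ) x = x) (ho : OrdGE v (d * i) x) :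
    OrdGE v (d * (2 * i + (ℓ - 1) * t))
      (nmProd τ ℓ (1 + x) - (1 + trSum τ ℓ x + nmProd τ ℓ x)) := by
  have hp := h.prime.two_le
  have h1 := nmProd_one_add τ ℓ x
  have h2 : ∑ k ∈ range (ℓ + 1), esymmConj τ ℓ x k = 1 + trSum τ ℓ x + nmProd τ ℓ x +
      ∑ k ∈ range (ℓ - 2), esymmConj τ ℓ x (k + 2) := by
    obtain ⟨m, rfl⟩ : ∃ m, ℓ = m + 2 := ⟨ℓ - 2, by omega⟩
    rw [sum_range_succ, sum_range_succ', sum_range_succ', esymmConj_self, esymmConj_zero,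
      esymmConj_one]
    simp only [add_tsub_cancel_right, add_assoc]
    ring
  rw [h1, h2, add_sub_cancel_left]
  refine OrdGE.sum fun k hk => ?_
  rw [mem_range] at hk
  refine (h.esymmConj_ge i hx ho (by omega : k + 2 ≠ 0) (by omega)).mono ?_
  have : (0 : ℤ) ≤ d * (k * i) := by positivity
  push_cast
  linarith

/-- Below the break, the norm multiplies the level of a one-unit by `ℓ`. -/
theorem nmProd_one_add_eq {i : ℕ} (hi : 0 < i) (hit : i < t) {x : L} (hx : (τ ^ ℓ) x = x)
    (ho : OrdEq v (d * i) x) : OrdEq v (d * ℓ * i) (nmProd τ ℓ (1 + x) - 1) := by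
  have h1 := h.nmProd_expansion i hx ho.ge
  have h2 := h.trSum_ge i hx ho.ge
  have h3 := h.nmProd_eq ho
  have hp : (2 : ℤ) ≤ ℓ := by exact_mod_cast h.prime.two_le
  have hd : (1 : ℤ) ≤ d := by exact_mod_cast h.d_pos
  have hit' : (i : ℤ) + 1 ≤ t := by exact_mod_cast hit
  have hlt : (d : ℤ) * ℓ * i + 1 ≤ d * (i + (ℓ - 1) * t) := by
    have : (ℓ - 1) * ((i : ℤ) + 1) ≤ (ℓ - 1) * t := mul_le_mul_of_nonneg_left hit' (by linarith)
    have h4 : (ℓ : ℤ) * i + 1 ≤ i + (ℓ - 1) * t := by linarith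
    have := mul_le_mul_of_nonneg_left h4 (by linarith : (0 : ℤ) ≤ d)
    linarith
  have hlt2 : (d : ℤ) * (i + (ℓ - 1) * t) ≤ d * (2 * i + (ℓ - 1) * t) :=
    mul_le_mul_of_nonneg_left (by linarith) (by linarith)
  have h5 : nmProd τ ℓ (1 + x) - 1 = nmProd τ ℓ x + (trSum τ ℓ x +
      (nmProd τ ℓ (1 + x) - (1 + trSum τ ℓ x + nmProd τ ℓ x))) := by ring
  rw [h5]
  have h6 : OrdEq v (d * ℓ * i) (nmProd τ ℓ x) := by convert h3 using 1; ring
  exact h6.add_ge ((h2.mono hlt).add (h1.mono (hlt.trans hlt2)))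

/-- From the break on, the norm raises orders at least as much as the trace does. -/
theorem nmProd_one_add_ge {i : ℕ} (hit : t ≤ i) {x : L} (hx : (τ ^ ℓ) x = x)
    (ho : OrdGE v (d * i) x) : OrdGE v (d * (i + (ℓ - 1) * t)) (nmProd τ ℓ (1 + x) - 1) := by
  have h1 := h.nmProd_expansion i hx ho
  have h2 := h.trSum_ge i hx ho
  have h3 := h.nmProd_ge ho
  have hp : (2 : ℤ) ≤ ℓ := by exact_mod_cast h.prime.two_le
  have hit' : (t : ℤ) ≤ i := by exact_mod_cast hit
  have h5 : nmProd τ ℓ (1 + x) - 1 = nmProd τ ℓ x + (trSum τ ℓ x +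
      (nmProd τ ℓ (1 + x) - (1 + trSum τ ℓ x + nmProd τ ℓ x))) := by ring
  rw [h5]
  refine (h3.mono ?_).add (h2.add (h1.mono ?_))
  · have : (ℓ - 1) * (t : ℤ) ≤ (ℓ - 1) * i := mul_le_mul_of_nonneg_left hit' (by linarith)
    have := mul_le_mul_of_nonneg_left this (by positivity : (0 : ℤ) ≤ d)
    linarith
  · exact mul_le_mul_of_nonneg_left (by linarith) (by positivity)

theorem nmProd_sub_one_ge {n : ℤ} (hn : 1 ≤ n) {x : L} (ho : OrdGE v n (x - 1)) :
    OrdGE v n (nmProd τ ℓ x - 1) :=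
  OrdGE.prod_sub_one (by omega) fun i _ => by
    have := h.ordGE_pow ho i
    rwa [map_sub, map_one] at this

/-- Above the break, every one-unit of the lower field is a norm to first order. -/
theorem exists_nmProd_approx {n : ℤ} (hn : d * ℓ * t < n) {y : L} (hy : τ y = y)
    (ho : OrdGE v n (y - 1)) : ∃ z, (τ ^ ℓ) z = z ∧ OrdGE v (n - d * ((ℓ - 1) * t)) (z - 1) ∧
      OrdGE v (n + 1) (y / nmProd τ ℓ z - 1) := by
  rcases eq_or_ne y 1 with rfl | hy1
  · exact ⟨1, map_one _, by simpa using ordGE_zero _, by simpa [nmProd_one] using ordGE_zero _⟩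
  obtain ⟨m, hm⟩ := exists_ordEq v (sub_ne_zero.2 hy1)
  have hy' : τ (y - 1) = y - 1 := by rw [map_sub, hy, map_one]
  obtain ⟨k, rfl⟩ := h.dvd_fixed hy' hm
  have hnk := hm.le_of_ge ho
  have hp : (2 : ℤ) ≤ ℓ := by exact_mod_cast h.prime.two_le
  have hd : (1 : ℤ) ≤ d := by exact_mod_cast h.d_pos
  push_cast at hnk hm
  have htk : (t : ℤ) < k := by
    by_contra hc
    push Not at hc
    have := mul_le_mul_of_nonneg_left hc (by positivity : (0 : ℤ) ≤ d * ℓ)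
    linarith
  -- the order, in units of `d`, of the element of the upper field whose trace is `y - 1`
  obtain ⟨i, hi⟩ : ∃ i : ℕ, (i : ℤ) = ℓ * k - (ℓ - 1) * t :=
    ⟨(ℓ * k - (ℓ - 1) * t).toNat, Int.toNat_of_nonneg (by nlinarith)⟩
  obtain ⟨θ, hθ, hθo, hθt⟩ := h.exists_trSum_eq
  set c := (y - 1) / trSum τ ℓ θ with hcdef
  have hc : τ c = c := by rw [hcdef, map_div₀, hy', map_trSum hθ]
  have hx : (τ ^ ℓ) (c * θ) = c * θ := by rw [map_mul, hθ, pow_apply_eq_self τ ℓ hc]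
  have hxo : OrdEq v (d * i) (c * θ) := by
    convert (hm.div hθt).mul hθo using 1
    rw [hi]; ring
  have htr : trSum τ ℓ (c * θ) = y - 1 := by
    rw [trSum_fixed_mul _ _ hc, hcdef, div_mul_cancel₀ _ hθt.ne_zero]
  have hi1 : (t : ℤ) < i := by rw [hi]; nlinarith
  refine ⟨1 + c * θ, by rw [map_add, map_one, hx], ?_, ?_⟩
  · rw [add_sub_cancel_left]
    refine hxo.ge.mono ?_
    rw [hi]; linarith
  · have h1 := h.nmProd_expansion i hx hxo.ge
    have h2 := h.nmProd_eq hxo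
    rw [htr] at h1
    have hpos : (1 : ℤ) ≤ d * i := by nlinarith [h.t_pos]
    have hz0 := OrdEq.of_sub_one (h.nmProd_sub_one_ge (x := 1 + c * θ) le_rfl
      (by rw [add_sub_cancel_left]; exact hxo.ge.mono hpos))
    have h3 : y / nmProd τ ℓ (1 + c * θ) - 1 = -((nmProd τ ℓ (1 + c * θ) -
        (1 + (y - 1) + nmProd τ ℓ (c * θ)) + nmProd τ ℓ (c * θ)) / nmProd τ ℓ (1 + c * θ)) := by
      have := hz0.ne_zero
      field_simp
      ring
    rw [h3]
    -- since `k > t`, both the error of the first-order expansion and the norm of `c * θ` are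
    -- negligible
    refine (((h1.mono ?_).add (h2.ge.mono ?_)).div hz0).neg.mono (m := n + 1) (n := n + 1 - 0)
      (by omega)
    · have : (d : ℤ) * (2 * i + (ℓ - 1) * t) = d * i + d * ℓ * k := by rw [hi]; ring
      linarith
    · have h4 : (ℓ : ℤ) * (d * i) - d * ℓ * k = d * ℓ * (ℓ - 1) * (k - t) := by rw [hi]; ring
      have h5 : (1 : ℤ) ≤ d * ℓ * (ℓ - 1) * (k - t) := by
        have : (0 : ℤ) < d * ℓ * (ℓ - 1) * (k - t) := by
          apply mul_pos (mul_pos (mul_pos _ _) _) <;> linarith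
        linarith
      linarith

/-- Above the break, every one-unit of the lower field is a norm. -/
theorem exists_nmProd_eq (hc : IsVComplete v) {n : ℤ} (hn : d * ℓ * t < n) {y : L}
    (hy : τ y = y) (ho : OrdGE v n (y - 1)) :
    ∃ z, (τ ^ ℓ) z = z ∧ OrdGE v (n - d * ((ℓ - 1) * t)) (z - 1) ∧ nmProd τ ℓ z = y := by
  have hdt : (1 : ℤ) ≤ d * t := by exact_mod_cast Nat.mul_pos h.d_pos h.t_pos
  have hp : (2 : ℤ) ≤ ℓ := by exact_mod_cast h.prime.two_le
  refine exists_eq_of_approx hc (τ ^ ℓ) (h.pow_map ℓ) (nmProd τ ℓ) (nmProd_mul τ ℓ)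
    (nmProd_one τ ℓ) (fun x m hm => h.nmProd_sub_one_ge hm) (fun y => τ y = y)
    (fun y z hy hz => by rw [map_div₀, hy, map_nmProd hz]) n _ (by linarith) ?_
    (fun m y hm hy hym => h.exists_nmProd_approx (lt_of_lt_of_le hn hm) hy hym) y hy ho
  have : (0 : ℤ) ≤ d * t * (ℓ - 1) := mul_nonneg (by linarith) (by linarith)
  linarith

/-- If the residue field is perfect, units of the lower field are norms up to one-units whose
level is the break. -/
theorem exists_div_nmProd (hperf : ∀ a, OrdGE v 0 a → ∃ b, τ b = b ∧ OrdGE v 1 (b ^ ℓ - a))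
    {y : L} (hy : τ y = y) (ho : OrdEq v 0 y) :
    ∃ z, (τ ^ ℓ) z = z ∧ OrdEq v 0 z ∧ OrdGE v (d * ℓ * t) (y / nmProd τ ℓ z - 1) := by
  suffices H : ∀ j : ℕ, j ≤ t → ∃ z, (τ ^ ℓ) z = z ∧ OrdEq v 0 z ∧
      OrdGE v (d * ℓ * j) (y / nmProd τ ℓ z - 1) from H t le_rfl
  have hp : (2 : ℤ) ≤ ℓ := by exact_mod_cast h.prime.two_le
  have hd : (1 : ℤ) ≤ d := by exact_mod_cast h.d_pos
  intro j
  induction j with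
  | zero =>
    intro _
    exact ⟨1, map_one _, ordEq_one, by simpa [nmProd_one] using ho.ge.sub ordEq_one.ge⟩
  | succ j ih =>
    intro hj
    obtain ⟨z, hz, hz0, hzy⟩ := ih (by omega)
    set y' := y / nmProd τ ℓ z with hy'
    have hN0 : OrdEq v 0 (nmProd τ ℓ z) := by simpa using h.nmProd_eq hz0
    have hy'f : τ y' = y' := by rw [hy', map_div₀, hy, map_nmProd hz]
    have hy'0 : OrdEq v 0 y' := by simpa using ho.div hN0
    -- it suffices to improve the approximation by one unit of order
    suffices H : ∃ z', (τ ^ ℓ) z' = z' ∧ OrdEq v 0 z' ∧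
        OrdGE v (d * ℓ * j + 1) (y' - nmProd τ ℓ z') by
      obtain ⟨z', hz', hz'0, hzy'⟩ := H
      have hN0' : OrdEq v 0 (nmProd τ ℓ z') := by simpa using h.nmProd_eq hz'0
      refine ⟨z * z', by rw [map_mul, hz, hz'], by simpa using hz0.mul hz'0, ?_⟩
      have h1 : y / nmProd τ ℓ (z * z') - 1 = (y' - nmProd τ ℓ z') / nmProd τ ℓ z' := by
        have := hN0.ne_zero
        have := hN0'.ne_zero
        rw [nmProd_mul, hy']
        field_simp
      rw [h1]
      push_cast
      refine h.ordGE_round_fixed ?_ (by simpa using hzy'.div hN0')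
      rw [map_div₀, map_sub, hy'f, map_nmProd hz']
    rcases Nat.eq_zero_or_pos j with rfl | hj0
    · -- on residues of units the norm from the upper field is the `ℓ`-th power
      obtain ⟨b, hb, hby⟩ := hperf y' hy'0.ge
      have hb0 : OrdEq v 0 (b ^ ℓ) := hy'0.of_sub (by simpa using hby)
      have hbne : b ≠ 0 := by
        rintro rfl
        exact hb0.ne_zero (zero_pow h.prime.ne_zero)
      obtain ⟨m, hm⟩ := exists_ordEq v hbne
      have hm0 : m = 0 := by
        have := (hm.pow ℓ).unique hb0
        have hℓ : (ℓ : ℤ) ≠ 0 := by linarith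
        exact (mul_eq_zero.1 this).resolve_left hℓ
      subst hm0
      refine ⟨b, pow_apply_eq_self τ ℓ hb, hm, ?_⟩
      rw [nmProd_of_fixed τ ℓ hb]
      simpa using hby.sub_swap
    · -- below the break, `1 + b π ^ j` has norm `1 + b ^ ℓ N(π) ^ j` to first order
      have hν := (h.nmProd_eq h.unif).pow j
      have hνf := map_nmProd h.unif_fix
      have hc0 : OrdGE v 0 ((y' - 1) / nmProd τ ℓ π ^ j) := by
        refine (hzy.div hν).mono ?_
        linarith
      obtain ⟨b, hb, hbc⟩ := hperf _ hc0
      have hb0 : OrdGE v 0 b := by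
        rcases eq_or_ne b 0 with rfl | hbne
        · exact ordGE_zero _
        obtain ⟨m, hm⟩ := exists_ordEq v hbne
        have h1 : OrdGE v 0 (b ^ ℓ) := hc0.of_sub (hbc.mono (by omega))
        have := (hm.pow ℓ).le_of_ge h1
        refine hm.ge.mono ?_
        by_contra hc
        push Not at hc
        nlinarith
      have hx : (τ ^ ℓ) (b * π ^ j) = b * π ^ j := by
        rw [map_mul, map_pow, h.unif_fix, pow_apply_eq_self τ ℓ hb]
      have hxo : OrdGE v (d * j) (b * π ^ j) :=
        (hb0.mul (h.unif.pow j).ge).mono (by linarith)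
      have hj' : (j : ℤ) + 1 ≤ t := by exact_mod_cast hj
      have hj1 : (1 : ℤ) ≤ j := by exact_mod_cast hj0
      have hlt : (d : ℤ) * ℓ * j + 1 ≤ d * (j + (ℓ - 1) * t) := by
        have : (ℓ - 1) * ((j : ℤ) + 1) ≤ (ℓ - 1) * t :=
          mul_le_mul_of_nonneg_left hj' (by linarith)
        have h4 : (ℓ : ℤ) * j + 1 ≤ j + (ℓ - 1) * t := by linarith
        have := mul_le_mul_of_nonneg_left h4 (by linarith : (0 : ℤ) ≤ d)
        linarith
      have hlt2 : (d : ℤ) * (j + (ℓ - 1) * t) ≤ d * (2 * j + (ℓ - 1) * t) :=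
        mul_le_mul_of_nonneg_left (by linarith) (by linarith)
      have h1 := (h.nmProd_expansion j hx hxo).mono (hlt.trans hlt2)
      have h2 := (h.trSum_ge j hx hxo).mono hlt
      have h3 : OrdGE v (d * ℓ * j + 1)
          ((b ^ ℓ - (y' - 1) / nmProd τ ℓ π ^ j) * nmProd τ ℓ π ^ j) :=
        (hbc.mul hν.ge).mono (by linarith)
      refine ⟨1 + b * π ^ j, by rw [map_add, map_one, hx], OrdEq.one_add (hxo.mono ?_), ?_⟩
      · nlinarith
      · have h4 : nmProd τ ℓ (b * π ^ j) = b ^ ℓ * nmProd τ ℓ π ^ j := by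
          rw [nmProd_mul, nmProd_pow, nmProd_of_fixed τ ℓ hb]
        have h5 : y' - nmProd τ ℓ (1 + b * π ^ j) =
            -((nmProd τ ℓ (1 + b * π ^ j) - (1 + trSum τ ℓ (b * π ^ j) +
              nmProd τ ℓ (b * π ^ j))) + trSum τ ℓ (b * π ^ j) +
              (b ^ ℓ - (y' - 1) / nmProd τ ℓ π ^ j) * nmProd τ ℓ π ^ j) := by
          have := hν.ne_zero
          rw [h4, sub_mul, div_mul_cancel₀ _ this]
          ring
        rw [h5]
        exact ((h1.add h2).add h3).neg

end Step

end RamifiedTower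

/-! ### One-units at the break which are not norms -/

namespace RamifiedTower

open WithZero Finset

namespace Step

variable {L : Type*} [Field L] {v : Valuation L ℤᵐ⁰} {τ : L ≃+* L} {ℓ d t : ℕ} {π : L}
variable (h : Step v τ ℓ d t π)
include h

/-- At the break, the norm is given on residues by an additive polynomial of degree `ℓ`. -/
theorem nmProd_at_break {θ : L} (hθ : (τ ^ ℓ) θ = θ) (hθo : OrdEq v (d * t) θ) {x a : L}
    (hx : (τ ^ ℓ) x = x) (hxo : OrdGE v (d * t) x) (ha : τ a = a)
    (hxa : OrdGE v 1 (x / θ - a)) :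
    OrdGE v (d * ℓ * t + 1) (nmProd τ ℓ (1 + x) - 1 -
      (a ^ ℓ + trSum τ ℓ θ / nmProd τ ℓ θ * a) * nmProd τ ℓ θ) := by
  have hp : (2 : ℤ) ≤ ℓ := by exact_mod_cast h.prime.two_le
  have hd : (1 : ℤ) ≤ d := by exact_mod_cast h.d_pos
  have ht : (1 : ℤ) ≤ t := by exact_mod_cast h.t_pos
  have hν := h.nmProd_eq hθo
  have hθ0 := hθo.ne_zero
  have h0 : OrdGE v 0 (x / θ) := by simpa using hxo.div hθo
  have ha0 : OrdGE v 0 a := h0.of_sub (hxa.sub_swap.mono (by omega))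
  have h1 := h.nmProd_expansion t hx hxo
  -- the trace term
  have hfix : (τ ^ ℓ) (x - a * θ) = x - a * θ := by
    rw [map_sub, map_mul, hx, hθ, pow_apply_eq_self τ ℓ ha]
  have hr : OrdGE v (d * ((t + 1 : ℕ) : ℤ)) (x - a * θ) := by
    push_cast
    refine h.ordGE_round hfix ?_
    have : x - a * θ = (x / θ - a) * θ := by field_simp
    rw [this]
    exact (hxa.mul hθo.ge).mono (by linarith)
  have h2 := h.trSum_ge _ hfix hr
  have h3 : trSum τ ℓ x = trSum τ ℓ (x - a * θ) + a * trSum τ ℓ θ := by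
    rw [← trSum_fixed_mul τ ℓ ha, ← trSum_add, sub_add_cancel]
  -- the norm term
  have h4 : OrdGE v 1 (nmProd τ ℓ (x / θ) - a ^ ℓ) := by
    have := OrdGE.prod_sub_prod (s := range ℓ) (f := fun i => (τ ^ i) (x / θ)) (g := fun _ => a)
      (fun i _ => h.ordGE_pow h0 i) (fun _ _ => ha0) (fun i _ => by
        have := h.ordGE_pow hxa i
        rwa [map_sub, pow_apply_eq_self τ i ha] at this)
    rwa [prod_const, card_range] at this
  have h5 : nmProd τ ℓ x = nmProd τ ℓ (x / θ) * nmProd τ ℓ θ := by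
    rw [← nmProd_mul, div_mul_cancel₀ _ hθ0]
  have h6 : nmProd τ ℓ (1 + x) - 1 -
      (a ^ ℓ + trSum τ ℓ θ / nmProd τ ℓ θ * a) * nmProd τ ℓ θ =
      (nmProd τ ℓ (1 + x) - (1 + trSum τ ℓ x + nmProd τ ℓ x)) + trSum τ ℓ (x - a * θ) +
      (nmProd τ ℓ (x / θ) - a ^ ℓ) * nmProd τ ℓ θ := by
    have := hν.ne_zero
    rw [h3, h5]
    field_simp
    ring
  rw [h6]
  have hdt : (1 : ℤ) ≤ d * t := by nlinarith
  refine ((h1.mono ?_).add (h2.mono ?_)).add ((h4.mul hν.ge).mono ?_)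
  · linarith
  · push_cast; linarith
  · linarith

/-- If `a ^ ℓ - a` does not represent all residues, there is a one-unit of the lower field whose
level is the break and which is not a norm. -/
theorem exists_not_nmProd
    (hAS : ∃ c, τ c = c ∧ OrdGE v 0 c ∧ ∀ a, OrdGE v 0 a → ¬ OrdGE v 1 (a ^ ℓ - a - c)) :
    ∃ y, τ y = y ∧ OrdGE v (d * ℓ * t) (y - 1) ∧ ∀ z, (τ ^ ℓ) z = z → nmProd τ ℓ z ≠ y := by
  obtain ⟨c, hc, hc0, hAS⟩ := hAS
  have hp : (2 : ℤ) ≤ ℓ := by exact_mod_cast h.prime.two_le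
  have hd : (1 : ℤ) ≤ d := by exact_mod_cast h.d_pos
  have ht : (1 : ℤ) ≤ t := by exact_mod_cast h.t_pos
  have hdt : (1 : ℤ) ≤ d * t := by nlinarith
  obtain ⟨θ, hθ, hθo, hθt⟩ := h.exists_trSum_eq
  have hν : OrdEq v (d * ℓ * t) (nmProd τ ℓ θ) := by
    convert h.nmProd_eq hθo using 1; ring
  have hνf := map_nmProd hθ
  set ν := nmProd τ ℓ θ with hνdef
  set β := trSum τ ℓ θ / ν with hβ
  -- the conjugate of the uniformizer has norm one, so that the additive polynomial has a root
  set w := delta τ π / π with hw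
  have hwf : (τ ^ ℓ) w = w := by
    rw [hw, map_div₀, pow_map_delta, h.unif_fix]
  have hwo : OrdEq v (d * t) w := h.break_div
  have hw1 : 1 + w = τ π / π := by
    have := h.unif.ne_zero
    rw [hw, delta]; field_simp; ring
  have hNw : nmProd τ ℓ (1 + w) = 1 := by
    have h1 := pow_map_nmProd τ 1 1 ℓ π
    rw [pow_one] at h1
    rw [hw1, nmProd_div, ← h1, map_nmProd h.unif_fix,
      div_self (nmProd_ne_zero τ ℓ h.unif.ne_zero)]
  have hwθ : OrdEq v 0 (w / θ) := by simpa using hwo.div hθo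
  obtain ⟨γ, hγ, hγw⟩ := h.resid _ hwθ.ge
  have hγ0 : OrdEq v 0 γ := hwθ.of_sub (by simpa using hγw.sub_swap)
  have hroot : OrdGE v 1 (γ ^ ℓ + β * γ) := by
    have h1 := h.nmProd_at_break hθ hθo hwf hwo.ge hγ hγw
    rw [hNw, sub_self, zero_sub] at h1
    have h2 := (h1.neg.div hν).mono (m := 1) (by linarith)
    rwa [neg_neg, mul_div_cancel_right₀ _ hν.ne_zero] at h2
  have hβγ : OrdGE v 1 (γ ^ (ℓ - 1) + β) := by
    have h1 := hroot.div hγ0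
    have h2 : (γ ^ ℓ + β * γ) / γ = γ ^ (ℓ - 1) + β := by
      have := hγ0.ne_zero
      rw [← Nat.sub_add_cancel h.prime.one_le, pow_succ, Nat.sub_add_cancel h.prime.one_le]
      field_simp
    rw [h2] at h1
    simpa using h1
  have hγℓ : OrdEq v 0 (γ ^ ℓ) := by simpa using hγ0.pow ℓ
  refine ⟨1 + γ ^ ℓ * c * ν, ?_, ?_, ?_⟩
  · rw [map_add, map_one, map_mul, map_mul, map_pow, hγ, hc, hνf]
  · rw [add_sub_cancel_left]
    exact ((hγℓ.ge.mul hc0).mul hν.ge).mono (by linarith)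
  intro z hz hNz
  have hN1 : OrdGE v (d * ℓ * t) (nmProd τ ℓ z - 1) := by
    rw [hNz, add_sub_cancel_left]
    exact ((hγℓ.ge.mul hc0).mul hν.ge).mono (by linarith)
  have hdℓt : (1 : ℤ) ≤ d * ℓ * t := by nlinarith
  have hN0 := OrdEq.of_sub_one (hN1.mono hdℓt)
  have hzne : z ≠ 0 := by
    rintro rfl
    refine hN0.ne_zero (prod_eq_zero (mem_range.2 h.prime.pos) (map_zero _))
  -- `z` is a one-unit
  obtain ⟨m, hm⟩ := exists_ordEq v hzne
  have hm0 : m = 0 := by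
    have := (h.nmProd_eq hm).unique hN0
    exact (mul_eq_zero.1 this).resolve_left (by linarith)
  subst hm0
  have hz1 : OrdGE v 1 (z - 1) := by
    obtain ⟨a, ha, hza⟩ := h.resid z hm.ge
    have ha0 : OrdGE v 0 a := hm.ge.of_sub (hza.sub_swap.mono (by omega))
    have h4 : OrdGE v 1 (nmProd τ ℓ z - a ^ ℓ) := by
      have := OrdGE.prod_sub_prod (s := range ℓ) (f := fun i => (τ ^ i) z) (g := fun _ => a)
        (fun i _ => h.ordGE_pow hm.ge i) (fun _ _ => ha0) (fun i _ => by
          have := h.ordGE_pow hza i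
          rwa [map_sub, pow_apply_eq_self τ i ha] at this)
      rwa [prod_const, card_range] at this
    have h5 : OrdGE v 1 (a ^ ℓ - 1 ^ ℓ) := by
      have := (hN1.mono hdℓt).sub h4
      convert this using 1
      rw [one_pow]; ring
    have h6 := OrdGE.of_pow_sub_pow h.prime h.natCast_ge ha0 ordEq_one.ge h5
    convert hza.add h6 using 1
    ring
  -- its level is at least the break
  have hzt : OrdGE v (d * t) (z - 1) := by
    rcases eq_or_ne z 1 with rfl | hz1'
    · simpa using ordGE_zero _
    obtain ⟨m, hm'⟩ := exists_ordEq v (sub_ne_zero.2 hz1')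
    have hfix : (τ ^ ℓ) (z - 1) = z - 1 := by rw [map_sub, map_one, hz]
    obtain ⟨k, rfl⟩ := h.dvd _ _ hfix hm'
    have hk0 : 0 < k := by
      have := hm'.le_of_ge hz1
      by_contra hc
      push Not at hc
      nlinarith
    lift k to ℕ using hk0.le
    by_cases hkt : k < t
    · have h1 := h.nmProd_one_add_eq (by exact_mod_cast hk0) hkt hfix hm'
      rw [add_sub_cancel] at h1
      have h2 := h1.le_of_ge hN1
      have h3 : (k : ℤ) < t := by exact_mod_cast hkt
      have h4 : (0 : ℤ) < d * ℓ := by nlinarith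
      have := mul_lt_mul_of_pos_left h3 h4
      linarith
    · push Not at hkt
      refine hm'.ge.mono ?_
      have h3 : (t : ℤ) ≤ k := by exact_mod_cast hkt
      exact mul_le_mul_of_nonneg_left h3 (by linarith)
  have hfix : (τ ^ ℓ) (z - 1) = z - 1 := by rw [map_sub, map_one, hz]
  have h0 : OrdGE v 0 ((z - 1) / θ) := by simpa using hzt.div hθo
  obtain ⟨a, ha, haz⟩ := h.resid _ h0
  have ha0 : OrdGE v 0 a := h0.of_sub (haz.sub_swap.mono (by omega))
  have h1 := h.nmProd_at_break hθ hθo hfix hzt ha haz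
  rw [add_sub_cancel, hNz, add_sub_cancel_left, ← sub_mul] at h1
  have h2 := (h1.div hν).mono (m := 1) (by linarith)
  rw [mul_div_cancel_right₀ _ hν.ne_zero] at h2
  -- rescaling by the root turns the additive polynomial into `a ^ ℓ - a`
  have h3 : OrdGE v 1 (a ^ ℓ - γ ^ (ℓ - 1) * a - γ ^ ℓ * c) := by
    have := ((hβγ.mul ha0).mono (m := 1) (by omega)).add h2
    convert this.neg using 1
    ring
  have h4 := h3.div hγℓ
  refine hAS (a / γ) (by simpa using ha0.div hγ0) ?_
  have h5 : (a ^ ℓ - γ ^ (ℓ - 1) * a - γ ^ ℓ * c) / γ ^ ℓ = (a / γ) ^ ℓ - a / γ - c := by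
    have := hγ0.ne_zero
    have h6 : γ ^ ℓ = γ ^ (ℓ - 1) * γ := by
      rw [← pow_succ, Nat.sub_add_cancel h.prime.one_le]
    rw [div_pow, sub_div, sub_div, mul_div_cancel_left₀ _ hγℓ.ne_zero]
    congr 2
    rw [h6]
    field_simp
  rw [h5] at h4
  simpa using h4

end Step

end RamifiedTower

/-! ### Hilbert 90 and norms in cyclic towers -/

namespace RamifiedTower

open WithZero Finset

section Hilbert

variable {L : Type*} [Field L]

theorem nmProd_zpow (τ : L ≃+* L) (n : ℕ) (x : L) (k : ℤ) :
    nmProd τ n (x ^ k) = nmProd τ n x ^ k := by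
  simp only [nmProd, map_zpow₀, prod_zpow]

theorem map_nmProd_mul (τ : L ≃+* L) (n : ℕ) (x : L) :
    τ (nmProd τ n x) * x = nmProd τ n x * (τ ^ n) x := by
  have h1 := prod_range_succ (fun i => (τ ^ i) x) n
  rw [prod_range_succ'] at h1
  simp only [pow_zero, RingAut.one_apply, pow_succ_apply'] at h1
  rw [nmProd, map_prod]
  exact h1

theorem nmProd_div_map (τ : L ≃+* L) (n : ℕ) {b : L} (hb : b ≠ 0) :
    nmProd τ n (b / τ b) = b / (τ ^ n) b := by
  have hb' : ∀ k, (τ ^ k) b ≠ 0 := fun k => (map_ne_zero_iff _ (τ ^ k).injective).2 hb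
  induction n with
  | zero => rw [nmProd, range_zero, prod_empty, pow_zero, RingAut.one_apply, div_self hb]
  | succ n ih =>
    rw [nmProd, prod_range_succ, ← nmProd, ih, map_div₀, ← RingAut.mul_apply, ← pow_succ]
    have := hb' n
    have := hb' (n + 1)
    field_simp

theorem nmProd_comm (σ : L ≃+* L) (m k : ℕ) (x : L) :
    nmProd (σ ^ m) k (nmProd σ m x) = nmProd σ (m * k) x := by
  rw [← nmProd_nmProd]
  simp only [nmProd, map_prod, ← pow_mul]
  rw [prod_comm]
  exact prod_congr rfl fun i _ => prod_congr rfl fun j _ => pow_apply_comm σ _ _ x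

/-- The conjugates of `p` are distinct if no proper divisor of the degree fixes `p`. -/
theorem pow_apply_injective (τ : L ≃+* L) {q : ℕ} {p : L} (hq : (τ ^ q) p = p)
    (hp : ∀ r, r ∣ q → r ≠ q → (τ ^ r) p ≠ p) :
    Function.Injective fun i : Fin q => (τ ^ (i : ℕ)) p := by
  have key : ∀ i j : ℕ, i < j → j < q → (τ ^ i) p ≠ (τ ^ j) p := by
    intro i j hij hj he
    have h1 : (τ ^ (j - i)) p = p := by
      apply (τ ^ i).injective
      rw [← pow_add_apply', Nat.add_sub_cancel' hij.le, he]
    have h2 : Function.IsPeriodicPt τ (j - i) p := by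
      rw [RingAut.coe_pow] at h1; exact h1
    have h3 : Function.IsPeriodicPt τ q p := by
      rw [RingAut.coe_pow] at hq; exact hq
    have h4 := h2.gcd h3
    refine hp _ (Nat.gcd_dvd_right (j - i) q) ?_ (by rw [RingAut.coe_pow]; exact h4)
    intro h5
    have := Nat.le_of_dvd (by omega) (h5 ▸ Nat.gcd_dvd_left (j - i) q)
    omega
  intro i j hij
  rcases lt_trichotomy (i : ℕ) j with h | h | h
  · exact absurd hij (key _ _ h j.2)
  · exact Fin.ext h
  · exact absurd hij.symm (key _ _ h i.2)

/-- Hilbert 90 for the cyclic extension of degree `q` cut out by `τ`; the nonvanishing of the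
resolvent of some power of `p` is a Vandermonde argument. -/
theorem exists_mul_map_eq (τ : L ≃+* L) {q : ℕ} {p w : L} (hq : (τ ^ q) p = p) (hq0 : 0 < q)
    (hp : ∀ r, r ∣ q → r ≠ q → (τ ^ r) p ≠ p) (hw : (τ ^ q) w = w) (hN : nmProd τ q w = 1) :
    ∃ b, b ≠ 0 ∧ (τ ^ q) b = b ∧ w * τ b = b := by
  -- the Lagrange resolvent
  let res : L → L := fun a => ∑ i ∈ range q, nmProd τ i w * (τ ^ i) a
  have hres : ∃ k : ℕ, res (p ^ k) ≠ 0 := by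
    by_contra! hc
    have h1 := Matrix.eq_zero_of_forall_pow_sum_mul_pow_eq_zero (R := L)
      (f := fun i : Fin q => (τ ^ (i : ℕ)) p) (v := fun i : Fin q => nmProd τ i w)
      (pow_apply_injective τ hq hp) (fun k => by
        have := hc k
        simp only [res, map_pow] at this
        rw [Fin.sum_univ_eq_sum_range (fun i => nmProd τ i w * (τ ^ i) p ^ (k : ℕ)) q]
        exact this)
    have h2 := congrFun h1 ⟨0, hq0⟩
    simp [nmProd] at h2
  obtain ⟨k, hk⟩ := hres
  have hpk : (τ ^ q) (p ^ k) = p ^ k := by rw [map_pow, hq]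
  refine ⟨_, hk, ?_, ?_⟩
  · simp only [res, map_sum, map_mul]
    refine sum_congr rfl fun i _ => ?_
    rw [pow_apply_comm τ, hpk]
    congr 1
    simp only [nmProd, map_prod]
    exact prod_congr rfl fun j _ => by rw [pow_apply_comm τ, hw]
  · simp only [res, map_sum, map_mul, mul_sum, ← pow_succ_apply']
    have h1 : ∀ i, w * (τ (nmProd τ i w) * (τ ^ (i + 1)) (p ^ k)) =
        nmProd τ (i + 1) w * (τ ^ (i + 1)) (p ^ k) := by
      intro i
      rw [← mul_assoc, mul_comm w, map_nmProd_mul]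
      congr 1
      rw [nmProd, nmProd, prod_range_succ]
    simp only [h1]
    have h2 := sum_range_succ (fun i => nmProd τ i w * (τ ^ i) (p ^ k)) q
    rw [sum_range_succ', hN, hpk] at h2
    simpa [nmProd] using h2

/-- In a cyclic tower, an element of the bottom field whose `ℓ`-th power is a norm from the top
field, of degree `ℓ` over the middle one, is a norm from the middle field. -/
theorem exists_nmProd_of_pow (σ : L ≃+* L) {m ℓ : ℕ} {p y z : L} (hℓ : ℓ.Prime)
    (hp : ((σ ^ m) ^ ℓ) p = p) (hpm : (σ ^ m) p ≠ p) (hy : σ y = y) (hy0 : y ≠ 0)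
    (hz : ((σ ^ m) ^ ℓ) z = z) (hN : nmProd σ (m * ℓ) z = y ^ ℓ) :
    ∃ c, (σ ^ m) c = c ∧ nmProd σ m c = y := by
  set T := nmProd σ m z with hT
  have hTℓ : nmProd (σ ^ m) ℓ T = y ^ ℓ := by rw [hT, nmProd_comm, hN]
  have hz0 : z ≠ 0 := by
    rintro rfl
    have h1 : nmProd (σ ^ m) ℓ T = 0 := by
      rcases Nat.eq_zero_or_pos m with rfl | hm
      · simp at hpm
      · have : T = 0 := prod_eq_zero (mem_range.2 hm) (map_zero _)
        rw [this]
        exact prod_eq_zero (mem_range.2 hℓ.pos) (map_zero _)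
    rw [hTℓ] at h1
    exact pow_ne_zero _ hy0 h1
  have hT0 : T ≠ 0 := nmProd_ne_zero σ m hz0
  have hTf : ((σ ^ m) ^ ℓ) T = T := by
    rw [hT, ← pow_mul, nmProd, map_prod]
    refine prod_congr rfl fun i _ => ?_
    rw [pow_apply_comm, pow_mul, hz]
  have hw : ((σ ^ m) ^ ℓ) (y / T) = y / T := by
    rw [map_div₀, hTf, ← pow_mul, pow_apply_eq_self σ _ hy]
  have hw1 : nmProd (σ ^ m) ℓ (y / T) = 1 := by
    rw [nmProd_div, hTℓ, nmProd_of_fixed _ _ (pow_apply_eq_self σ _ hy),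
      div_self (pow_ne_zero _ hy0)]
  obtain ⟨b, hb0, hb, hwb⟩ := exists_mul_map_eq (σ ^ m) hp hℓ.pos (fun r hr hrℓ => by
    rcases (Nat.dvd_prime hℓ).1 hr with rfl | rfl
    · rwa [pow_one]
    · exact absurd rfl hrℓ) hw hw1
  have hσb : σ b ≠ 0 := (map_ne_zero_iff _ σ.injective).2 hb0
  have hσmb : (σ ^ m) b ≠ 0 := (map_ne_zero_iff _ (σ ^ m).injective).2 hb0
  -- `y / T = b / σ ^ m b` by Hilbert 90, and `b / σ ^ m b` is the norm of `b / σ b`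
  have hyc : nmProd σ m (z * (b / σ b)) = y := by
    rw [nmProd_mul, nmProd_div_map σ m hb0, ← hT]
    field_simp at hwb ⊢
    rw [← hwb]
  refine ⟨_, ?_, hyc⟩
  -- an element whose norm is fixed by `σ` lies in the middle field
  have h1 := map_nmProd_mul σ m (z * (b / σ b))
  rw [hyc, hy] at h1
  exact (mul_left_cancel₀ hy0 h1).symm

end Hilbert

section Powers

variable {L : Type*} [Field L] {v : Valuation L ℤᵐ⁰}

theorem OrdGE.one_add_pow_prime {ℓ : ℕ} (hp : ℓ.Prime) {E s : ℤ} (hE : OrdGE v E (ℓ : L))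
    (hs : 0 ≤ s) {b : L} (hb : OrdGE v s b) :
    OrdGE v (min (E + 2 * s) (ℓ * s)) ((1 + b) ^ ℓ - (1 + ℓ * b)) := by
  obtain ⟨m, rfl⟩ : ∃ m, ℓ = m + 2 := ⟨ℓ - 2, by have := hp.two_le; omega⟩
  have h1 : (1 + b) ^ (m + 2) - (1 + (m + 2 : ℕ) * b) =
      ∑ k ∈ range m, ((m + 2).choose (k + 2) : L) * b ^ (k + 2) + b ^ (m + 2) := by
    rw [add_comm 1 b, add_pow, sum_range_succ, sum_range_succ', sum_range_succ']
    simp only [one_pow, mul_one, zero_add, Nat.choose_zero_right, Nat.choose_one_right,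
      Nat.choose_self, Nat.cast_one, pow_zero, pow_one, add_assoc, one_add_one_eq_two]
    have : ∀ k ∈ range m, b ^ (k + 2) * ((m + 2).choose (k + 2) : L) =
        ((m + 2).choose (k + 2) : L) * b ^ (k + 2) := fun k _ => mul_comm _ _
    rw [sum_congr rfl this]
    ring
  rw [h1]
  refine (OrdGE.sum fun k hk => ?_).add ((hb.pow _).mono (by simp))
  rw [mem_range] at hk
  obtain ⟨a, ha⟩ := hp.dvd_choose_self (k := k + 2) (by omega) (by omega)
  rw [ha, Nat.cast_mul]
  refine ((hE.mul (ordGE_natCast v a)).mul (hb.pow (k + 2))).mono ?_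
  have : (0 : ℤ) ≤ k * s := by positivity
  push_cast
  refine (min_le_left _ _).trans ?_
  linarith

/-- The power map on one-units. -/
theorem OrdGE.pow_prime_sub_one {ℓ : ℕ} (hp : ℓ.Prime) {E s : ℤ} (hE : OrdGE v E (ℓ : L))
    (hs : 0 ≤ s) {y : L} (hy : OrdGE v s (y - 1)) :
    OrdGE v (min (s + E) (ℓ * s)) (y ^ ℓ - 1) := by
  have h1 := OrdGE.one_add_pow_prime hp hE hs hy
  rw [add_sub_cancel] at h1
  have h2 : y ^ ℓ - 1 = (y ^ ℓ - (1 + ℓ * (y - 1))) + ℓ * (y - 1) := by ring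
  rw [h2]
  refine (h1.mono ?_).add ((hE.mul hy).mono ?_)
  · exact min_le_min (by linarith) le_rfl
  · exact (min_le_left _ _).trans (by linarith)

/-- One-units of level larger than `ℓ E / (ℓ - 1)` are `ℓ`-th powers, where `E` is the order of
`ℓ`. -/
theorem exists_pow_prime_eq (hc : IsVComplete v) (σ : L ≃+* L) (hσ : ∀ x, v (σ x) = v x) {ℓ : ℕ}
    (hp : ℓ.Prime) {E s : ℤ} (hE : OrdEq v E (ℓ : L)) (hE0 : 0 ≤ E) (hs : E < (ℓ - 1) * (s - E))
    {x : L} (hx : σ x = x) (ho : OrdGE v s (x - 1)) :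
    ∃ y, σ y = y ∧ OrdGE v (s - E) (y - 1) ∧ y ^ ℓ = x := by
  have hp2 : (2 : ℤ) ≤ ℓ := by exact_mod_cast hp.two_le
  have hsE : 1 ≤ s - E := by
    by_contra hcon
    push Not at hcon
    have : (ℓ - 1) * (s - E) ≤ 0 := mul_nonpos_of_nonneg_of_nonpos (by linarith) (by linarith)
    linarith
  have hcont : ∀ x : L, ∀ n : ℤ, 1 ≤ n → OrdGE v n (x - 1) → OrdGE v n (x ^ ℓ - 1) := by
    intro x n hn hx
    have := OrdGE.prod_sub_one (s := range ℓ) (f := fun _ => x) (n := n) (by omega)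
      (fun _ _ => hx)
    rwa [prod_const, card_range] at this
  refine exists_eq_of_approx hc σ hσ (fun y => y ^ ℓ) (fun a b => mul_pow a b ℓ) (one_pow ℓ)
    hcont (fun y => σ y = y) (fun y z hy hz => by rw [map_div₀, map_pow, hy, hz]) s E hsE hE0
    ?_ x hx ho
  intro n y hn hy hyn
  -- `(1 + (y - 1) / ℓ) ^ ℓ` agrees with `y` to first order
  have hb : OrdGE v (n - E) ((y - 1) / ℓ) := hyn.div hE
  have hz1 : OrdGE v (n - E) (1 + (y - 1) / ℓ - 1) := by rwa [add_sub_cancel_left]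
  have hz0 := OrdEq.of_sub_one (hcont _ 1 le_rfl (hz1.mono (by omega)))
  refine ⟨1 + (y - 1) / ℓ, by rw [map_add, map_div₀, map_sub, hy, map_one, map_natCast], hz1, ?_⟩
  have h1 := OrdGE.one_add_pow_prime hp hE.ge (by omega) hb
  rw [mul_div_cancel₀ _ hE.ne_zero, add_sub_cancel] at h1
  have h2 : y / (1 + (y - 1) / ℓ) ^ ℓ - 1 =
      -(((1 + (y - 1) / ℓ) ^ ℓ - y) / (1 + (y - 1) / ℓ) ^ ℓ) := by
    rw [sub_div _ y, div_self hz0.ne_zero]; ring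
  rw [h2]
  refine ((h1.div hz0).mono ?_).neg
  rw [sub_zero]
  refine le_min (by linarith) ?_
  have : (ℓ - 1) * (s - E) ≤ (ℓ - 1) * (n - E) :=
    mul_le_mul_of_nonneg_left (by linarith) (by linarith)
  linarith

end Powers

end RamifiedTower

/-! ### Towers of cyclic steps -/

namespace RamifiedTower

open WithZero Finset

/-- A totally ramified cyclic extension of degree `ℓ ^ N` of discretely valued fields, with
residue characteristic `ℓ`. Only the top field `L` is given as a type: the layers are the fixed
fields of `σ ^ ℓ ^ m`, where `σ` generates the Galois group. The valuation is normalised on `L`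
with uniformizer `π`, and `lam j` is the `j`-th lower ramification break. -/
structure Tower {L : Type*} [Field L] (v : Valuation L ℤᵐ⁰) (σ : L ≃+* L) (ℓ N : ℕ) (π : L)
    (lam : ℕ → ℕ) : Prop where
  prime : ℓ.Prime
  natCast_ge : OrdGE v 1 (ℓ : L)
  map : ∀ x, v (σ x) = v x
  pow_eq : ∀ x, (σ ^ ℓ ^ N) x = x
  resid : ∀ x, OrdGE v 0 x → ∃ a, σ a = a ∧ OrdGE v 1 (x - a)
  unif : OrdEq v 1 π
  brk : ∀ j < N, OrdEq v (lam j + 1) (delta (σ ^ ℓ ^ j) π)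

namespace Tower

variable {L : Type*} [Field L] {v : Valuation L ℤᵐ⁰} {σ : L ≃+* L} {ℓ N : ℕ} {π : L}
  {lam : ℕ → ℕ}
variable (h : Tower v σ ℓ N π lam)
include h

theorem pow_map (i : ℕ) (x : L) : v ((σ ^ i) x) = v x := by
  induction i with
  | zero => simp
  | succ i ih => rw [pow_succ_apply', h.map, ih]

theorem ordGE_pow {n : ℤ} {x : L} (hx : OrdGE v n x) (i : ℕ) : OrdGE v n ((σ ^ i) x) := by
  rw [OrdGE, h.pow_map]; exact hx

theorem ordEq_pow {n : ℤ} {x : L} (hx : OrdEq v n x) (i : ℕ) : OrdEq v n ((σ ^ i) x) := by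
  rw [OrdEq, h.pow_map]; exact hx

/-- The Galois group of a totally ramified `ℓ`-extension acts trivially on the associated graded
ring: the ramification is wild. -/
theorem delta_ge {n : ℤ} {x : L} (hx : OrdGE v n x) (k : ℕ) :
    OrdGE v (n + 1) (delta (σ ^ k) x) := by
  rcases eq_or_ne x 0 with rfl | hx0
  · simpa [delta] using ordGE_zero _
  obtain ⟨m, hm⟩ := exists_ordEq v hx0
  have hnm := hm.le_of_ge hx
  set y := (σ ^ k) x / x with hy
  have hy0 : OrdEq v 0 y := by
    have := (h.ordEq_pow hm k).div hm
    rwa [sub_self] at this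
  obtain ⟨a, ha, hya⟩ := h.resid y hy0.ge
  have ha0 : OrdGE v 0 a := hy0.ge.of_sub (hya.sub_swap.mono (by omega))
  -- `y = σ ^ k x / x` has norm one, so that its residue is an `ℓ ^ N`-th root of unity, which is
  -- trivial in characteristic `ℓ`
  have hN : nmProd (σ ^ k) (ℓ ^ N) y = 1 := by
    have h1 := map_nmProd_mul (σ ^ k) (ℓ ^ N) x
    rw [← pow_mul, mul_comm k, pow_mul] at h1
    have h2 : ((σ ^ ℓ ^ N) ^ k) x = x := pow_apply_eq_self _ _ (h.pow_eq x)
    rw [h2] at h1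
    have h3 := pow_map_nmProd (σ ^ k) 1 1 (ℓ ^ N) x
    rw [pow_one] at h3
    rw [hy, nmProd_div, ← h3, mul_right_cancel₀ hx0 h1, div_self (nmProd_ne_zero _ _ hx0)]
  have h4 : OrdGE v 1 (1 - a ^ ℓ ^ N) := by
    have := OrdGE.prod_sub_prod (s := range (ℓ ^ N)) (f := fun i => ((σ ^ k) ^ i) y)
      (g := fun _ => a)
      (fun i _ => by rw [← pow_mul]; exact h.ordGE_pow hy0.ge _) (fun _ _ => ha0)
      (fun i _ => by
        rw [← pow_mul]
        have := h.ordGE_pow hya (k * i)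
        rwa [map_sub, pow_apply_eq_self σ _ ha] at this)
    rw [prod_const, card_range] at this
    rwa [← nmProd, hN] at this
  have h5 : ∀ j, OrdGE v 1 (a ^ ℓ ^ j - 1) → OrdGE v 1 (a - 1) := by
    intro j
    induction j with
    | zero => intro h6; simpa using h6
    | succ j ih =>
      intro h6
      refine ih (OrdGE.of_pow_sub_pow h.prime h.natCast_ge
        (by simpa using ha0.pow (ℓ ^ j)) ordEq_one.ge ?_)
      rwa [← pow_mul, ← pow_succ, one_pow]
  have h6 := hya.add (h5 N h4.sub_swap)
  have h7 : delta (σ ^ k) x = (y - a + (a - 1)) * x := by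
    rw [hy, delta]; field_simp; ring
  rw [h7]
  exact (h6.mul hm.ge).mono (by linarith)

theorem lam_pos {j : ℕ} (hj : j < N) : 0 < lam j := by
  have := (h.brk j hj).le_of_ge (h.delta_ge h.unif.ge _)
  omega

/-- The lower ramification breaks increase strictly. -/
theorem lam_lt_succ {j : ℕ} (hj : j + 1 < N) : lam j < lam (j + 1) := by
  set τ := σ ^ ℓ ^ j with hτ
  have hb := h.brk j (by omega)
  have hb' := h.brk (j + 1) hj
  have hl := h.lam_pos (j := j) (by omega)
  set w := delta τ π / π with hw
  have hwo : OrdEq v (lam j) w := by simpa using hb.div h.unif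
  have hw1 : OrdGE v 1 w := hwo.ge.mono (by omega)
  have h1w : 1 + w = τ π / π := by
    have := h.unif.ne_zero
    rw [hw, delta]; field_simp; ring
  have h1w0 := OrdEq.one_add hw1
  -- `τ ^ ℓ π / π` is the norm of `τ π / π`
  have hprod : nmProd τ ℓ (1 + w) = (τ ^ ℓ) π / π := by
    have h1 := map_nmProd_mul τ ℓ π
    have h3 := pow_map_nmProd τ 1 1 ℓ π
    rw [pow_one] at h3
    have := h.unif.ne_zero
    have := nmProd_ne_zero τ ℓ h.unif.ne_zero
    rw [h1w, nmProd_div, ← h3]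
    field_simp
    linear_combination h1
  -- all the conjugates of `1 + w` agree with it modulo order `lam j + 1`, and `ℓ`-th powers raise
  -- the level of a one-unit
  have hge : OrdGE v (lam j + 1) (nmProd τ ℓ (1 + w) - 1) := by
    have h2 : ∀ i ∈ range ℓ, OrdGE v (lam j + 1) ((τ ^ i) (1 + w) / (1 + w) - 1) := by
      intro i _
      have h3 := h.delta_ge hwo.ge (ℓ ^ j * i)
      rw [pow_mul, ← hτ] at h3
      have h4 : (τ ^ i) (1 + w) / (1 + w) - 1 = delta (τ ^ i) w / (1 + w) := by
        have := h1w0.ne_zero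
        rw [delta, map_add, map_one]; field_simp; ring
      rw [h4]
      simpa using h3.div h1w0
    have h3 := OrdGE.prod_sub_one (by omega) h2
    rw [prod_div_distrib, prod_const, card_range] at h3
    have h4 : OrdGE v (lam j + 1) ((1 + w) ^ ℓ - 1) := by
      refine (OrdGE.pow_prime_sub_one h.prime h.natCast_ge (s := lam j) (by omega)
        (by rw [add_sub_cancel_left]; exact hwo.ge)).mono (le_min le_rfl ?_)
      have hp : (2 : ℤ) ≤ ℓ := by exact_mod_cast h.prime.two_le
      have : (1 : ℤ) ≤ lam j := by exact_mod_cast hl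
      nlinarith
    have h5 := h3.mul_sub_one (by omega) h4
    rwa [div_mul_cancel₀ _ (pow_ne_zero _ h1w0.ne_zero)] at h5
  have hτℓ : σ ^ ℓ ^ (j + 1) = τ ^ ℓ := by rw [hτ, ← pow_mul, pow_succ]
  rw [hτℓ] at hb'
  have h6 : OrdEq v (lam (j + 1)) (nmProd τ ℓ (1 + w) - 1) := by
    have h7 := hb'.div h.unif
    have h8 : delta (τ ^ ℓ) π / π = nmProd τ ℓ (1 + w) - 1 := by
      have := h.unif.ne_zero
      rw [hprod, delta]; field_simp
    rw [h8] at h7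
    simpa using h7
  have := h6.le_of_ge hge
  omega

theorem lam_lt {i j : ℕ} (hij : i < j) (hj : j < N) : lam i < lam j := by
  induction j, hij using Nat.le_induction with
  | base => exact h.lam_lt_succ hj
  | succ j _ ih => exact (ih (by omega)).trans (h.lam_lt_succ hj)

/-- Every layer is totally ramified, and its uniformizer shows the same lower breaks as that of
the top field (compatibility of the lower numbering with these quotients). -/
theorem layer_aux (k : ℕ) : ∀ m, m + k = N →
    (∀ x n, (σ ^ ℓ ^ m) x = x → OrdEq v n x → ((ℓ ^ k : ℕ) : ℤ) ∣ n) ∧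
    ∃ p, (σ ^ ℓ ^ m) p = p ∧ OrdEq v (ℓ ^ k : ℕ) p ∧
      ∀ j < m, OrdEq v ((ℓ ^ k : ℕ) * (lam j + 1)) (delta (σ ^ ℓ ^ j) p) := by
  induction k with
  | zero =>
    rintro m rfl
    refine ⟨fun x n _ _ => by simp, π, h.pow_eq π, by simpa using h.unif, fun j hj => ?_⟩
    simpa using h.brk j hj
  | succ k ih =>
    intro m hm
    -- descend from the layer `m + 1`: the norm of its uniformizer is a uniformizer of the layer `m`
    obtain ⟨hdvd, p, hp, hpo, hpb⟩ := ih (m + 1) (by omega)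
    have hτℓ : σ ^ ℓ ^ (m + 1) = (σ ^ ℓ ^ m) ^ ℓ := by rw [← pow_mul, pow_succ]
    have hstep : Step v (σ ^ ℓ ^ m) ℓ (ℓ ^ k) (lam m) p :=
      { prime := h.prime
        d_pos := pow_pos h.prime.pos k
        t_pos := h.lam_pos (by omega)
        natCast_ge := h.natCast_ge
        map := h.pow_map _
        resid := fun x hx => by
          obtain ⟨a, ha, hxa⟩ := h.resid x hx
          exact ⟨a, pow_apply_eq_self σ _ ha, hxa⟩
        dvd := fun x n hx => hdvd x n (by rw [hτℓ]; exact hx)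
        unif_fix := by rw [← hτℓ]; exact hp
        unif := hpo
        brk := hpb m (by omega) }
    refine ⟨fun x n hx ho => by rw [pow_succ]; exact hstep.dvd_fixed hx ho,
      nmProd (σ ^ ℓ ^ m) ℓ p, map_nmProd hstep.unif_fix, ?_, fun j hj => ?_⟩
    · convert hstep.nmProd_eq hpo using 1
      rw [pow_succ]; push_cast; ring
    · set w := delta (σ ^ ℓ ^ j) p / p with hw
      have hwo : OrdEq v ((ℓ ^ k : ℕ) * lam j) w := by
        convert (hpb j (by omega)).div hpo using 1
        ring
      have hwf : ((σ ^ ℓ ^ m) ^ ℓ) w = w := by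
        have h1 := pow_apply_comm σ (ℓ ^ j) (ℓ ^ (m + 1)) p
        rw [hp] at h1
        rw [← hτℓ, hw, map_div₀, delta, map_sub, hp, h1]
      -- the level of `σ ^ ℓ ^ j p / p` is below the break of the step
      have h1 := hstep.nmProd_one_add_eq (h.lam_pos (by omega)) (h.lam_lt hj (by omega)) hwf hwo
      have h1w : 1 + w = (σ ^ ℓ ^ j) p / p := by
        have := hpo.ne_zero
        rw [hw, delta]; field_simp; ring
      have hN := hstep.nmProd_eq hpo
      have h2 : delta (σ ^ ℓ ^ j) (nmProd (σ ^ ℓ ^ m) ℓ p) =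
          (nmProd (σ ^ ℓ ^ m) ℓ (1 + w) - 1) * nmProd (σ ^ ℓ ^ m) ℓ p := by
        have := hN.ne_zero
        rw [h1w, nmProd_div, delta, pow_map_nmProd]
        field_simp
      rw [h2]
      convert h1.mul hN using 1
      rw [pow_succ]; push_cast; ring

/-- The steps of a tower. -/
theorem exists_step {m : ℕ} (hm : m < N) :
    ∃ p, Step v (σ ^ ℓ ^ m) ℓ (ℓ ^ (N - (m + 1))) (lam m) p := by
  obtain ⟨hdvd, p, hp, hpo, hpb⟩ := h.layer_aux (N - (m + 1)) (m + 1) (by omega)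
  have hτℓ : σ ^ ℓ ^ (m + 1) = (σ ^ ℓ ^ m) ^ ℓ := by rw [← pow_mul, pow_succ]
  exact ⟨p,
    { prime := h.prime
      d_pos := pow_pos h.prime.pos _
      t_pos := h.lam_pos hm
      natCast_ge := h.natCast_ge
      map := h.pow_map _
      resid := fun x hx => by
        obtain ⟨a, ha, hxa⟩ := h.resid x hx
        exact ⟨a, pow_apply_eq_self σ _ ha, hxa⟩
      dvd := fun x n hx => hdvd x n (by rw [hτℓ]; exact hx)
      unif_fix := by rw [← hτℓ]; exact hp
      unif := hpo
      brk := hpb m (by omega) }⟩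

/-- The breaks do not depend on the uniformizer, nor on the top layer. -/
theorem delta_layer_eq {m : ℕ} (hm : m < N) {q : L} (hq : (σ ^ ℓ ^ (m + 1)) q = q)
    (hqo : OrdEq v (ℓ ^ (N - (m + 1)) : ℕ) q) :
    OrdEq v ((ℓ ^ (N - (m + 1)) : ℕ) * (lam m + 1)) (delta (σ ^ ℓ ^ m) q) := by
  obtain ⟨p, hp⟩ := h.exists_step hm
  have hτℓ : σ ^ ℓ ^ (m + 1) = (σ ^ ℓ ^ m) ^ ℓ := by rw [← pow_mul, pow_succ]
  rw [hτℓ] at hq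
  have := hp.delta_eq (i := 1) (fun hd => absurd (Nat.le_of_dvd one_pos hd)
    (by have := h.prime.two_le; omega)) hq (by simpa using hqo)
  convert this using 1
  push_cast; ring

end Tower

end RamifiedTower

/-! ### Norm groups and upper ramification breaks -/

namespace RamifiedTower

open WithZero Finset

section

/-- The drop of levels along the norm from the `m`-th layer, for one-units beyond the breaks. -/
def normShift (ℓ N : ℕ) (lam : ℕ → ℕ) (m : ℕ) : ℤ :=
  ∑ j ∈ range m, (ℓ - 1) * (ℓ ^ (N - (j + 1)) : ℕ) * lam j

/-- The `n`-th upper ramification break of a tower of height `N`, multiplied by `ℓ ^ N` so as to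
be a level for the valuation that is normalised on the top field. -/
def upperBreak (ℓ N : ℕ) (lam : ℕ → ℕ) (n : ℕ) : ℤ :=
  ℓ * (ℓ ^ (N - (n + 1)) : ℕ) * lam n + normShift ℓ N lam n

end

theorem Step.nmProd_sub_one_ge_of_break_le {L : Type*} [Field L] {v : Valuation L ℤᵐ⁰}
    {τ : L ≃+* L} {ℓ d t : ℕ} {π : L} (h : Step v τ ℓ d t π) {s : ℤ} (hs : d * t ≤ s) {x : L}
    (hx : (τ ^ ℓ) x = x) (ho : OrdGE v s (x - 1)) :
    OrdGE v (s + (ℓ - 1) * d * t) (nmProd τ ℓ x - 1) := by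
  rcases eq_or_ne x 1 with rfl | hx1
  · simpa [nmProd_one] using ordGE_zero _
  obtain ⟨m, hm⟩ := exists_ordEq v (sub_ne_zero.2 hx1)
  have hfix : (τ ^ ℓ) (x - 1) = x - 1 := by rw [map_sub, map_one, hx]
  obtain ⟨k, rfl⟩ := h.dvd _ _ hfix hm
  have h1 := hm.le_of_ge ho
  have hd : (0 : ℤ) < d := by exact_mod_cast h.d_pos
  have htk : (t : ℤ) ≤ k := le_of_mul_le_mul_left (hs.trans h1) hd
  lift k to ℕ using (by omega)
  have h2 := h.nmProd_one_add_ge (by exact_mod_cast htk) hfix hm.ge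
  rw [add_sub_cancel] at h2
  exact h2.mono (by linarith)

theorem pow_pow_succ {L : Type*} [Field L] (σ : L ≃+* L) (ℓ m : ℕ) :
    (σ ^ ℓ ^ m) ^ ℓ = σ ^ ℓ ^ (m + 1) := by
  rw [← pow_mul, pow_succ]

namespace Tower

variable {L : Type*} [Field L] {v : Valuation L ℤᵐ⁰} {σ : L ≃+* L} {ℓ N : ℕ} {π : L}
  {lam : ℕ → ℕ}
variable (h : Tower v σ ℓ N π lam)
include h

theorem upperBreak_pos {n : ℕ} (hn : n < N) : 1 ≤ upperBreak ℓ N lam n := by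
  have h1 : (1 : ℤ) ≤ ℓ := by exact_mod_cast h.prime.one_le
  have h2 : (1 : ℤ) ≤ lam n := by exact_mod_cast h.lam_pos hn
  have h3 : (1 : ℤ) ≤ (ℓ ^ (N - (n + 1)) : ℕ) := by exact_mod_cast Nat.one_le_pow _ _ h.prime.pos
  have h4 : 0 ≤ normShift ℓ N lam n := sum_nonneg fun j _ =>
    mul_nonneg (mul_nonneg (by linarith) (by positivity)) (by positivity)
  have h5 : (1 : ℤ) ≤ ℓ * (ℓ ^ (N - (n + 1)) : ℕ) := by nlinarith
  have : (1 : ℤ) ≤ ℓ * (ℓ ^ (N - (n + 1)) : ℕ) * lam n := by nlinarith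
  rw [upperBreak]
  linarith

theorem upperBreak_lt_succ {n : ℕ} (hn : n + 1 < N) :
    upperBreak ℓ N lam n < upperBreak ℓ N lam (n + 1) := by
  rw [upperBreak, upperBreak, normShift, normShift, sum_range_succ]
  have h1 : N - (n + 1) = N - (n + 1 + 1) + 1 := by omega
  have h2 : (lam n : ℤ) < lam (n + 1) := by exact_mod_cast h.lam_lt_succ hn
  have h3 : (0 : ℤ) < (ℓ ^ (N - (n + 1)) : ℕ) := by exact_mod_cast pow_pos h.prime.pos _
  have h4 : (ℓ : ℤ) * (ℓ ^ (N - (n + 1 + 1)) : ℕ) = (ℓ ^ (N - (n + 1)) : ℕ) := by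
    rw [h1, pow_succ]; push_cast; ring
  rw [h4]
  nlinarith

theorem upperBreak_le {i j : ℕ} (hij : i ≤ j) (hj : j < N) :
    upperBreak ℓ N lam i ≤ upperBreak ℓ N lam j := by
  induction j, hij using Nat.le_induction with
  | base => exact le_rfl
  | succ j _ ih => exact (ih (by omega)).trans (h.upperBreak_lt_succ hj).le

/-- The norm from the `m`-th layer maps one-units beyond the breaks into the expected level. -/
theorem nmProd_sub_one_ge (m : ℕ) (hm : m ≤ N) : ∀ (s : ℤ) (x : L), (σ ^ ℓ ^ m) x = x →
    (∀ j < m, (ℓ ^ (N - (j + 1)) : ℕ) * (lam j : ℤ) ≤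
      s + normShift ℓ N lam m - normShift ℓ N lam (j + 1)) → OrdGE v s (x - 1) →
    OrdGE v (s + normShift ℓ N lam m) (nmProd σ (ℓ ^ m) x - 1) := by
  induction m with
  | zero =>
    intro s x hx _ ho
    simpa [normShift, nmProd] using ho
  | succ m ih =>
    intro s x hx hs ho
    obtain ⟨p, hp⟩ := h.exists_step (m := m) (by omega)
    have hx' : ((σ ^ ℓ ^ m) ^ ℓ) x = x := by rw [pow_pow_succ]; exact hx
    have hS : normShift ℓ N lam (m + 1) = normShift ℓ N lam m +
        (ℓ - 1) * (ℓ ^ (N - (m + 1)) : ℕ) * lam m := by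
      rw [normShift, sum_range_succ, ← normShift]
    have h1 := hp.nmProd_sub_one_ge_of_break_le (s := s)
      ((hs m (by omega)).trans (by linarith)) hx' ho
    have h2 := ih (by omega) _ _ (map_nmProd hx') (fun j hj => (hs j (by omega)).trans
      (by linarith)) h1
    rw [nmProd_nmProd, ← pow_succ] at h2
    exact h2.mono (by linarith)

/-- One-units of the bottom field beyond the upper breaks are norms from the `m`-th layer. -/
theorem exists_nmProd_eq (hc : IsVComplete v) (m : ℕ) (hm : m ≤ N) {s : ℤ} {y : L}
    (hy : σ y = y) (ho : OrdGE v s (y - 1)) (hs : ∀ j < m, upperBreak ℓ N lam j < s) :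
    ∃ z, (σ ^ ℓ ^ m) z = z ∧ OrdGE v (s - normShift ℓ N lam m) (z - 1) ∧
      nmProd σ (ℓ ^ m) z = y := by
  induction m with
  | zero => exact ⟨y, by simpa using hy, by simpa [normShift] using ho, by simp [nmProd]⟩
  | succ m ih =>
    obtain ⟨z, hz, hzo, hzy⟩ := ih (by omega) fun j hj => hs j (by omega)
    obtain ⟨p, hp⟩ := h.exists_step (m := m) (by omega)
    have h1 := hs m (by omega)
    rw [upperBreak] at h1
    obtain ⟨z', hz', hzo', hzz⟩ := hp.exists_nmProd_eq hc
      (n := s - normShift ℓ N lam m) (by linarith) hz hzo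
    refine ⟨z', by rw [← pow_pow_succ]; exact hz', ?_, ?_⟩
    · rw [normShift, sum_range_succ, ← normShift]
      exact hzo'.mono (by linarith)
    · rw [pow_succ, ← nmProd_nmProd, hzz, hzy]

/-- Distinctness of the conjugates of a layer uniformizer. -/
theorem exists_layer_gen {n : ℕ} (hn : n ≤ N) : ∃ p, (σ ^ ℓ ^ n) p = p ∧
    ∀ r, r ∣ ℓ ^ n → r ≠ ℓ ^ n → (σ ^ r) p ≠ p := by
  obtain ⟨-, p, hp, -, hpb⟩ := h.layer_aux (N - n) n (by omega)
  refine ⟨p, hp, fun r hr hrn => ?_⟩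
  obtain ⟨j, hj, rfl⟩ := (Nat.dvd_prime_pow h.prime).1 hr
  have hjn : j < n := lt_of_le_of_ne hj (by rintro rfl; exact hrn rfl)
  exact fun he => (hpb j hjn).ne_zero (by rw [delta, he, sub_self])

/-- There is a one-unit of the bottom field whose level is the `n`-th upper break and which is not
a norm from the layer `n + 1`. It is the norm of a one-unit of the `n`-th layer that is not a norm
in the last step; the ambiguity by elements `b / σ b` of norm one is harmless because, the residue
field being perfect, `b` is a norm up to one-units at the break. -/
theorem exists_not_nmProd (hc : IsVComplete v)
    (hperf : ∀ a, OrdGE v 0 a → ∃ b, σ b = b ∧ OrdGE v 1 (b ^ ℓ - a))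
    (hAS : ∃ c, σ c = c ∧ OrdGE v 0 c ∧ ∀ a, OrdGE v 0 a → ¬ OrdGE v 1 (a ^ ℓ - a - c))
    {n : ℕ} (hn : n < N) : ∃ y, σ y = y ∧ OrdGE v (upperBreak ℓ N lam n) (y - 1) ∧
      ∀ z, (σ ^ ℓ ^ (n + 1)) z = z → nmProd σ (ℓ ^ (n + 1)) z ≠ y := by
  obtain ⟨p, hp⟩ := h.exists_step hn
  set τ := σ ^ ℓ ^ n with hτ
  set d := ℓ ^ (N - (n + 1)) with hd
  have hτℓ : σ ^ ℓ ^ (n + 1) = τ ^ ℓ := (pow_pow_succ σ ℓ n).symm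
  have hτf : ∀ a, σ a = a → τ a = a := fun a ha => pow_apply_eq_self σ _ ha
  have hτσ : ∀ a, τ (σ a) = σ (τ a) := fun a => by
    have := pow_apply_comm σ 1 (ℓ ^ n) a
    rwa [pow_one] at this
  have hτℓσ : ∀ a, (τ ^ ℓ) (σ a) = σ ((τ ^ ℓ) a) := fun a => by
    have := pow_apply_comm σ 1 (ℓ ^ (n + 1)) a
    rwa [pow_one, hτℓ] at this
  have hdt : (1 : ℤ) ≤ d * lam n := by exact_mod_cast Nat.mul_pos hp.d_pos hp.t_pos
  have hp2 : (2 : ℤ) ≤ ℓ := by exact_mod_cast h.prime.two_le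
  obtain ⟨x, hx, hxo, hxN⟩ := hp.exists_not_nmProd (by
    obtain ⟨c, hc, hcc⟩ := hAS
    exact ⟨c, hτf c hc, hcc⟩)
  have hx0 : x ≠ 0 := (OrdEq.of_sub_one (hxo.mono (m := 1) (by nlinarith))).ne_zero
  refine ⟨nmProd σ (ℓ ^ n) x, map_nmProd hx, ?_, ?_⟩
  · rw [upperBreak, ← hd]
    -- the level `ℓ * d * lam n` of `x` lies beyond the breaks met by the norm on its way down, as
    -- the upper breaks increase
    refine (h.nmProd_sub_one_ge n hn.le _ x hx (fun j hj => ?_) hxo).mono (by linarith)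
    have h1 := h.upperBreak_le hj.le hn
    rw [upperBreak, upperBreak, ← hd] at h1
    have hS : normShift ℓ N lam (j + 1) = normShift ℓ N lam j +
        (ℓ - 1) * (ℓ ^ (N - (j + 1)) : ℕ) * lam j := by
      rw [normShift, sum_range_succ, ← normShift]
    linarith
  intro z hz hzN
  rw [hτℓ] at hz
  have hz0 : z ≠ 0 := by
    rintro rfl
    refine nmProd_ne_zero σ (ℓ ^ n) hx0 ?_
    rw [← hzN]
    exact prod_eq_zero (mem_range.2 (pow_pos h.prime.pos _)) (map_zero _)
  have hNz0 := nmProd_ne_zero τ ℓ hz0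
  -- the quotient has norm one in the bottom field
  set w := x / nmProd τ ℓ z with hw
  have hwf : τ w = w := by rw [hw, map_div₀, hx, map_nmProd hz]
  have hwN : nmProd σ (ℓ ^ n) w = 1 := by
    rw [hw, nmProd_div, nmProd_nmProd, ← pow_succ, hzN, div_self (nmProd_ne_zero σ _ hx0)]
  obtain ⟨g, hg, hgr⟩ := h.exists_layer_gen hn.le
  obtain ⟨b, hb0, hbf, hwb⟩ := exists_mul_map_eq σ hg (pow_pos h.prime.pos n) hgr hwf hwN
  -- decompose `b`
  obtain ⟨m, hm⟩ := exists_ordEq v hb0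
  obtain ⟨k, rfl⟩ := hp.dvd_fixed hbf hm
  have hNp := hp.nmProd_eq hp.unif
  have hpf := map_nmProd hp.unif_fix
  have hzpow : OrdEq v ((d * ℓ : ℕ) * k) (nmProd τ ℓ p ^ k) := by
    rw [OrdEq] at hNp ⊢
    rw [map_zpow₀, hNp, ← exp_zsmul]
    congr 1
    push_cast
    simp only [smul_eq_mul]
    ring
  have hb1f : τ (b / nmProd τ ℓ p ^ k) = b / nmProd τ ℓ p ^ k := by
    rw [map_div₀, map_zpow₀, hpf]
    rw [hbf]
  have hb1o : OrdEq v 0 (b / nmProd τ ℓ p ^ k) := by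
    have := hm.div hzpow
    rwa [sub_self] at this
  obtain ⟨z₁, hz₁, hz₁o, hz₁b⟩ := hp.exists_div_nmProd (fun a ha => by
    obtain ⟨b, hb, hba⟩ := hperf a ha
    exact ⟨b, hτf b hb, hba⟩) hb1f hb1o
  set b₂ := b / nmProd τ ℓ p ^ k / nmProd τ ℓ z₁ with hb₂
  have hb₂f : τ b₂ = b₂ := by rw [hb₂, map_div₀, hb1f, map_nmProd hz₁]
  have hz₁N0 := nmProd_ne_zero τ ℓ hz₁o.ne_zero
  set z₂ := z₁ * p ^ k with hz₂
  have hz₂0 : z₂ ≠ 0 := mul_ne_zero hz₁o.ne_zero (zpow_ne_zero _ hp.unif.ne_zero)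
  have hz₂f : (τ ^ ℓ) z₂ = z₂ := by
    rw [hz₂, map_mul, map_zpow₀, hp.unif_fix, hz₁]
  have hbz : b = nmProd τ ℓ z₂ * b₂ := by
    have := hzpow.ne_zero
    rw [hz₂, nmProd_mul, nmProd_zpow, hb₂]
    field_simp
  have hdℓt : (1 : ℤ) ≤ d * ℓ * lam n := by nlinarith
  have hb₂o := OrdEq.of_sub_one (hz₁b.mono hdℓt)
  -- `b₂ / σ b₂` lies beyond the break, hence is a norm
  have hq : OrdGE v (d * ℓ * lam n + 1) (b₂ / σ b₂ - 1) := by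
    have h1 := h.delta_ge hz₁b 1
    rw [pow_one] at h1
    have hσo : OrdEq v 0 (σ b₂) := by
      have := h.ordEq_pow hb₂o 1
      rwa [pow_one] at this
    have h2 : b₂ / σ b₂ - 1 = -(delta σ (b₂ - 1) / σ b₂) := by
      have := hσo.ne_zero
      rw [delta, map_sub, map_one]
      field_simp
      ring
    rw [h2]
    simpa using (h1.div hσo).neg
  obtain ⟨z₃, hz₃, -, hz₃N⟩ := hp.exists_nmProd_eq hc (n := d * ℓ * lam n + 1) (by linarith)
    (y := b₂ / σ b₂) (by rw [map_div₀, hτσ, hb₂f]) hq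
  have hσz₂ : σ z₂ ≠ 0 := (map_ne_zero_iff _ σ.injective).2 hz₂0
  refine hxN (z * (z₂ / σ z₂) * z₃) ?_ ?_
  · rw [map_mul, map_mul, map_div₀, hτℓσ, hz, hz₂f, hz₃]
  · have hσN : σ (nmProd τ ℓ z₂) = nmProd τ ℓ (σ z₂) := by
      have := pow_map_nmProd σ (ℓ ^ n) 1 ℓ z₂
      rwa [pow_one] at this
    have hσb₂ : σ b₂ ≠ 0 := (map_ne_zero_iff _ σ.injective).2 hb₂o.ne_zero
    have hwb' : w * σ b = b := hwb
    rw [hbz, map_mul, hσN] at hwb'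
    have h5 := nmProd_ne_zero τ ℓ hσz₂
    rw [nmProd_mul, nmProd_mul, nmProd_div, hz₃N]
    rw [hw] at hwb'
    field_simp at hwb' ⊢
    linear_combination -hwb'

/-- Upper breaks at least grow like the filtration of one-units under `ℓ`-th powers: if
`u_{n+1}` were smaller than `min (ℓ u_n) (u_n + e)`, the `ℓ`-th power of a one-unit of level `u_n`
that is not a norm from the layer `n + 1` would be a norm from the layer `n + 2`. -/
theorem min_le_upperBreak (hc : IsVComplete v)
    (hperf : ∀ a, OrdGE v 0 a → ∃ b, σ b = b ∧ OrdGE v 1 (b ^ ℓ - a))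
    (hAS : ∃ c, σ c = c ∧ OrdGE v 0 c ∧ ∀ a, OrdGE v 0 a → ¬ OrdGE v 1 (a ^ ℓ - a - c))
    {E : ℤ} (hE : OrdEq v E (ℓ : L)) {n : ℕ} (hn : n + 1 < N) :
    min (upperBreak ℓ N lam n + E) (ℓ * upperBreak ℓ N lam n) ≤ upperBreak ℓ N lam (n + 1) := by
  by_contra hlt
  push Not at hlt
  obtain ⟨y, hy, hyo, hyN⟩ := h.exists_not_nmProd hc hperf hAS (n := n) (by omega)
  have hu := h.upperBreak_pos (n := n) (by omega)
  have hy0 := (OrdEq.of_sub_one (hyo.mono hu)).ne_zero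
  have hyℓ := OrdGE.pow_prime_sub_one h.prime hE.ge (by omega) hyo
  obtain ⟨z, hz, -, hzN⟩ := h.exists_nmProd_eq hc (n + 2) (by omega) (y := y ^ ℓ)
    (by rw [map_pow, hy]) hyℓ
    (fun j hj => lt_of_le_of_lt (h.upperBreak_le (by omega) hn) hlt)
  obtain ⟨p, hp⟩ := h.exists_step (m := n + 1) (by omega)
  obtain ⟨c, hcf, hcN⟩ := exists_nmProd_of_pow σ (m := ℓ ^ (n + 1)) h.prime hp.unif_fix
    (fun he => hp.brk.ne_zero (by rw [delta, he, sub_self])) hy hy0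
    (by rw [pow_pow_succ]; exact hz) (by rw [← pow_succ]; exact hzN)
  exact hyN c hcf hcN

/-- Far out, upper breaks grow at most by the absolute ramification index: otherwise a one-unit of
level `u_{n+1}` that is not a norm from the layer `n + 2` would be the `ℓ`-th power of a norm from
the layer `n + 1`. -/
theorem upperBreak_succ_le (hc : IsVComplete v)
    (hperf : ∀ a, OrdGE v 0 a → ∃ b, σ b = b ∧ OrdGE v 1 (b ^ ℓ - a))
    (hAS : ∃ c, σ c = c ∧ OrdGE v 0 c ∧ ∀ a, OrdGE v 0 a → ¬ OrdGE v 1 (a ^ ℓ - a - c))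
    {E : ℤ} (hE : OrdEq v E (ℓ : L)) {n : ℕ} (hn : n + 1 < N)
    (hlarge : E ≤ (ℓ - 1) * upperBreak ℓ N lam n) :
    upperBreak ℓ N lam (n + 1) ≤ upperBreak ℓ N lam n + E := by
  by_contra hlt
  push Not at hlt
  have hp2 : (2 : ℤ) ≤ ℓ := by exact_mod_cast h.prime.two_le
  have hE0 : 1 ≤ E := hE.le_of_ge h.natCast_ge
  obtain ⟨x, hx, hxo, hxN⟩ := h.exists_not_nmProd hc hperf hAS hn
  obtain ⟨y, hy, hyo, hyx⟩ := exists_pow_prime_eq hc σ h.map h.prime hE (by omega)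
    (s := upperBreak ℓ N lam (n + 1)) (by nlinarith) hx hxo
  obtain ⟨w, hw, -, hwN⟩ := h.exists_nmProd_eq hc (n + 1) hn.le hy hyo
    (fun j hj => lt_of_le_of_lt (h.upperBreak_le (Nat.le_of_lt_succ hj) (by omega)) (by linarith))
  refine hxN w ?_ ?_
  · rw [← pow_pow_succ]; exact pow_apply_eq_self _ _ hw
  · rw [pow_succ, ← nmProd_nmProd, nmProd_of_fixed _ _ hw, nmProd_pow, hwN, hyx]

/-- Lower breaks are bounded by the ramification index of `ℓ`. -/
theorem mul_lam_le {E : ℤ} (hE : OrdEq v E (ℓ : L)) {n : ℕ} (hn : n < N) :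
    (ℓ - 1) * (ℓ ^ (N - (n + 1)) : ℕ) * (lam n : ℤ) ≤ E := by
  obtain ⟨p, hp⟩ := h.exists_step hn
  have := hE.le_of_ge hp.natCast_prime_ge
  linarith

end Tower

end RamifiedTower

/-! ### Completion of a discretely valued field with an automorphism -/

namespace RamifiedTower

open WithZero Finset Topology

section Completion

theorem valued_mem_nhds_iff {F : Type*} [Field F] [hv : Valued F ℤᵐ⁰] {π : F}
    (hπ : OrdEq hv.v 1 π) {x : F} {s : Set F} :
    s ∈ 𝓝 x ↔ ∃ n : ℤ, ∀ y, OrdGE hv.v n (y - x) → y ∈ s := by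
  rw [Valued.mem_nhds]
  constructor
  · rintro ⟨γ, hγ⟩
    set g := MonoidWithZeroHom.ValueGroup₀.embedding γ.1 with hg
    have hg0 : g ≠ 0 := by simp [hg]
    refine ⟨-log g + 1, fun y hy => hγ ?_⟩
    show hv.v.restrict (y - x) < γ.1
    rw [Valuation.restrict_lt_iff_lt_embedding, ← hg]
    refine lt_of_le_of_lt hy ?_
    rw [← exp_log hg0, exp_lt_exp, log_exp]
    omega
  · rintro ⟨n, hn⟩
    have hz : OrdEq hv.v n (π ^ n) := by
      rw [OrdEq, map_zpow₀, hπ, ← exp_zsmul]; simp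
    refine ⟨Units.mk0 (hv.v.restrict (π ^ n)) ((Valuation.ne_zero_iff _).2 hz.ne_zero),
      fun y hy => hn y ?_⟩
    have h1 : hv.v.restrict (y - x) < hv.v.restrict (π ^ n) := hy
    rw [Valuation.restrict_lt_iff] at h1
    exact (h1.trans_eq hz).le

theorem OrdGE.telescope {L : Type*} [Field L] {v : Valuation L ℤᵐ⁰} {f : ℕ → L}
    (hf : ∀ n : ℕ, OrdGE v n (f (n + 1) - f n)) {m n : ℕ} (hmn : m ≤ n) :
    OrdGE v m (f n - f m) := by
  induction n, hmn using Nat.le_induction with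
  | base => simpa using ordGE_zero _
  | succ n hmn ih =>
    simpa using ((hf n).mono (by exact_mod_cast hmn)).add ih

theorem isVComplete_of_completeSpace {F : Type*} [Field F] [hv : Valued F ℤᵐ⁰] [CompleteSpace F]
    {π : F} (hπ : OrdEq hv.v 1 π) : IsVComplete hv.v := by
  intro f hf
  have hc : CauchySeq f := by
    rw [CauchySeq, Valued.cauchy_iff]
    refine ⟨inferInstance, fun γ => ?_⟩
    set g := MonoidWithZeroHom.ValueGroup₀.embedding γ.1 with hg
    have hg0 : g ≠ 0 := by simp [hg]
    set k := (-log g + 1).toNat with hk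
    refine ⟨f '' Set.Ici k, Filter.image_mem_map (Filter.Ici_mem_atTop k), ?_⟩
    rintro _ ⟨a, ha, rfl⟩ _ ⟨b, hb, rfl⟩
    rw [Valuation.restrict_lt_iff_lt_embedding, ← hg]
    have h1 : OrdGE hv.v k (f b - f a) := by
      have := (OrdGE.telescope hf hb).sub (OrdGE.telescope hf ha)
      simpa using this
    refine lt_of_le_of_lt h1 ?_
    rw [← exp_log hg0, exp_lt_exp]
    omega
  obtain ⟨x, hx⟩ := cauchySeq_tendsto_of_complete hc
  refine ⟨x, fun n => ?_⟩
  have h1 : {y | OrdGE hv.v n (y - x)} ∈ 𝓝 x := (valued_mem_nhds_iff hπ).2 ⟨n, fun y hy => hy⟩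
  obtain ⟨m, hm1, hm2⟩ := Filter.nonempty_of_mem
    (Filter.inter_mem (show f ⁻¹' _ ∈ Filter.atTop from hx h1) (Filter.Ici_mem_atTop n))
  have h2 : OrdGE hv.v n (f m - x) := hm1
  have h3 := (OrdGE.telescope hf hm2).sub h2
  simpa using h3

/-- A discretely valued field with an isometric automorphism has a completion with an isometric
automorphism, in which it is dense. -/
theorem exists_completion.{u} {L : Type u} [Field L] (v : Valuation L ℤᵐ⁰) (σ : L ≃+* L)
    (hσ : ∀ x, v (σ x) = v x) {π : L} (hπ : OrdEq v 1 π) :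
    ∃ (L' : Type u) (_ : Field L') (v' : Valuation L' ℤᵐ⁰) (σ' : L' ≃+* L') (ι : L →+* L'),
      (∀ x, v' (ι x) = v x) ∧ (∀ x, σ' (ι x) = ι (σ x)) ∧ (∀ y, v' (σ' y) = v' y) ∧
      (∀ y, ∀ n : ℤ, ∃ x, OrdGE v' n (y - ι x)) ∧ IsVComplete v' := by
  let hv : Valued L ℤᵐ⁰ := Valued.mk' v
  have hvv : hv.v = v := rfl
  have cont : ∀ f : L →+* L, (∀ x, v (f x) = v x) → Continuous f := fun f hf => by
    rw [continuous_iff_continuousAt]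
    intro x s hs
    obtain ⟨n, hn⟩ := (valued_mem_nhds_iff hπ).1 hs
    refine (valued_mem_nhds_iff hπ).2 ⟨n, fun y hy => hn _ ?_⟩
    rw [← map_sub, OrdGE, hvv, hf]
    exact hy
  have hσ' : ∀ x, v (σ.symm x) = v x := fun x => by rw [← hσ, RingEquiv.apply_symm_apply]
  have c1 := cont σ.toRingHom hσ
  have c2 := cont σ.symm.toRingHom hσ'
  let σ' : UniformSpace.Completion L ≃+* UniformSpace.Completion L :=
    RingEquiv.ofRingHom (UniformSpace.Completion.mapRingHom σ.toRingHom c1)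
      (UniformSpace.Completion.mapRingHom σ.symm.toRingHom c2)
      (by rw [UniformSpace.Completion.mapRingHom_comp]; simp)
      (by rw [UniformSpace.Completion.mapRingHom_comp]; simp)
  let ι : L →+* UniformSpace.Completion L := UniformSpace.Completion.coeRingHom
  have hι : ∀ x, Valued.v (ι x) = v x := fun x => Valued.valuedCompletion_apply x
  have hσι : ∀ x, σ' (ι x) = ι (σ x) := fun x =>
    UniformSpace.Completion.mapRingHom_coe c1 x
  have hπ' : OrdEq (Valued.v : Valuation (UniformSpace.Completion L) ℤᵐ⁰) 1 (ι π) := by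
    rw [OrdEq, hι]; exact hπ
  have hdense : ∀ (y : UniformSpace.Completion L) (n : ℤ),
      ∀ s ∈ 𝓝 y, ∃ x, OrdGE Valued.v n (y - ι x) ∧ ι x ∈ s := fun y n s hs => by
    have h1 : s ∩ {z | OrdGE Valued.v n (z - y)} ∈ 𝓝 y :=
      Filter.inter_mem hs ((valued_mem_nhds_iff hπ').2 ⟨n, fun z hz => hz⟩)
    obtain ⟨x, hx⟩ := UniformSpace.Completion.denseRange_coe.mem_nhds h1
    exact ⟨x, OrdGE.sub_swap hx.2, hx.1⟩
  have hσc : Continuous σ' := UniformSpace.Completion.continuous_map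
  refine ⟨UniformSpace.Completion L, inferInstance, Valued.v, σ', ι, hι, hσι, fun y => ?_,
    fun y n => ?_, isVComplete_of_completeSpace hπ'⟩
  · -- by density and continuity, the extended automorphism neither lowers nor raises orders
    have key : ∀ n, OrdGE Valued.v n y → OrdGE Valued.v n (σ' y) := fun n hy => by
      have h1 : {z | OrdGE Valued.v n (z - σ' y)} ∈ 𝓝 (σ' y) :=
        (valued_mem_nhds_iff hπ').2 ⟨n, fun z hz => hz⟩
      obtain ⟨x, hx1, hx2⟩ := hdense y n _ (hσc.continuousAt h1)
      have h2 : OrdGE Valued.v n (σ' (ι x) - σ' y) := hx2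
      have h3 : OrdGE v n x := by
        rw [OrdGE, ← hι]
        have := hy.sub hx1
        rwa [sub_sub_cancel] at this
      have h4 : OrdGE Valued.v n (σ' (ι x)) := by rw [OrdGE, hσι, hι, hσ]; exact h3
      simpa using h4.sub h2
    have key2 : ∀ n, OrdGE Valued.v n (σ' y) → OrdGE Valued.v n y := fun n hy => by
      have h1 : {z | OrdGE Valued.v n (z - σ' y)} ∈ 𝓝 (σ' y) :=
        (valued_mem_nhds_iff hπ').2 ⟨n, fun z hz => hz⟩
      obtain ⟨x, hx1, hx2⟩ := hdense y n _ (hσc.continuousAt h1)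
      have h2 : OrdGE Valued.v n (σ' (ι x) - σ' y) := hx2
      have h3 : OrdGE v n x := by
        rw [OrdGE, ← hσ, ← hι, ← hσι]
        have := h2.add hy
        rwa [sub_add_cancel] at this
      have h4 : OrdGE Valued.v n (ι x) := by rw [OrdGE, hι]; exact h3
      simpa using hx1.add h4
    rcases eq_or_ne y 0 with rfl | hy
    · rw [map_zero]
    obtain ⟨n, hn⟩ := exists_ordEq Valued.v hy
    obtain ⟨m, hm⟩ := exists_ordEq Valued.v ((map_ne_zero_iff _ σ'.injective).2 hy)
    have h1 := hm.le_of_ge (key n hn.ge)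
    have h2 := hn.le_of_ge (key2 m hm.ge)
    rw [hn, hm, le_antisymm h1 h2]
  · obtain ⟨x, hx, -⟩ := hdense y n Set.univ Filter.univ_mem
    exact ⟨x, hx⟩

namespace Tower

variable {L : Type*} [Field L] {v : Valuation L ℤᵐ⁰} {σ : L ≃+* L} {ℓ N : ℕ} {π : L}
  {lam : ℕ → ℕ}

theorem pow_apply_of_comm {L L' : Type*} [Field L] [Field L'] {σ : L ≃+* L} {σ' : L' ≃+* L'}
    {ι : L →+* L'} (hσι : ∀ x, σ' (ι x) = ι (σ x)) (k : ℕ) (x : L) :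
    (σ' ^ k) (ι x) = ι ((σ ^ k) x) := by
  induction k with
  | zero => simp
  | succ k ih => rw [pow_succ_apply', pow_succ_apply', ih, hσι]

/-- A ramified tower extends to an extension of the top field in which the order and the
automorphism extend, as soon as the automorphism keeps its order and residues are represented by
fixed elements. -/
theorem of_extension (h : Tower v σ ℓ N π lam) {L' : Type*} [Field L'] {v' : Valuation L' ℤᵐ⁰}
    {σ' : L' ≃+* L'} {ι : L →+* L'} (hι : ∀ x, v' (ι x) = v x) (hσι : ∀ x, σ' (ι x) = ι (σ x))
    (hσ' : ∀ y, v' (σ' y) = v' y) (hpow : ∀ x, (σ' ^ ℓ ^ N) x = x)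
    (hres : ∀ x, OrdGE v' 0 x → ∃ a, σ' a = a ∧ OrdGE v' 1 (x - a)) :
    Tower v' σ' ℓ N (ι π) lam where
  prime := h.prime
  natCast_ge := by
    rw [← map_natCast ι, OrdGE, hι]
    exact h.natCast_ge
  map := hσ'
  pow_eq := hpow
  resid := hres
  unif := by rw [OrdEq, hι]; exact h.unif
  brk j hj := by
    rw [delta, pow_apply_of_comm hσι, ← map_sub, OrdEq, hι]
    exact h.brk j hj

/-- The properties of a tower which enter the comparison of breaks are inherited by the
completion. -/
theorem exists_complete.{u} {L : Type u} [Field L] {v : Valuation L ℤᵐ⁰} {σ : L ≃+* L} {ℓ N : ℕ}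
    {π : L} {lam : ℕ → ℕ} (h : Tower v σ ℓ N π lam)
    (hperf : ∀ a, OrdGE v 0 a → ∃ b, σ b = b ∧ OrdGE v 1 (b ^ ℓ - a))
    (hAS : ∃ c, σ c = c ∧ OrdGE v 0 c ∧ ∀ a, OrdGE v 0 a → ¬ OrdGE v 1 (a ^ ℓ - a - c)) :
    ∃ (L' : Type u) (_ : Field L') (v' : Valuation L' ℤᵐ⁰) (σ' : L' ≃+* L') (ι : L →+* L'),
      (∀ x, v' (ι x) = v x) ∧ Tower v' σ' ℓ N (ι π) lam ∧ IsVComplete v' ∧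
      (∀ a, OrdGE v' 0 a → ∃ b, σ' b = b ∧ OrdGE v' 1 (b ^ ℓ - a)) ∧
      (∃ c, σ' c = c ∧ OrdGE v' 0 c ∧ ∀ a, OrdGE v' 0 a → ¬ OrdGE v' 1 (a ^ ℓ - a - c)) := by
  obtain ⟨L', _, v', σ', ι, hι, hσι, hσ', hd, hc⟩ := exists_completion v σ h.map h.unif
  have hge : ∀ {n x}, OrdGE v' n (ι x) ↔ OrdGE v n x := by
    intro n x
    rw [OrdGE, hι, OrdGE]
  have hres : ∀ y, OrdGE v' 0 y → ∃ x, OrdGE v 0 x ∧ OrdGE v' 1 (y - ι x) := fun y hy => by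
    obtain ⟨x, hx⟩ := hd y 1
    refine ⟨x, hge.1 ?_, hx⟩
    have := hy.sub (hx.mono (m := 0) (by norm_num))
    rwa [sub_sub_cancel] at this
  have hpowv : ∀ k y, v' ((σ' ^ k) y) = v' y := fun k y => by
    induction k with
    | zero => simp
    | succ k ih => rw [pow_succ_apply', hσ', ih]
  have hT : Tower v' σ' ℓ N (ι π) lam := by
    refine h.of_extension hι hσι hσ' (fun y => ?_) fun y hy => ?_
    · rw [← sub_eq_zero]
      refine eq_zero_of_forall_ordGE (v := v') fun n => ?_
      obtain ⟨x, hx⟩ := hd y n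
      have h1 : OrdGE v' n ((σ' ^ ℓ ^ N) (y - ι x)) := by rw [OrdGE, hpowv]; exact hx
      rw [map_sub, pow_apply_of_comm hσι, h.pow_eq] at h1
      convert h1.sub hx using 1
      ring
    · obtain ⟨x, hx, hxy⟩ := hres y hy
      obtain ⟨a, ha, hax⟩ := h.resid x hx
      refine ⟨ι a, by rw [hσι, ha], ?_⟩
      have h1 : OrdGE v' 1 (ι (x - a)) := hge.2 hax
      rw [map_sub] at h1
      simpa using hxy.add h1
  refine ⟨L', _, v', σ', ι, hι, hT, hc, fun y hy => ?_, ?_⟩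
  · obtain ⟨x, hx, hxy⟩ := hres y hy
    obtain ⟨b, hb, hbx⟩ := hperf x hx
    refine ⟨ι b, by rw [hσι, hb], ?_⟩
    have h1 : OrdGE v' 1 (ι (b ^ ℓ - x)) := hge.2 hbx
    rw [map_sub, map_pow] at h1
    simpa using h1.sub hxy
  · obtain ⟨c, hc1, hc2, hc3⟩ := hAS
    refine ⟨ι c, by rw [hσι, hc1], hge.2 hc2, fun y hy hyc => ?_⟩
    obtain ⟨x, hx, hxy⟩ := hres y hy
    refine hc3 x hx (hge.1 ?_)
    rw [map_sub, map_sub, map_pow]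
    have h1 := OrdGE.pow_sub_pow (k := ℓ) hy (hge.2 hx) hxy
    convert (hyc.sub h1).add hxy using 1
    ring

end Tower

end Completion

end RamifiedTower

/-! ### An Artin–Schreier equation without solution -/

namespace RamifiedTower

open WithZero Finset AddMonoidAlgebra

section ArtinSchreier

variable {k : Type*} [Field k]

/-- The largest exponent which occurs in `f` is `α`; in particular `f ≠ 0`. -/
def HasDeg (f : AddMonoidAlgebra k ℚ) (α : ℚ) : Prop :=
  f.coeff α ≠ 0 ∧ ∀ i, f.coeff i ≠ 0 → i ≤ α

theorem exists_hasDeg {f : AddMonoidAlgebra k ℚ} (hf : f ≠ 0) : ∃ α, HasDeg f α := by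
  have h : f.coeff.support.Nonempty := by
    rw [Finsupp.support_nonempty_iff]
    exact fun h => hf (AddMonoidAlgebra.ext h)
  refine ⟨f.coeff.support.max' h, ?_, fun i hi => ?_⟩
  · exact Finsupp.mem_support_iff.1 (f.coeff.support.max'_mem h)
  · exact f.coeff.support.le_max' i (Finsupp.mem_support_iff.2 hi)

theorem exists_coeff_ne_zero_of_mul {f g : AddMonoidAlgebra k ℚ} {i : ℚ}
    (hi : (f * g).coeff i ≠ 0) : ∃ a b, f.coeff a ≠ 0 ∧ g.coeff b ≠ 0 ∧ a + b = i := by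
  classical
  have := support_coeff_mul_subset f g (Finsupp.mem_support_iff.2 hi)
  obtain ⟨a, ha, b, hb, hab⟩ := Finset.mem_add.1 this
  exact ⟨a, b, Finsupp.mem_support_iff.1 ha, Finsupp.mem_support_iff.1 hb, hab⟩

theorem HasDeg.mul {f g : AddMonoidAlgebra k ℚ} {α β : ℚ} (hf : HasDeg f α) (hg : HasDeg g β) :
    HasDeg (f * g) (α + β) := by
  refine ⟨?_, fun i hi => ?_⟩
  · rw [coeff_mul_add_of_uniqueAdd]
    · exact mul_ne_zero hf.1 hg.1
    · intro a b ha hb hab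
      have h1 := hf.2 a (Finsupp.mem_support_iff.1 ha)
      have h2 := hg.2 b (Finsupp.mem_support_iff.1 hb)
      constructor <;> linarith
  · obtain ⟨a, b, ha, hb, rfl⟩ := exists_coeff_ne_zero_of_mul hi
    exact add_le_add (hf.2 a ha) (hg.2 b hb)

theorem hasDeg_single (α : ℚ) : HasDeg (single α (1 : k)) α := by
  classical
  refine ⟨by simp [coeff_single], fun i hi => ?_⟩
  rw [coeff_single, Finsupp.single_apply] at hi
  by_contra hc
  exact hi (if_neg fun h => hc h.ge)

theorem HasDeg.pow {f : AddMonoidAlgebra k ℚ} {α : ℚ} (hf : HasDeg f α) (n : ℕ) :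
    HasDeg (f ^ n) (n * α) := by
  induction n with
  | zero => simpa [AddMonoidAlgebra.one_def] using hasDeg_single (k := k) 0
  | succ n ih =>
    rw [pow_succ]
    convert ih.mul hf using 1
    push_cast; ring

theorem HasDeg.unique {f : AddMonoidAlgebra k ℚ} {α β : ℚ} (hα : HasDeg f α) (hβ : HasDeg f β) :
    α = β := le_antisymm (hβ.2 _ hα.1) (hα.2 _ hβ.1)

theorem HasDeg.sub {f g : AddMonoidAlgebra k ℚ} {α β : ℚ} (hf : HasDeg f α) (hg : HasDeg g β)
    (h : β < α) : HasDeg (f - g) α := by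
  have hg0 : ∀ i, β < i → g.coeff i = 0 := fun i hi => by
    by_contra hc
    exact absurd (hg.2 i hc) (not_le.2 hi)
  refine ⟨?_, fun i hi => ?_⟩
  · rw [coeff_sub, Finsupp.sub_apply, hg0 _ h, sub_zero]
    exact hf.1
  · by_contra hc
    rw [coeff_sub, Finsupp.sub_apply, hg0 _ (h.trans (not_le.1 hc)), sub_zero] at hi
    exact hc (hf.2 i hi)

/-- Comparison of degrees in the equation `(A / B) ^ ℓ - A / B = T ^ γ`. -/
theorem deg_of_artinSchreier {ℓ : ℕ} (hp : ℓ.Prime) {A B : AddMonoidAlgebra k ℚ} (hB : B ≠ 0)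
    {γ : ℚ} (hγ : 0 < γ) (h : A ^ ℓ - A * B ^ (ℓ - 1) = single γ 1 * B ^ ℓ) :
    ∃ α β, A.coeff α ≠ 0 ∧ B.coeff β ≠ 0 ∧ ℓ * (α - β) = γ := by
  obtain ⟨β, hβ⟩ := exists_hasDeg hB
  have hR := (hasDeg_single (k := k) γ).mul (hβ.pow ℓ)
  rw [← h] at hR
  have hℓ : (2 : ℚ) ≤ ℓ := by exact_mod_cast hp.two_le
  have hsub : ((ℓ - 1 : ℕ) : ℚ) = ℓ - 1 := by rw [Nat.cast_sub hp.one_le, Nat.cast_one]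
  rcases eq_or_ne A 0 with rfl | hA
  · rw [zero_pow hp.ne_zero, zero_mul, sub_zero] at hR
    exact absurd rfl hR.1
  obtain ⟨α, hα⟩ := exists_hasDeg hA
  have h1 := hα.pow ℓ
  have h2 := hα.mul (hβ.pow (ℓ - 1))
  rw [hsub] at h2
  refine ⟨α, β, hα.1, hβ.1, ?_⟩
  rcases lt_or_ge β α with hlt | hle
  · have h3 := h1.sub h2 (by nlinarith)
    have := h3.unique hR
    linarith
  · -- all exponents on the left are too small
    exfalso
    have h3 : (A ^ ℓ).coeff (γ + ℓ * β) = 0 := by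
      by_contra hc
      have := h1.2 _ hc
      nlinarith
    have h4 : (A * B ^ (ℓ - 1)).coeff (γ + ℓ * β) = 0 := by
      by_contra hc
      have := h2.2 _ hc
      nlinarith
    exact hR.1 (by rw [coeff_sub, Finsupp.sub_apply, h3, h4, sub_zero])

/-- The equation `a ^ ℓ - a = T` has no solution in the field of fractions of the monoid algebra
`k[T ^ ℚ]` of characteristic `ℓ`: replacing `a` by `a - T ^ (1 / ℓ) - … - T ^ (1 / ℓ ^ r)` turns
the right-hand side into `T ^ (1 / ℓ ^ r)`, whose exponent is too divisible to be a multiple by `ℓ`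
of a difference of exponents of `a`. -/
theorem not_artinSchreier {ℓ : ℕ} (hp : ℓ.Prime) [CharP k ℓ] {A B : AddMonoidAlgebra k ℚ}
    (hB : B ≠ 0) : A ^ ℓ - A * B ^ (ℓ - 1) ≠ single 1 1 * B ^ ℓ := by
  intro h
  have : Fact ℓ.Prime := ⟨hp⟩
  have : CharP (AddMonoidAlgebra k ℚ) ℓ :=
    charP_of_injective_algebraMap (algebraMap k (AddMonoidAlgebra k ℚ)).injective ℓ
  have hℓ : (1 : ℚ) < ℓ := by exact_mod_cast hp.one_lt
  -- a bound for the denominators at `ℓ` of the finitely many exponents of `A` and `B`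
  obtain ⟨r, hr⟩ : ∃ r : ℕ, ∀ i ∈ A.coeff.support ∪ B.coeff.support,
      padicNorm ℓ i ≤ (ℓ : ℚ) ^ r := by
    obtain ⟨r, hr⟩ := pow_unbounded_of_one_lt
      (∑ i ∈ A.coeff.support ∪ B.coeff.support, padicNorm ℓ i) hℓ
    exact ⟨r, fun i hi => (single_le_sum (f := fun i => padicNorm ℓ i)
      (fun j _ => padicNorm.nonneg j) hi).trans hr.le⟩
  have hrB : ∀ i, B.coeff i ≠ 0 → padicNorm ℓ i ≤ (ℓ : ℚ) ^ r := fun i hi =>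
    hr i (mem_union_right _ (Finsupp.mem_support_iff.2 hi))
  have hnorm : ∀ s : ℕ, padicNorm ℓ (((ℓ : ℚ) ^ s)⁻¹) = (ℓ : ℚ) ^ s := fun s => by
    induction s with
    | zero => simp
    | succ s ih =>
      rw [pow_succ, mul_inv, padicNorm.mul, ih, inv_eq_one_div (ℓ : ℚ), padicNorm.div,
        padicNorm.one, padicNorm.padicNorm_p_of_prime, one_div, inv_inv]
  have key : ∀ s ≤ r, ∃ A' : AddMonoidAlgebra k ℚ,
      (∀ i, A'.coeff i ≠ 0 → padicNorm ℓ i ≤ (ℓ : ℚ) ^ r) ∧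
      A' ^ ℓ - A' * B ^ (ℓ - 1) = single (((ℓ : ℚ) ^ s)⁻¹) 1 * B ^ ℓ := by
    intro s
    induction s with
    | zero => exact fun _ => ⟨A, fun i hi => hr i (mem_union_left _ (Finsupp.mem_support_iff.2 hi)),
        by simpa using h⟩
    | succ s ih =>
      intro hs
      obtain ⟨A', hA', he⟩ := ih (by omega)
      set γ : ℚ := ((ℓ : ℚ) ^ (s + 1))⁻¹ with hγ
      have hγ' : ((ℓ : ℚ) ^ s)⁻¹ = ℓ • γ := by
        rw [hγ, nsmul_eq_mul, pow_succ]
        field_simp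
      -- substitute `a + T ^ γ` for `a`; as long as `s < r` the exponents stay within the bound
      refine ⟨A' - single γ 1 * B, fun i hi => ?_, ?_⟩
      · rw [coeff_sub, Finsupp.sub_apply] at hi
        by_cases hc : A'.coeff i = 0
        · rw [hc, zero_sub, neg_ne_zero] at hi
          obtain ⟨a, b, ha, hb, rfl⟩ := exists_coeff_ne_zero_of_mul hi
          have : a = γ := by
            by_contra hne
            rw [coeff_single, Finsupp.single_apply] at ha
            exact ha (if_neg (Ne.symm hne))
          refine padicNorm.nonarchimedean.trans (max_le ?_ (hrB b hb))
          rw [this, hγ, hnorm]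
          exact pow_le_pow_right₀ hℓ.le hs
        · exact hA' i hc
      · obtain ⟨m, rfl⟩ : ∃ m, ℓ = m + 1 := ⟨ℓ - 1, by have := hp.pos; omega⟩
        rw [sub_pow_char, mul_pow, single_pow, one_pow, ← hγ', sub_mul]
        rw [Nat.add_sub_cancel] at he ⊢
        rw [sub_sub_eq_add_sub, sub_eq_iff_eq_add] at *
        rw [he]
        ring
  obtain ⟨A', hA', he⟩ := key r le_rfl
  obtain ⟨α, β, hα, hβ, hαβ⟩ := deg_of_artinSchreier hp hB (by positivity) he
  -- `α - β = 1 / ℓ ^ (r + 1)` has a larger denominator than the exponents `α` and `β` allow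
  have h1 := (padicNorm.sub (p := ℓ)).trans (max_le (hA' α hα) (hrB β hβ))
  have h2 := congrArg (padicNorm ℓ) hαβ
  rw [padicNorm.mul, hnorm, padicNorm.padicNorm_p_of_prime] at h2
  have h3 : (0 : ℚ) < (ℓ : ℚ) ^ r := by positivity
  have h4 : padicNorm ℓ (α - β) = ℓ * (ℓ : ℚ) ^ r := by
    rw [← h2]; field_simp
  rw [h4] at h1
  nlinarith

end ArtinSchreier

end RamifiedTower

/-! ### The Gauss valuation on the monoid algebra of the rationals -/

namespace RamifiedTower

open WithZero Finset AddMonoidAlgebra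

section Gauss

variable {L : Type*} [Field L] (v : Valuation L ℤᵐ⁰)

/-- The inclusion of the polynomials with integral coefficients. -/
noncomputable abbrev integralIncl :
    AddMonoidAlgebra v.valuationSubring ℚ →+* AddMonoidAlgebra L ℚ :=
  mapRingHom ℚ v.valuationSubring.subtype

/-- Reduction of coefficients. -/
noncomputable abbrev integralRed : AddMonoidAlgebra v.valuationSubring ℚ →+*
    AddMonoidAlgebra (IsLocalRing.ResidueField v.valuationSubring) ℚ :=
  mapRingHom ℚ (IsLocalRing.residue v.valuationSubring)

/-- The largest value of a coefficient. -/
def gaussFun (f : AddMonoidAlgebra L ℚ) : ℤᵐ⁰ := f.coeff.support.sup fun i => v (f.coeff i)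

variable {v}

theorem gaussFun_le_iff {f : AddMonoidAlgebra L ℚ} {c : ℤᵐ⁰} :
    gaussFun v f ≤ c ↔ ∀ i, v (f.coeff i) ≤ c := by
  rw [gaussFun, Finset.sup_le_iff]
  refine ⟨fun h i => ?_, fun h i _ => h i⟩
  by_cases hi : f.coeff i = 0
  · rw [hi, map_zero]; exact zero_le
  · exact h i (Finsupp.mem_support_iff.2 hi)

theorem le_gaussFun (f : AddMonoidAlgebra L ℚ) (i : ℚ) : v (f.coeff i) ≤ gaussFun v f :=
  gaussFun_le_iff.1 le_rfl i

theorem exists_gaussFun_eq (f : AddMonoidAlgebra L ℚ) : ∃ i, v (f.coeff i) = gaussFun v f := by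
  rcases f.coeff.support.eq_empty_or_nonempty with h | h
  · refine ⟨0, ?_⟩
    rw [Finsupp.support_eq_empty] at h
    rw [gaussFun, h]; simp
  · obtain ⟨i, -, hi⟩ := exists_mem_eq_sup _ h fun i => v (f.coeff i)
    exact ⟨i, hi.symm⟩

theorem gaussFun_smul (c : L) (f : AddMonoidAlgebra L ℚ) :
    gaussFun v (c • f) = v c * gaussFun v f := by
  refine le_antisymm (gaussFun_le_iff.2 fun i => ?_) ?_
  · rw [coeff_smul, Finsupp.smul_apply, smul_eq_mul, map_mul]
    exact mul_le_mul_right (le_gaussFun f i) _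
  · obtain ⟨i, hi⟩ := exists_gaussFun_eq (v := v) f
    rw [← hi, ← map_mul]
    exact le_gaussFun (c • f) i

theorem gaussFun_eq_zero_iff {f : AddMonoidAlgebra L ℚ} : gaussFun v f = 0 ↔ f = 0 := by
  rw [← le_zero_iff, gaussFun_le_iff]
  simp only [le_zero_iff, Valuation.zero_iff]
  refine ⟨fun h => AddMonoidAlgebra.ext (Finsupp.ext h), fun h i => by rw [h]; rfl⟩

theorem gaussFun_integralIncl_le (F : AddMonoidAlgebra v.valuationSubring ℚ) :
    gaussFun v (integralIncl v F) ≤ 1 := by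
  rw [gaussFun_le_iff]
  intro i
  rw [coeff_mapRingHom]
  exact (F.coeff i).2

theorem exists_integralIncl_eq {f : AddMonoidAlgebra L ℚ} (hf : gaussFun v f ≤ 1) :
    ∃ F, integralIncl v F = f := by
  rw [gaussFun_le_iff] at hf
  refine ⟨⟨Finsupp.onFinset f.coeff.support (fun i => ⟨f.coeff i, hf i⟩) fun i hi => ?_⟩, ?_⟩
  · rw [Finsupp.mem_support_iff]
    exact fun hc => hi (Subtype.ext hc)
  · refine AddMonoidAlgebra.ext (Finsupp.ext fun i => ?_)
    rw [coeff_mapRingHom]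
    rfl

theorem residue_eq_zero_iff_lt_one (x : v.valuationSubring) :
    IsLocalRing.residue v.valuationSubring x = 0 ↔ v x < 1 := by
  rw [IsLocalRing.residue_eq_zero_iff, Valuation.mem_maximalIdeal_iff]

theorem gaussFun_integralIncl_lt_one_iff {F : AddMonoidAlgebra v.valuationSubring ℚ} :
    gaussFun v (integralIncl v F) < 1 ↔ integralRed v F = 0 := by
  constructor
  · intro h
    refine AddMonoidAlgebra.ext (Finsupp.ext fun i => ?_)
    rw [coeff_mapRingHom]
    refine (residue_eq_zero_iff_lt_one _).2 (lt_of_le_of_lt ?_ h)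
    have := le_gaussFun (v := v) (integralIncl v F) i
    rwa [coeff_mapRingHom] at this
  · intro h
    obtain ⟨i, hi⟩ := exists_gaussFun_eq (v := v) (integralIncl v F)
    rw [← hi, coeff_mapRingHom]
    refine (residue_eq_zero_iff_lt_one _).1 ?_
    rw [← coeff_mapRingHom, h]
    rfl

theorem exists_smul_integralIncl {f : AddMonoidAlgebra L ℚ} (hf : f ≠ 0) :
    ∃ (c : L) (F : AddMonoidAlgebra v.valuationSubring ℚ), c ≠ 0 ∧ integralRed v F ≠ 0 ∧
      f = c • integralIncl v F := by
  obtain ⟨i, hi⟩ := exists_gaussFun_eq (v := v) f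
  have hc : f.coeff i ≠ 0 := by
    rw [← v.ne_zero_iff, hi, Ne, gaussFun_eq_zero_iff]
    exact hf
  have h1 : gaussFun v ((f.coeff i)⁻¹ • f) = 1 := by
    rw [gaussFun_smul, ← hi, map_inv₀, inv_mul_cancel₀ ((v.ne_zero_iff).2 hc)]
  obtain ⟨F, hF⟩ := exists_integralIncl_eq h1.le
  refine ⟨f.coeff i, F, hc, fun h => ?_, ?_⟩
  · rw [← gaussFun_integralIncl_lt_one_iff, hF, h1] at h
    exact lt_irrefl _ h
  · rw [hF, smul_inv_smul₀ hc]

theorem gaussFun_integralIncl_eq_one {F : AddMonoidAlgebra v.valuationSubring ℚ}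
    (h : integralRed v F ≠ 0) : gaussFun v (integralIncl v F) = 1 := by
  rw [Ne, ← gaussFun_integralIncl_lt_one_iff, not_lt] at h
  exact le_antisymm (gaussFun_integralIncl_le F) h

/-- Gauss's lemma: reduction modulo the maximal ideal takes values in a domain. -/
theorem gaussFun_mul (f g : AddMonoidAlgebra L ℚ) :
    gaussFun v (f * g) = gaussFun v f * gaussFun v g := by
  have hz : gaussFun v (0 : AddMonoidAlgebra L ℚ) = 0 := gaussFun_eq_zero_iff.2 rfl
  rcases eq_or_ne f 0 with rfl | hf
  · rw [zero_mul, hz, zero_mul]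
  rcases eq_or_ne g 0 with rfl | hg
  · rw [mul_zero, hz, mul_zero]
  obtain ⟨c, F, -, hF, rfl⟩ := exists_smul_integralIncl (v := v) hf
  obtain ⟨d, G, -, hG, rfl⟩ := exists_smul_integralIncl (v := v) hg
  have hFG : integralRed v (F * G) ≠ 0 := by
    rw [map_mul]; exact mul_ne_zero hF hG
  rw [smul_mul_smul_comm, ← map_mul, gaussFun_smul, gaussFun_smul, gaussFun_smul,
    gaussFun_integralIncl_eq_one hF, gaussFun_integralIncl_eq_one hG,
    gaussFun_integralIncl_eq_one hFG, map_mul]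
  simp

variable (v)

/-- The Gauss valuation on the monoid algebra `L[T ^ ℚ]`. -/
def gaussValuation : Valuation (AddMonoidAlgebra L ℚ) ℤᵐ⁰ where
  toFun := gaussFun v
  map_zero' := gaussFun_eq_zero_iff.2 rfl
  map_one' := by
    have h := gaussFun_integralIncl_eq_one (v := v) (F := 1) (by rw [map_one]; exact one_ne_zero)
    rwa [map_one] at h
  map_mul' := gaussFun_mul
  map_add_le_max' f g := by
    rw [gaussFun_le_iff]
    intro i
    rw [coeff_add, Finsupp.add_apply]
    exact (v.map_add _ _).trans (max_le_max (le_gaussFun f i) (le_gaussFun g i))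

theorem nonZeroDivisors_le_gaussValuation :
    nonZeroDivisors (AddMonoidAlgebra L ℚ) ≤ (gaussValuation v).supp.primeCompl := by
  intro f hf hc
  have h : f ∈ (gaussValuation v).supp := hc
  rw [Valuation.mem_supp_iff] at h
  exact nonZeroDivisors.ne_zero hf (gaussFun_eq_zero_iff.1 h)

/-- The Gauss valuation on the field of fractions of `L[T ^ ℚ]`. -/
noncomputable def gaussFrac : Valuation (FractionRing (AddMonoidAlgebra L ℚ)) ℤᵐ⁰ :=
  (gaussValuation v).extendToLocalization (nonZeroDivisors_le_gaussValuation v) _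

theorem gaussFrac_algebraMap (f : AddMonoidAlgebra L ℚ) :
    gaussFrac v (algebraMap _ _ f) = gaussFun v f :=
  Valuation.extendToLocalization_apply_map_apply _ _ _ f

/-- The polynomials with integral coefficients as elements of the field of fractions. -/
noncomputable abbrev integralToFrac : AddMonoidAlgebra v.valuationSubring ℚ →+*
    FractionRing (AddMonoidAlgebra L ℚ) :=
  (algebraMap _ _).comp (integralIncl v)

variable {v}

theorem ordGE_one_iff_lt_one {F : Type*} [Field F] {w : Valuation F ℤᵐ⁰} {x : F} :
    OrdGE w 1 x ↔ w x < 1 := by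
  constructor
  · exact fun h => lt_of_le_of_lt h (by rw [← exp_zero, exp_lt_exp]; norm_num)
  · intro h
    have h0 : OrdGE w 0 x := by rw [OrdGE]; simpa using h.le
    rcases h0.lt_or_eq with h1 | h1
    · exact h1
    · rw [OrdEq, neg_zero, exp_zero] at h1
      exact absurd h1 h.ne

theorem ordGE_integralToFrac (F : AddMonoidAlgebra v.valuationSubring ℚ) :
    OrdGE (gaussFrac v) 0 (integralToFrac v F) := by
  rw [OrdGE, RingHom.comp_apply, gaussFrac_algebraMap, neg_zero, exp_zero]
  exact gaussFun_integralIncl_le F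

theorem ordGE_one_integralToFrac_iff {F : AddMonoidAlgebra v.valuationSubring ℚ} :
    OrdGE (gaussFrac v) 1 (integralToFrac v F) ↔ integralRed v F = 0 := by
  rw [ordGE_one_iff_lt_one, RingHom.comp_apply, gaussFrac_algebraMap,
    gaussFun_integralIncl_lt_one_iff]

theorem ordEq_integralToFrac {F : AddMonoidAlgebra v.valuationSubring ℚ}
    (h : integralRed v F ≠ 0) : OrdEq (gaussFrac v) 0 (integralToFrac v F) := by
  rw [OrdEq, RingHom.comp_apply, gaussFrac_algebraMap, gaussFun_integralIncl_eq_one h]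
  simp

/-- An integral element of the field of fractions is a fraction with integral numerator and
denominator of nonzero reduction. -/
theorem exists_integralToFrac_div {x : FractionRing (AddMonoidAlgebra L ℚ)}
    (hx : OrdGE (gaussFrac v) 0 x) : ∃ F G, integralRed v G ≠ 0 ∧
      x = integralToFrac v F / integralToFrac v G := by
  obtain ⟨f, g, hg, rfl⟩ := IsFractionRing.div_surjective (A := AddMonoidAlgebra L ℚ) x
  have hg0 := nonZeroDivisors.ne_zero hg
  obtain ⟨c, G, hc, hG, hgG⟩ := exists_smul_integralIncl (v := v) hg0
  have hc' : algebraMap (AddMonoidAlgebra L ℚ) (FractionRing (AddMonoidAlgebra L ℚ))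
      (algebraMap L _ c) ≠ 0 := by
    rw [Ne, FaithfulSMul.algebraMap_eq_zero_iff, FaithfulSMul.algebraMap_eq_zero_iff]
    exact hc
  have hG0 := (ordEq_integralToFrac hG).ne_zero
  have hf : gaussFun v (c⁻¹ • f) ≤ 1 := by
    rw [OrdGE, map_div₀, gaussFrac_algebraMap, gaussFrac_algebraMap, hgG, gaussFun_smul,
      gaussFun_integralIncl_eq_one hG, mul_one, neg_zero, exp_zero] at hx
    rwa [gaussFun_smul, map_inv₀, mul_comm, ← div_eq_mul_inv]
  obtain ⟨F, hF⟩ := exists_integralIncl_eq hf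
  refine ⟨F, G, hG, ?_⟩
  have hf' : f = algebraMap L _ c * integralIncl v F := by
    rw [hF, ← Algebra.smul_def, smul_inv_smul₀ hc]
  rw [hgG, hf', Algebra.smul_def, map_mul, map_mul, mul_div_mul_left _ _ hc']
  rfl

end Gauss

end RamifiedTower

/-! ### Enlarging the residue field -/

namespace RamifiedTower

open WithZero Finset AddMonoidAlgebra

section BaseChange

theorem ordGE_div_sub_div {F : Type*} [Field F] {w : Valuation F ℤᵐ⁰} {a b c d : F}
    (hb : OrdEq w 0 b) (hd : OrdEq w 0 d) (h : OrdGE w 1 (a * d - b * c)) :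
    OrdGE w 1 (a / b - c / d) := by
  rw [div_sub_div _ _ hb.ne_zero hd.ne_zero]
  simpa using h.div (hb.mul hd)

variable {L : Type*} [Field L] {v : Valuation L ℤᵐ⁰}

/-- Every polynomial with integral coefficients can be altered, without changing its reduction,
so that its coefficients lie in a given set of representatives of the residue field. -/
theorem exists_integralRed_eq (S : L → Prop) (h0 : S 0)
    (hS : ∀ x, OrdGE v 0 x → ∃ a, S a ∧ OrdGE v 1 (x - a))
    (f : AddMonoidAlgebra (IsLocalRing.ResidueField v.valuationSubring) ℚ) :
    ∃ F, integralRed v F = f ∧ ∀ i, S ((integralIncl v F).coeff i) := by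
  classical
  have h1 : ∀ y : IsLocalRing.ResidueField v.valuationSubring,
      ∃ x : v.valuationSubring, IsLocalRing.residue _ x = y ∧ S x ∧ (y = 0 → x = 0) := by
    intro y
    -- zero must be lifted to zero to keep the supports finite
    by_cases hy : y = 0
    · exact ⟨0, by rw [map_zero, hy], h0, fun _ => rfl⟩
    obtain ⟨x, rfl⟩ := IsLocalRing.residue_surjective y
    have hx0 : OrdGE v 0 (x : L) := by
      rw [OrdGE, neg_zero, exp_zero]
      exact x.2
    obtain ⟨a, ha, hxa⟩ := hS x hx0
    have ha0 : v a ≤ 1 := by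
      have := hx0.sub (hxa.mono (m := 0) (by norm_num))
      rw [sub_sub_cancel, OrdGE] at this
      simpa using this
    refine ⟨⟨a, ha0⟩, ?_, ha, fun h => absurd h hy⟩
    rw [eq_comm, ← sub_eq_zero, ← map_sub, residue_eq_zero_iff_lt_one, ← ordGE_one_iff_lt_one]
    exact hxa
  choose s hs1 hs2 hs3 using h1
  refine ⟨⟨f.coeff.mapRange s (hs3 0 rfl)⟩, ?_, fun i => ?_⟩
  · refine AddMonoidAlgebra.ext (Finsupp.ext fun i => ?_)
    rw [coeff_mapRingHom]
    exact hs1 _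
  · rw [coeff_mapRingHom]
    exact hs2 _

/-- The automorphism of `L[T ^ ℚ]` which acts on coefficients. -/
noncomputable def coeffEquiv (σ : L ≃+* L) : AddMonoidAlgebra L ℚ ≃+* AddMonoidAlgebra L ℚ :=
  RingEquiv.ofRingHom (mapRingHom ℚ σ.toRingHom) (mapRingHom ℚ σ.symm.toRingHom)
    (by rw [← mapRingHom_comp]; simp) (by rw [← mapRingHom_comp]; simp)

theorem coeff_coeffEquiv (σ : L ≃+* L) (f : AddMonoidAlgebra L ℚ) (i : ℚ) :
    (coeffEquiv σ f).coeff i = σ (f.coeff i) :=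
  coeff_mapRingHom σ.toRingHom f i

theorem coeff_coeffEquiv_pow (σ : L ≃+* L) (n : ℕ) (f : AddMonoidAlgebra L ℚ) (i : ℚ) :
    ((coeffEquiv σ ^ n) f).coeff i = (σ ^ n) (f.coeff i) := by
  induction n with
  | zero => rfl
  | succ n ih =>
    rw [pow_succ', pow_succ', RingAut.mul_apply, RingAut.mul_apply, coeff_coeffEquiv, ih]

theorem gaussFun_coeffEquiv {σ : L ≃+* L} (hσ : ∀ x, v (σ x) = v x) (f : AddMonoidAlgebra L ℚ) :
    gaussFun v (coeffEquiv σ f) = gaussFun v f := by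
  refine le_antisymm (gaussFun_le_iff.2 fun i => ?_) (gaussFun_le_iff.2 fun i => ?_)
  · rw [coeff_coeffEquiv, hσ]
    exact le_gaussFun f i
  · rw [← hσ, ← coeff_coeffEquiv]
    exact le_gaussFun _ i

/-- The automorphism of the field of fractions of `L[T ^ ℚ]` which acts on coefficients. -/
noncomputable def fracEquiv (σ : L ≃+* L) :
    FractionRing (AddMonoidAlgebra L ℚ) ≃+* FractionRing (AddMonoidAlgebra L ℚ) :=
  IsFractionRing.ringEquivOfRingEquiv (coeffEquiv σ)

theorem fracEquiv_algebraMap (σ : L ≃+* L) (f : AddMonoidAlgebra L ℚ) :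
    fracEquiv σ (algebraMap _ _ f) = algebraMap _ _ (coeffEquiv σ f) :=
  IsFractionRing.ringEquivOfRingEquiv_algebraMap (coeffEquiv σ) f

theorem fracEquiv_pow_algebraMap (σ : L ≃+* L) (n : ℕ) (f : AddMonoidAlgebra L ℚ) :
    (fracEquiv σ ^ n) (algebraMap _ _ f) = algebraMap _ _ ((coeffEquiv σ ^ n) f) := by
  induction n with
  | zero => rfl
  | succ n ih =>
    rw [pow_succ', pow_succ', RingAut.mul_apply, RingAut.mul_apply, ih, fracEquiv_algebraMap]

theorem gaussFrac_fracEquiv {σ : L ≃+* L} (hσ : ∀ x, v (σ x) = v x)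
    (x : FractionRing (AddMonoidAlgebra L ℚ)) : gaussFrac v (fracEquiv σ x) = gaussFrac v x := by
  obtain ⟨f, g, -, rfl⟩ := IsFractionRing.div_surjective (A := AddMonoidAlgebra L ℚ) x
  simp only [map_div₀, fracEquiv_algebraMap, gaussFrac_algebraMap, gaussFun_coeffEquiv hσ]

theorem fracEquiv_integralToFrac {σ : L ≃+* L} {F : AddMonoidAlgebra v.valuationSubring ℚ}
    (hF : ∀ i, σ ((integralIncl v F).coeff i) = (integralIncl v F).coeff i) :
    fracEquiv σ (integralToFrac v F) = integralToFrac v F := by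
  rw [RingHom.comp_apply, fracEquiv_algebraMap]
  congr 1
  exact AddMonoidAlgebra.ext (Finsupp.ext fun i => (coeff_coeffEquiv _ _ _).trans (hF i))

namespace Tower

variable {σ : L ≃+* L} {ℓ N : ℕ} {π : L} {lam : ℕ → ℕ}

/-- The residue field of a tower can be enlarged so that it remains perfect and has an
Artin–Schreier extension. -/
theorem exists_artinSchreier.{u} {L : Type u} [Field L] {v : Valuation L ℤᵐ⁰} {σ : L ≃+* L}
    {ℓ N : ℕ} {π : L} {lam : ℕ → ℕ} (h : Tower v σ ℓ N π lam)
    (hperf : ∀ a, OrdGE v 0 a → ∃ b, OrdGE v 1 (b ^ ℓ - a)) :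
    ∃ (L' : Type u) (_ : Field L') (v' : Valuation L' ℤᵐ⁰) (σ' : L' ≃+* L') (ι : L →+* L'),
      (∀ x, v' (ι x) = v x) ∧ Tower v' σ' ℓ N (ι π) lam ∧
      (∀ a, OrdGE v' 0 a → ∃ b, σ' b = b ∧ OrdGE v' 1 (b ^ ℓ - a)) ∧
      (∃ c, σ' c = c ∧ OrdGE v' 0 c ∧ ∀ a, OrdGE v' 0 a → ¬ OrdGE v' 1 (a ^ ℓ - a - c)) := by
  have hp := h.prime
  have : Fact ℓ.Prime := ⟨hp⟩
  let k := IsLocalRing.ResidueField v.valuationSubring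
  have : CharP k ℓ := by
    have h1 : (ℓ : k) = 0 := by
      have h2 : IsLocalRing.residue v.valuationSubring (ℓ : v.valuationSubring) = 0 := by
        rw [residue_eq_zero_iff_lt_one, ← ordGE_one_iff_lt_one]
        simpa using h.natCast_ge
      simpa using h2
    exact ringChar.of_eq (CharP.ringChar_of_prime_eq_zero hp h1)
  have : PerfectRing k ℓ := by
    refine PerfectRing.ofSurjective k ℓ fun y => ?_
    obtain ⟨x, rfl⟩ := IsLocalRing.residue_surjective y
    have hx0 : OrdGE v 0 (x : L) := by
      rw [OrdGE, neg_zero, exp_zero]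
      exact x.2
    obtain ⟨b, hb⟩ := hperf x hx0
    have hb1 : OrdGE v 0 (b ^ ℓ) := hx0.of_sub (hb.mono (by norm_num))
    have hb0 : v b ≤ 1 := by
      rw [OrdGE, map_pow, neg_zero, exp_zero] at hb1
      exact (pow_le_one_iff hp.ne_zero).1 hb1
    refine ⟨IsLocalRing.residue _ ⟨b, hb0⟩, ?_⟩
    rw [frobenius_def, ← map_pow, ← sub_eq_zero, ← map_sub, residue_eq_zero_iff_lt_one,
      ← ordGE_one_iff_lt_one]
    exact hb
  have : CharP (AddMonoidAlgebra k ℚ) ℓ :=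
    charP_of_injective_algebraMap (algebraMap k (AddMonoidAlgebra k ℚ)).injective ℓ
  -- the monoid algebra of the rationals over a perfect field is perfect
  have hroot : ∀ f : AddMonoidAlgebra k ℚ, ∃ g, g ^ ℓ = f := by
    intro f
    induction f using AddMonoidAlgebra.induction_on with
    | of m =>
      refine ⟨single (m / ℓ) 1, ?_⟩
      rw [single_pow, one_pow, nsmul_eq_mul, mul_div_cancel₀ _ (by exact_mod_cast hp.ne_zero)]
      rfl
    | add f g hf hg =>
      obtain ⟨f', rfl⟩ := hf
      obtain ⟨g', rfl⟩ := hg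
      exact ⟨f' + g', add_pow_char _ _ _⟩
    | smul r f hf =>
      obtain ⟨f', rfl⟩ := hf
      obtain ⟨s, rfl⟩ := (PerfectRing.bijective_frobenius (R := k) (p := ℓ)).2 r
      exact ⟨s • f', smul_pow s f' ℓ⟩
  let ι : L →+* FractionRing (AddMonoidAlgebra L ℚ) := algebraMap L _
  have hιa : ∀ x, ι x = algebraMap (AddMonoidAlgebra L ℚ) _ (single 0 x) := fun x =>
    IsScalarTower.algebraMap_apply L (AddMonoidAlgebra L ℚ) _ x
  have hι : ∀ x, gaussFrac v (ι x) = v x := fun x => by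
    have h1 : (single 0 x : AddMonoidAlgebra L ℚ) = x • 1 := by
      rw [one_def, smul_single, smul_eq_mul, mul_one]
    have h2 : gaussFun v (1 : AddMonoidAlgebra L ℚ) = 1 := map_one (gaussValuation v)
    rw [hιa, gaussFrac_algebraMap, h1, gaussFun_smul, h2, mul_one]
  have hσι : ∀ x, fracEquiv σ (ι x) = ι (σ x) := fun x => by
    rw [hιa, fracEquiv_algebraMap, hιa]
    congr 1
    exact mapRingHom_single σ.toRingHom 0 x
  have hlift := exists_integralRed_eq (v := v) (fun x => σ x = x) (map_zero σ) h.resid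
  -- a fixed fraction with prescribed reductions of numerator and denominator
  have hfix : ∀ (f g : AddMonoidAlgebra k ℚ), ∃ F G, integralRed v F = f ∧ integralRed v G = g ∧
      fracEquiv σ (integralToFrac v F / integralToFrac v G) =
        integralToFrac v F / integralToFrac v G := by
    intro f g
    obtain ⟨F, hF1, hF2⟩ := hlift f
    obtain ⟨G, hG1, hG2⟩ := hlift g
    exact ⟨F, G, hF1, hG1, by
      rw [map_div₀, fracEquiv_integralToFrac hF2, fracEquiv_integralToFrac hG2]⟩
  have hT : Tower (gaussFrac v) (fracEquiv σ) ℓ N (ι π) lam := by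
    refine h.of_extension hι hσι (gaussFrac_fracEquiv h.map) (fun x => ?_) fun x hx => ?_
    · obtain ⟨f, g, -, rfl⟩ := IsFractionRing.div_surjective (A := AddMonoidAlgebra L ℚ) x
      have h1 : ∀ f : AddMonoidAlgebra L ℚ, (coeffEquiv σ ^ ℓ ^ N) f = f := fun f =>
        AddMonoidAlgebra.ext (Finsupp.ext fun i => by
          rw [coeff_coeffEquiv_pow, h.pow_eq])
      rw [map_div₀, fracEquiv_pow_algebraMap, fracEquiv_pow_algebraMap, h1, h1]
    · obtain ⟨F, G, hG, rfl⟩ := exists_integralToFrac_div hx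
      obtain ⟨F', G', hF', hG', hfx⟩ := hfix (integralRed v F) (integralRed v G)
      refine ⟨_, hfx, ordGE_div_sub_div (ordEq_integralToFrac hG)
        (ordEq_integralToFrac (by rwa [hG'])) ?_⟩
      rw [← map_mul, ← map_mul, ← map_sub, ordGE_one_integralToFrac_iff, map_sub, map_mul,
        map_mul, hF', hG', mul_comm, sub_self]
  refine ⟨_, _, gaussFrac v, fracEquiv σ, ι, hι, hT, fun x hx => ?_, ?_⟩
  · obtain ⟨F, G, hG, rfl⟩ := exists_integralToFrac_div hx
    obtain ⟨f, hf⟩ := hroot (integralRed v F)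
    obtain ⟨g, hg⟩ := hroot (integralRed v G)
    obtain ⟨F', G', hF', hG', hfx⟩ := hfix f g
    have hg0 : g ≠ 0 := by
      rintro rfl
      rw [zero_pow hp.ne_zero] at hg
      exact hG hg.symm
    refine ⟨_, hfx, ?_⟩
    rw [div_pow, ← map_pow, ← map_pow]
    refine ordGE_div_sub_div (ordEq_integralToFrac ?_) (ordEq_integralToFrac hG) ?_
    · rw [map_pow, hG']
      exact pow_ne_zero _ hg0
    · rw [← map_mul, ← map_mul, ← map_sub, ordGE_one_integralToFrac_iff, map_sub, map_mul,
        map_mul, map_pow, map_pow, hF', hG', hf, hg, mul_comm, sub_self]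
  · refine ⟨integralToFrac v (single 1 1), ?_, ordGE_integralToFrac _, fun x hx hxc => ?_⟩
    · refine fracEquiv_integralToFrac fun i => ?_
      rw [mapRingHom_single, map_one, coeff_single, Finsupp.single_apply]
      split_ifs
      · exact map_one σ
      · exact map_zero σ
    · obtain ⟨F, G, hG, rfl⟩ := exists_integralToFrac_div hx
      refine not_artinSchreier (k := k) hp hG (A := integralRed v F) ?_
      have hG0 := ordEq_integralToFrac hG
      have h1 := hxc.mul (hG0.pow ℓ).ge
      have h2 : ∀ x y t : FractionRing (AddMonoidAlgebra L ℚ), y ≠ 0 →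
          ((x / y) ^ ℓ - x / y - t) * y ^ ℓ = x ^ ℓ - x * y ^ (ℓ - 1) - t * y ^ ℓ := by
        intro x y t hy
        obtain ⟨m, rfl⟩ : ∃ m, ℓ = m + 1 := ⟨ℓ - 1, by have := hp.pos; omega⟩
        rw [Nat.add_sub_cancel, sub_mul, sub_mul, ← mul_pow, div_mul_cancel₀ _ hy, pow_succ y,
          div_mul_eq_mul_div, mul_comm (y ^ m) y, mul_left_comm, mul_div_cancel_left₀ _ hy]
      rw [h2 _ _ _ hG0.ne_zero] at h1
      simp only [← map_pow, ← map_mul, ← map_sub] at h1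
      have h3 := ordGE_one_integralToFrac_iff.1 (h1.mono (m := 1) (by simp))
      rw [map_sub, map_sub, map_mul, map_mul, map_pow, map_pow, map_pow, mapRingHom_single,
        map_one, sub_eq_zero] at h3
      exact h3

/-- A tower with perfect residue field embeds, with the same breaks, into a complete one with
perfect residue field which has an Artin–Schreier extension. -/
theorem exists_complete_artinSchreier.{u} {L : Type u} [Field L] {v : Valuation L ℤᵐ⁰}
    {σ : L ≃+* L} {ℓ N : ℕ} {π : L} {lam : ℕ → ℕ} (h : Tower v σ ℓ N π lam)
    (hperf : ∀ a, OrdGE v 0 a → ∃ b, OrdGE v 1 (b ^ ℓ - a)) :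
    ∃ (L' : Type u) (_ : Field L') (v' : Valuation L' ℤᵐ⁰) (σ' : L' ≃+* L') (ι : L →+* L'),
      (∀ x, v' (ι x) = v x) ∧ Tower v' σ' ℓ N (ι π) lam ∧ IsVComplete v' ∧
      (∀ a, OrdGE v' 0 a → ∃ b, σ' b = b ∧ OrdGE v' 1 (b ^ ℓ - a)) ∧
      (∃ c, σ' c = c ∧ OrdGE v' 0 c ∧ ∀ a, OrdGE v' 0 a → ¬ OrdGE v' 1 (a ^ ℓ - a - c)) := by
  obtain ⟨L₁, _, v₁, σ₁, ι₁, hι₁, h₁, hp₁, ha₁⟩ := h.exists_artinSchreier hperf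
  obtain ⟨L₂, _, v₂, σ₂, ι₂, hι₂, h₂, hc, hp₂, ha₂⟩ := h₁.exists_complete hp₁ ha₁
  exact ⟨L₂, _, v₂, σ₂, ι₂.comp ι₁, fun x => (hι₂ _).trans (hι₁ x), h₂, hc, hp₂, ha₂⟩

/-- Lower bound for the growth of the upper breaks. -/
theorem min_le_upperBreak_of_perfect (h : Tower v σ ℓ N π lam)
    (hperf : ∀ a, OrdGE v 0 a → ∃ b, OrdGE v 1 (b ^ ℓ - a))
    {E : ℤ} (hE : OrdEq v E (ℓ : L)) {n : ℕ} (hn : n + 1 < N) :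
    min (upperBreak ℓ N lam n + E) (ℓ * upperBreak ℓ N lam n) ≤ upperBreak ℓ N lam (n + 1) := by
  obtain ⟨L', _, v', σ', ι, hι, h', hc, hp', ha'⟩ := h.exists_complete_artinSchreier hperf
  refine h'.min_le_upperBreak hc hp' ha' ?_ hn
  rw [← map_natCast ι, OrdEq, hι]
  exact hE

/-- Upper bound for the growth of the upper breaks. -/
theorem upperBreak_succ_le_of_perfect (h : Tower v σ ℓ N π lam)
    (hperf : ∀ a, OrdGE v 0 a → ∃ b, OrdGE v 1 (b ^ ℓ - a))
    {E : ℤ} (hE : OrdEq v E (ℓ : L)) {n : ℕ} (hn : n + 1 < N)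
    (hlarge : E ≤ (ℓ - 1) * upperBreak ℓ N lam n) :
    upperBreak ℓ N lam (n + 1) ≤ upperBreak ℓ N lam n + E := by
  obtain ⟨L', _, v', σ', ι, hι, h', hc, hp', ha'⟩ := h.exists_complete_artinSchreier hperf
  refine h'.upperBreak_succ_le hc hp' ha' ?_ hn hlarge
  rw [← map_natCast ι, OrdEq, hι]
  exact hE

end Tower

end BaseChange

end RamifiedTower

/-! ### Totally ramified extensions of a discrete valuation ring -/

namespace RamifiedTower

open WithZero Finset

section TotRam

theorem OrdEq.zpow {F : Type*} [Field F] {v : Valuation F ℤᵐ⁰} {m : ℤ} {x : F} (hx : OrdEq v m x)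
    (k : ℤ) : OrdEq v (k * m) (x ^ k) := by
  rw [OrdEq] at hx ⊢
  rw [map_zpow₀, hx, ← exp_zsmul, smul_eq_mul, mul_neg]

/-- `v` is a normalised discrete valuation of `F` whose valuation ring is the integral closure
of the ring `R`; its residue field is that of `R`, and `ϖ` in `R` has order `n`. -/
structure IsTotRamVal {R F : Type*} [CommRing R] [Field F] [Algebra R F] (v : Valuation F ℤᵐ⁰)
    (ϖ : R) (n : ℕ) : Prop where
  pos : 0 < n
  integral_iff : ∀ x, OrdGE v 0 x ↔ IsIntegral R x
  unif : OrdEq v n (algebraMap R F ϖ)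
  resid : ∀ x, OrdGE v 0 x → ∃ r : R, OrdGE v 1 (x - algebraMap R F r)

variable {R : Type*} [CommRing R]

namespace IsTotRamVal

variable {F F' : Type*} [Field F] [Field F'] [Algebra R F] [Algebra R F'] {v : Valuation F ℤᵐ⁰}
  {v' : Valuation F' ℤᵐ⁰} {ϖ : R} {n n' : ℕ}

/-- If `x` has order `k`, then `x ^ n / ϖ ^ k` is a unit, a property which embeddings preserve. -/
theorem ordEq_map (h : IsTotRamVal v ϖ n) (h' : IsTotRamVal v' ϖ n') (ψ : F →ₐ[R] F') {x : F}
    {k k' : ℤ} (hx : OrdEq v k x) (hx' : OrdEq v' k' (ψ x)) : n * k' = k * n' := by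
  have hunit : ∀ {u : F}, OrdEq v 0 u → OrdEq v' 0 (ψ u) := by
    intro u hu
    have h1 := (h'.integral_iff _).2 (((h.integral_iff _).1 hu.ge).map ψ)
    have h2 := (h'.integral_iff _).2 (((h.integral_iff _).1 hu.inv.ge).map ψ)
    obtain ⟨m, hm⟩ := exists_ordEq v' ((map_ne_zero_iff ψ ψ.toRingHom.injective).2 hu.ne_zero)
    have h3 := hm.le_of_ge h1
    rw [map_inv₀] at h2
    have h4 := hm.inv.le_of_ge h2
    obtain rfl : m = 0 := by omega
    exact hm
  have hu : OrdEq v 0 (x ^ n / algebraMap R F ϖ ^ k) := by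
    convert (hx.pow n).div (h.unif.zpow k) using 1
    ring
  have h1 := hunit hu
  rw [map_div₀, map_pow, map_zpow₀, AlgHom.commutes] at h1
  have h2 := (hx'.pow n).div (h'.unif.zpow k)
  have := h1.unique h2
  linarith

theorem map_algEquiv (h : IsTotRamVal v ϖ n) (ψ : F ≃ₐ[R] F) (x : F) : v (ψ x) = v x := by
  rcases eq_or_ne x 0 with rfl | hx
  · rw [map_zero]
  obtain ⟨k, hk⟩ := exists_ordEq v hx
  obtain ⟨k', hk'⟩ := exists_ordEq v ((map_ne_zero_iff ψ ψ.injective).2 hx)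
  have := h.ordEq_map h ψ.toAlgHom hk hk'
  have hn : (n : ℤ) ≠ 0 := by exact_mod_cast h.pos.ne'
  have h1 : k' = k := mul_left_cancel₀ hn (this.trans (mul_comm _ _))
  rw [hk, ← h1, ← hk']

theorem ordGE_zero_algebraMap (h : IsTotRamVal v ϖ n) (r : R) : OrdGE v 0 (algebraMap R F r) :=
  (h.integral_iff _).2 isIntegral_algebraMap

/-- Expansion of an integral element in powers of a uniformizer. -/
theorem exists_expansion (h : IsTotRamVal v ϖ n) {π : F} (hπ : OrdEq v 1 π) (k : ℕ) {x : F}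
    (hx : OrdGE v 0 x) : ∃ y ∈ Algebra.adjoin R {π}, OrdGE v k (x - y) := by
  induction k with
  | zero => exact ⟨0, zero_mem _, by simpa using hx⟩
  | succ k ih =>
    obtain ⟨y, hy, hxy⟩ := ih
    have h1 := hxy.div (hπ.pow k)
    rw [mul_one, sub_self] at h1
    obtain ⟨r, hr⟩ := h.resid _ h1
    refine ⟨y + algebraMap R F r * π ^ k, add_mem hy (mul_mem (algebraMap_mem _ r)
      (pow_mem (Algebra.self_mem_adjoin_singleton R π) k)), ?_⟩
    have h2 := hr.mul (hπ.pow k).ge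
    rw [sub_mul, div_mul_cancel₀ _ (hπ.pow k).ne_zero] at h2
    rw [← sub_sub]
    refine h2.mono ?_
    push_cast; omega

/-- A uniformizer generates the ring of integers, by Nakayama's lemma. -/
theorem mem_adjoin [IsLocalRing R] (hϖ : ϖ ∈ IsLocalRing.maximalIdeal R) (h : IsTotRamVal v ϖ n)
    (hfin : (integralClosure R F).toSubmodule.FG) {π : F} (hπ : OrdEq v 1 π) {x : F}
    (hx : OrdGE v 0 x) : x ∈ Algebra.adjoin R {π} := by
  have key : (integralClosure R F).toSubmodule ≤ (Algebra.adjoin R {π}).toSubmodule := by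
    refine Submodule.le_of_le_smul_of_le_jacobson_bot (I := IsLocalRing.maximalIdeal R) hfin
      (IsLocalRing.maximalIdeal_le_jacobson ⊥) fun z hz => ?_
    obtain ⟨y, hy, hzy⟩ := h.exists_expansion hπ n ((h.integral_iff z).2 hz)
    have h1 := hzy.div h.unif
    rw [sub_self] at h1
    refine Submodule.mem_sup.2 ⟨y, hy, ϖ • ((z - y) / algebraMap R F ϖ),
      Submodule.smul_mem_smul hϖ ((h.integral_iff _).1 h1), ?_⟩
    rw [Algebra.smul_def, mul_div_cancel₀ _ h.unif.ne_zero, add_sub_cancel]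
  exact key ((h.integral_iff x).1 hx)

/-- An automorphism which fixes a uniformizer is trivial. -/
theorem eq_one_of_apply_unif [IsLocalRing R] (hϖ : ϖ ∈ IsLocalRing.maximalIdeal R)
    (h : IsTotRamVal v ϖ n) (hfin : (integralClosure R F).toSubmodule.FG) {π : F}
    (hπ : OrdEq v 1 π) (ψ : F ≃ₐ[R] F) (hψ : ψ π = π) (x : F) : ψ x = x := by
  rcases eq_or_ne x 0 with rfl | hx
  · exact map_zero ψ
  have key : ∀ y, OrdGE v 0 y → ψ y = y := fun y hy => by
    have hy' := h.mem_adjoin hϖ hfin hπ hy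
    have : Algebra.adjoin R {π} ≤ AlgHom.equalizer ψ.toAlgHom (AlgHom.id R F) :=
      Algebra.adjoin_le (by rintro _ rfl; exact hψ)
    exact this hy'
  obtain ⟨k, hk⟩ := exists_ordEq v hx
  rcases le_total 0 k with hk0 | hk0
  · exact key x (hk.ge.mono hk0)
  · have h1 := key _ (hk.inv.ge.mono (by omega))
    rw [map_inv₀] at h1
    exact inv_injective h1

end IsTotRamVal

variable [IsDomain R] [IsDiscreteValuationRing R] {B : Type*} [CommRing B]
  [IsDedekindDomain B] [Algebra R B]

theorem exists_sub_algebraMap_mem {P : Ideal B} (hP : P.IsPrime)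
    (hPl : P.LiesOver (IsLocalRing.maximalIdeal R)) (hP0 : P ≠ ⊥) (hf : P.inertiaDeg R = 1)
    (b : B) : ∃ r : R, b - algebraMap R B r ∈ P := by
  have hPm : P.IsMaximal := hP.isMaximal hP0
  rw [Ideal.inertiaDeg_eq_of_isMaximal (IsLocalRing.maximalIdeal R) P] at hf
  let : Field (R ⧸ IsLocalRing.maximalIdeal R) := Ideal.Quotient.field _
  let : Field (B ⧸ P) := Ideal.Quotient.field _
  obtain ⟨c, hc⟩ := (finrank_eq_one_iff_of_nonzero' (1 : B ⧸ P) one_ne_zero).1 hf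
    (Ideal.Quotient.mk P b)
  obtain ⟨r, rfl⟩ := Ideal.Quotient.mk_surjective c
  refine ⟨r, ?_⟩
  rw [← Ideal.Quotient.eq, ← hc, Algebra.smul_def, mul_one]
  rfl

variable [Module.Finite R B] [Module.IsTorsionFree R B]

/-- In the totally ramified case the fundamental identity leaves room for one prime only, of
inertia degree one. -/
theorem eq_and_inertiaDeg_eq_one (hram : ∀ P : Ideal B, P.IsPrime →
      P.LiesOver (IsLocalRing.maximalIdeal R) → P.ramificationIdx R = Module.finrank R B)
    {P Q : Ideal B} (hP : P.IsPrime) (hPl : P.LiesOver (IsLocalRing.maximalIdeal R))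
    (hQ : Q.IsPrime) (hQl : Q.LiesOver (IsLocalRing.maximalIdeal R)) :
    Q = P ∧ P.inertiaDeg R = 1 := by
  classical
  have hsum := Ideal.sum_ramification_inertia_eq_finrank (IsLocalRing.maximalIdeal R) B
  have hpos : 0 < Module.finrank R B := by
    rw [← hram P hP hPl]; exact P.ramificationIdx_pos R
  let p : (IsLocalRing.maximalIdeal R).primesOver B := ⟨P, hP, hPl⟩
  let q : (IsLocalRing.maximalIdeal R).primesOver B := ⟨Q, hQ, hQl⟩
  have hle : ∀ s : Finset ((IsLocalRing.maximalIdeal R).primesOver B),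
      ∑ x ∈ s, Module.finrank R B * x.1.inertiaDeg R ≤ Module.finrank R B := by
    intro s
    refine le_trans (le_of_eq (sum_congr rfl fun x _ => ?_))
      ((sum_le_univ_sum_of_nonneg fun x => Nat.zero_le _).trans hsum.le)
    rw [hram x.1 x.2.1 x.2.2]
  have hp1 : 0 < P.inertiaDeg R := P.inertiaDeg_pos R
  have hq1 : 0 < Q.inertiaDeg R := Q.inertiaDeg_pos R
  constructor
  · by_contra hne
    have h1 := hle {p, q}
    rw [sum_pair (fun hpq => hne (congrArg Subtype.val hpq).symm)] at h1
    change Module.finrank R B * P.inertiaDeg R + Module.finrank R B * Q.inertiaDeg R ≤ _ at h1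
    nlinarith
  · have h1 := hle {p}
    rw [sum_singleton] at h1
    change Module.finrank R B * P.inertiaDeg R ≤ _ at h1
    nlinarith

variable (F : Type*) [Field F] [Algebra B F] [IsFractionRing B F] [Algebra R F]
  [IsScalarTower R B F]

/-- The valuation of the only prime. Its valuation ring is `B`, and its residue field is that of `R`
because the inertia degree is one. -/
theorem exists_isTotRamVal [IsIntegralClosure B R F] {ϖ : R} (hϖ : Irreducible ϖ)
    (hram : ∀ P : Ideal B, P.IsPrime →
      P.LiesOver (IsLocalRing.maximalIdeal R) → P.ramificationIdx R = Module.finrank R B)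
    (w : IsDedekindDomain.HeightOneSpectrum B)
    (hw : w.asIdeal.LiesOver (IsLocalRing.maximalIdeal R)) :
    IsTotRamVal (w.valuation F) ϖ (Module.finrank R B) := by
  -- there is only one prime, so that its valuation ring is `B`
  have hpi : ∀ w' : IsDedekindDomain.HeightOneSpectrum B, w' = w := by
    intro w'
    refine IsDedekindDomain.HeightOneSpectrum.ext ?_
    refine (eq_and_inertiaDeg_eq_one hram w.isPrime hw w'.isPrime ?_).1
    refine ⟨?_⟩
    have h1 : w'.asIdeal.under R ≠ ⊥ := Ideal.IsIntegral.comap_ne_bot R w'.ne_bot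
    have := w'.isPrime
    exact (IsLocalRing.eq_maximalIdeal
      ((inferInstance : (w'.asIdeal.under R).IsPrime).isMaximal h1)).symm
  have hϖm : IsLocalRing.maximalIdeal R = Ideal.span {ϖ} := hϖ.maximalIdeal_eq
  have hone : w.asIdeal.inertiaDeg R = 1 :=
    (eq_and_inertiaDeg_eq_one hram w.isPrime hw w.isPrime hw).2
  have hmem : ∀ x, OrdGE (w.valuation F) 0 x ↔ ∃ b, algebraMap B F b = x := by
    intro x
    rw [OrdGE, neg_zero, exp_zero]
    constructor
    · intro h
      exact IsDedekindDomain.HeightOneSpectrum.mem_integers_of_valuation_le_one F x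
        fun w' => by rw [hpi w']; exact h
    · rintro ⟨b, rfl⟩
      exact w.valuation_le_one b
  refine ⟨?_, fun x => ?_, ?_, fun x hx => ?_⟩
  · rw [← hram _ w.isPrime hw]
    have := w.isPrime
    exact Ideal.ramificationIdx_pos _ R
  · rw [hmem, IsIntegralClosure.isIntegral_iff (A := B)]
  · have h0 : algebraMap R B ϖ ≠ 0 := by
      rw [Ne, FaithfulSMul.algebraMap_eq_zero_iff]
      exact hϖ.ne_zero
    have hmap : (IsLocalRing.maximalIdeal R).map (algebraMap R B) =
        Ideal.span {algebraMap R B ϖ} := by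
      rw [hϖm, Ideal.map_span, Set.image_singleton]
    have := w.isPrime
    have h1 := Ideal.IsDedekindDomain.ramificationIdx_eq_multiplicity (IsLocalRing.maximalIdeal R)
      w.asIdeal (by rw [hmap, Ne, Ideal.span_singleton_eq_bot]; exact h0)
    rw [hram _ w.isPrime hw, hmap] at h1
    rw [IsScalarTower.algebraMap_apply R B F, OrdEq, w.valuation_of_algebraMap,
      w.intValuation_eq_exp_neg_multiplicity h0, ← h1]
  · obtain ⟨b, rfl⟩ := (hmem x).1 hx
    obtain ⟨r, hr⟩ := exists_sub_algebraMap_mem w.isPrime hw w.ne_bot hone b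
    refine ⟨r, ?_⟩
    rw [IsScalarTower.algebraMap_apply R B F, ← map_sub, ordGE_one_iff_lt_one,
      w.valuation_lt_one_iff_mem]
    exact hr

end TotRam

end RamifiedTower

/-! ### Ramified towers from totally ramified cyclic extensions -/

namespace RamifiedTower

open WithZero Finset

namespace Tower

variable {L : Type*} [Field L] {v : Valuation L ℤᵐ⁰} {σ : L ≃+* L} {ℓ N : ℕ} {π : L}
  {lam lam' : ℕ → ℕ}

theorem congr (h : Tower v σ ℓ N π lam) (hl : ∀ j < N, lam' j = lam j) :
    Tower v σ ℓ N π lam' :=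
  { h with brk := fun j hj => by rw [hl j hj]; exact h.brk j hj }

/-- All generators of the subgroup generated by `σ ^ ℓ ^ j` move `π` equally far. -/
theorem ordEq_pow_mul_sub (h : Tower v σ ℓ N π lam) {j : ℕ} (hj : j < N) {k : ℕ} (hk : ¬ ℓ ∣ k) :
    OrdEq v (lam j + 1) ((σ ^ (ℓ ^ j * k)) π - π) := by
  set τ := σ ^ ℓ ^ j with hτ
  have hy := h.brk j hj
  have key : ∀ k : ℕ, OrdGE v (lam j + 2) ((τ ^ k) π - π - k * delta τ π) := by
    intro k
    induction k with
    | zero => simpa using ordGE_zero _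
    | succ k ih =>
      have h1 : OrdGE v (lam j + 2) (τ ((τ ^ k) π - π - k * delta τ π)) := h.ordGE_pow ih _
      have h2 := (ordGE_natCast v k).mul (h.delta_ge hy.ge (ℓ ^ j))
      rw [← hτ] at h2
      convert h1.add (h2.mono (m := lam j + 2) (by omega)) using 1
      rw [pow_succ_apply', map_sub, map_sub, map_mul, map_natCast, Nat.cast_succ]
      simp only [delta, map_sub]
      ring
  have h1 := (ordEq_natCast h.prime h.natCast_ge hk).mul hy
  rw [zero_add] at h1
  rw [pow_mul]
  exact h1.of_sub (by convert key k using 1; ring)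

end Tower

/-- The sum over `0 < i < ℓ ^ n` of a function which depends on the exponent of `ℓ` in `i`
only. -/
theorem sum_range_pow_of_prime {ℓ : ℕ} (hp : ℓ.Prime) (n : ℕ) : ∀ (f : ℕ → ℤ) (a : ℕ → ℤ),
    (∀ j < n, ∀ k, ¬ ℓ ∣ k → f (ℓ ^ j * k) = a j) → f 0 = 0 →
    ∑ i ∈ range (ℓ ^ n), f i = ∑ j ∈ range n, (ℓ - 1) * (ℓ ^ (n - (j + 1)) : ℕ) * a j := by
  induction n with
  | zero => intro f a _ h0; simpa using h0
  | succ n ih =>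
    intro f a hf h0
    -- split the sum into residue classes modulo `ℓ`: multiples of `ℓ` are left to the induction
    -- hypothesis
    have h1 : ∑ i ∈ range (ℓ ^ (n + 1)), f i =
        ∑ q ∈ range (ℓ ^ n), ∑ r ∈ range ℓ, f (ℓ * q + r) := by
      have : ∀ m, ∑ i ∈ range (m * ℓ), f i = ∑ q ∈ range m, ∑ r ∈ range ℓ, f (ℓ * q + r) := by
        intro m
        induction m with
        | zero => simp
        | succ m ihm => rw [Nat.succ_mul, sum_range_add, ihm, sum_range_succ, mul_comm m ℓ]
      rw [pow_succ, this]
    have h2 : ∀ q ∈ range (ℓ ^ n), ∑ r ∈ range ℓ, f (ℓ * q + r) = f (ℓ * q) + (ℓ - 1) * a 0 := by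
      intro q _
      obtain ⟨m, rfl⟩ : ∃ m, ℓ = m + 1 := ⟨ℓ - 1, by have := hp.pos; omega⟩
      rw [sum_range_succ', add_zero, add_comm]
      congr 1
      have h3 : ∀ r ∈ range m, f ((m + 1) * q + (r + 1)) = a 0 := by
        intro r hr
        have h4 := hf 0 (by omega) ((m + 1) * q + (r + 1)) (by
          rw [Nat.dvd_add_right (dvd_mul_right _ _)]
          exact Nat.not_dvd_of_pos_of_lt (by omega) (by have := mem_range.1 hr; omega))
        rwa [pow_zero, one_mul] at h4
      rw [sum_congr rfl h3, sum_const, card_range, nsmul_eq_mul]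
      push_cast; ring
    rw [h1, sum_congr rfl h2, sum_add_distrib, sum_const, card_range, nsmul_eq_mul,
      ih (fun q => f (ℓ * q)) (fun j => a (j + 1)) (fun j hj k hk => by
        rw [← hf (j + 1) (by omega) k hk, pow_succ, mul_comm _ ℓ, mul_assoc]) (by simpa using h0),
      sum_range_succ']
    congr 1
    · refine sum_congr rfl fun j _ => ?_
      rw [show n + 1 - (j + 1 + 1) = n - (j + 1) by omega]
    · rw [Nat.add_sub_cancel_right]
      ring

namespace Tower

variable {L : Type*} [Field L] {v : Valuation L ℤᵐ⁰} {σ : L ≃+* L} {ℓ N : ℕ} {π : L}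
  {lam : ℕ → ℕ}

/-- Hilbert's formula for the order of the different. -/
theorem ordEq_prod_sub (h : Tower v σ ℓ N π lam) :
    OrdEq v (∑ j ∈ range N, (ℓ - 1) * (ℓ ^ (N - (j + 1)) : ℕ) * ((lam j : ℤ) + 1))
      (∏ i ∈ (range (ℓ ^ N)).erase 0, (π - (σ ^ i) π)) := by
  have hex : ∀ i ∈ (range (ℓ ^ N)).erase 0, ∃ j < N, ∃ k, ¬ ℓ ∣ k ∧ i = ℓ ^ j * k := by
    intro i hi
    rw [mem_erase, mem_range] at hi
    obtain ⟨j, k, hk, rfl⟩ := Nat.exists_eq_pow_mul_and_not_dvd hi.1 ℓ h.prime.ne_one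
    refine ⟨j, ?_, k, hk, rfl⟩
    rw [← Nat.pow_lt_pow_iff_right h.prime.one_lt]
    refine lt_of_le_of_lt (Nat.le_mul_of_pos_right _ (Nat.pos_of_ne_zero ?_)) hi.2
    rintro rfl
    exact hk (dvd_zero _)
  let f : ℕ → ℤ := fun i => -log (v (π - (σ ^ i) π))
  have hf : ∀ j < N, ∀ k, ¬ ℓ ∣ k → OrdEq v (lam j + 1) (π - (σ ^ (ℓ ^ j * k)) π) :=
    fun j hj k hk => by simpa using (h.ordEq_pow_mul_sub hj hk).neg
  have hf' : ∀ j < N, ∀ k, ¬ ℓ ∣ k → f (ℓ ^ j * k) = (lam j : ℤ) + 1 := fun j hj k hk => by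
    have := hf j hj k hk
    rw [OrdEq] at this
    simp only [f]
    rw [this, log_exp, neg_neg]
  have hf0 : f 0 = 0 := by simp [f]
  rw [← sum_range_pow_of_prime h.prime N f (fun j => (lam j : ℤ) + 1) hf' hf0,
    ← sum_erase _ hf0]
  have hprod : ∀ s : Finset ℕ, (∀ i ∈ s, OrdEq v (f i) (π - (σ ^ i) π)) →
      OrdEq v (∑ i ∈ s, f i) (∏ i ∈ s, (π - (σ ^ i) π)) := by
    intro s
    induction s using Finset.induction_on with
    | empty => intro _; simpa using ordEq_one
    | insert a s ha ih =>
      intro hs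
      rw [sum_insert ha, prod_insert ha]
      exact (hs a (mem_insert_self a s)).mul (ih fun i hi => hs i (mem_insert_of_mem hi))
  refine hprod _ fun i hi => ?_
  obtain ⟨j, hj, k, hk, rfl⟩ := hex i hi
  rw [hf' j hj k hk]
  exact hf j hj k hk

end Tower

theorem toRingEquiv_pow_apply {R F : Type*} [CommRing R] [Field F] [Algebra R F] (σ : F ≃ₐ[R] F)
    (k : ℕ) (x : F) : (σ.toRingEquiv ^ k) x = (σ ^ k) x := by
  induction k with
  | zero => rfl
  | succ k ih => rw [pow_succ_apply', pow_succ', AlgEquiv.mul_apply, ← ih]; rfl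

namespace IsTotRamVal

variable {R : Type*} [CommRing R] {F : Type*} [Field F] [Algebra R F] {v : Valuation F ℤᵐ⁰} {ϖ : R}
  {ℓ N : ℕ}

/-- A cyclic automorphism of order `ℓ ^ N` of a totally ramified extension of degree `ℓ ^ N` makes
up a tower. Its breaks are finite since an automorphism which fixes the uniformizer is trivial. -/
theorem exists_tower [IsLocalRing R] (hϖ : ϖ ∈ IsLocalRing.maximalIdeal R)
    (h : IsTotRamVal v ϖ (ℓ ^ N)) (hfin : (integralClosure R F).toSubmodule.FG) (hp : ℓ.Prime)
    (hℓ : ϖ ∣ (ℓ : R)) {π : F} (hπ : OrdEq v 1 π) (σ : F ≃ₐ[R] F) (hσ : σ ^ ℓ ^ N = 1)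
    (hne : ∀ j < N, σ ^ ℓ ^ j ≠ 1) : ∃ lam, Tower v σ.toRingEquiv ℓ N π lam := by
  have hmap := h.map_algEquiv σ
  have hmapk : ∀ k x, v ((σ ^ k) x) = v x := fun k x => h.map_algEquiv (σ ^ k) x
  have hb : ∀ j, ∃ b : ℕ, j < N → OrdEq v (b + 1) (delta (σ.toRingEquiv ^ ℓ ^ j) π) := by
    intro j
    by_cases hj : j < N
    · have h0 : delta (σ.toRingEquiv ^ ℓ ^ j) π ≠ 0 := by
        rw [delta, toRingEquiv_pow_apply, sub_ne_zero]
        exact fun hc => hne j hj (AlgEquiv.ext (h.eq_one_of_apply_unif hϖ hfin hπ _ hc))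
      obtain ⟨m, hm⟩ := exists_ordEq v h0
      have h1 : OrdGE v 1 ((σ ^ ℓ ^ j) π) := by rw [OrdGE, hmapk]; exact hπ.ge
      have h2 : OrdGE v 1 (delta (σ.toRingEquiv ^ ℓ ^ j) π) := by
        rw [delta, toRingEquiv_pow_apply]
        exact h1.sub hπ.ge
      have h3 := hm.le_of_ge h2
      refine ⟨(m - 1).toNat, fun _ => ?_⟩
      rwa [Int.toNat_of_nonneg (by omega), sub_add_cancel]
    · exact ⟨0, fun hc => absurd hc hj⟩
  choose lam hlam using hb
  refine ⟨lam, hp, ?_, hmap, fun x => ?_, fun x hx => ?_, hπ, hlam⟩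
  · obtain ⟨c, hc⟩ := hℓ
    rw [← map_natCast (algebraMap R F), hc, map_mul]
    exact (h.unif.ge.mul (h.ordGE_zero_algebraMap c)).mono
      (by rw [add_zero]; exact_mod_cast h.pos)
  · rw [toRingEquiv_pow_apply, hσ]; rfl
  · obtain ⟨r, hr⟩ := h.resid x hx
    exact ⟨_, σ.commutes r, hr⟩

/-- The breaks of the lower layers do not change when the tower grows. -/
theorem lam_eq {F' : Type*} [Field F'] [Algebra R F'] {v' : Valuation F' ℤᵐ⁰} {j : ℕ} (hj : j < N)
    (h : IsTotRamVal v ϖ (ℓ ^ N)) (h' : IsTotRamVal v' ϖ (ℓ ^ (j + 1))) {σ : F ≃ₐ[R] F}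
    {σ' : F' ≃ₐ[R] F'} {π : F} {π' : F'} {lam lam' : ℕ → ℕ}
    (hT : Tower v σ.toRingEquiv ℓ N π lam) (hT' : Tower v' σ'.toRingEquiv ℓ (j + 1) π' lam')
    (ψ : F' →ₐ[R] F) (hψ : ∀ x, ψ (σ' x) = σ (ψ x)) : lam j = lam' j := by
  have hp := hT.prime
  have hpos : (0 : ℤ) < (ℓ : ℤ) ^ (j + 1) := pow_pos (by exact_mod_cast hp.pos) _
  have hsplit : (ℓ : ℤ) ^ N = ℓ ^ (j + 1) * ℓ ^ (N - (j + 1)) := by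
    rw [← pow_add]; congr 1; omega
  -- an element of the subfield has its order multiplied by the ramification index above it
  have hord : ∀ {x : F'} {k : ℤ}, OrdEq v' k x → OrdEq v ((ℓ ^ (N - (j + 1)) : ℕ) * k) (ψ x) := by
    intro x k hx
    obtain ⟨k', hk'⟩ := exists_ordEq v ((map_ne_zero_iff ψ ψ.toRingHom.injective).2 hx.ne_zero)
    have h1 := h'.ordEq_map h ψ hx hk'
    push_cast at h1 ⊢
    rw [hsplit, mul_left_comm] at h1
    rw [mul_comm, ← mul_left_cancel₀ hpos.ne' h1]
    exact hk'
  have hψk : ∀ k x, ψ ((σ'.toRingEquiv ^ k) x) = (σ.toRingEquiv ^ k) (ψ x) := by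
    intro k x
    induction k with
    | zero => rfl
    | succ k ih =>
      rw [pow_succ_apply', pow_succ_apply', ← ih]
      exact hψ _
  have h1 := hord hT'.unif
  rw [mul_one] at h1
  have h2 := hT.delta_layer_eq hj (by rw [← hψk, hT'.pow_eq]) h1
  have h3 := hord (hT'.brk j (by omega))
  rw [delta, map_sub, hψk] at h3
  have h4 := h2.unique h3
  have h5 : ((ℓ ^ (N - (j + 1)) : ℕ) : ℤ) ≠ 0 := by
    exact_mod_cast (pow_pos hp.pos _).ne'
  have := mul_left_cancel₀ h5 h4
  omega

end IsTotRamVal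

end RamifiedTower

/-! ### The different of a totally ramified cyclic extension -/

namespace RamifiedTower

open WithZero Finset Polynomial

section Different

variable {R : Type*} [CommRing R] [IsDomain R] [IsDiscreteValuationRing R]
  {K F B : Type*} [Field K] [Algebra R K] [IsFractionRing R K] [Field F] [Algebra K F] [Algebra R F]
  [IsScalarTower R K F] [FiniteDimensional K F]

/-- The minimal polynomial of a uniformizer, as a product over its conjugates. -/
theorem minpoly_map_eq_prod {v : Valuation F ℤᵐ⁰} {ℓ N : ℕ} (σ : F ≃ₐ[K] F) {s : F ≃+* F}
    (hs : ∀ x, s x = σ x) {π : F} {lam : ℕ → ℕ} (h : Tower v s ℓ N π lam)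
    (hdeg : Module.finrank K F ≤ ℓ ^ N) :
    (minpoly K π).map (algebraMap K F) = ∏ i ∈ range (ℓ ^ N), (X - C ((s ^ i) π)) := by
  have hpow : ∀ i x, (s ^ i) x = (σ ^ i) x := fun i x => by
    induction i with
    | zero => rfl
    | succ i ih => rw [pow_succ_apply', ih, hs, pow_succ', AlgEquiv.mul_apply]
  -- the breaks are finite, so that the conjugates are distinct; hence the product divides the
  -- minimal polynomial, and has at least its degree
  have hne : ∀ i ∈ (range (ℓ ^ N)).erase 0, (s ^ i) π ≠ π := by
    intro i hi hc
    exact prod_ne_zero_iff.1 h.ordEq_prod_sub.ne_zero i hi (by rw [hc, sub_self])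
  have hlt : ∀ i j, i < j → j < ℓ ^ N → (s ^ i) π ≠ (s ^ j) π := by
    intro i j hij hj hc
    refine hne (j - i) (mem_erase.2 ⟨by omega, mem_range.2 (by omega)⟩) ?_
    refine (s ^ i).injective ?_
    rw [← RingAut.mul_apply, ← pow_add, Nat.add_sub_cancel' hij.le, hc]
  have hmon := (minpoly.monic (Algebra.IsIntegral.isIntegral (R := K) π)).map (algebraMap K F)
  refine (eq_of_monic_of_dvd_of_natDegree_le (monic_prod_of_monic _ _ fun i _ => monic_X_sub_C _)
    hmon ?_ ?_)
  · refine Finset.prod_dvd_of_coprime (fun i hi j hj hij => ?_) fun i _ => ?_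
    · rw [Function.onFun]
      refine isCoprime_X_sub_C_of_isUnit_sub (sub_ne_zero.2 ?_).isUnit
      rcases lt_or_gt_of_ne hij with h1 | h1
      · exact hlt i j h1 (mem_range.1 hj)
      · exact (hlt j i h1 (mem_range.1 hi)).symm
    · rw [dvd_iff_isRoot, IsRoot, eval_map_algebraMap, hpow, aeval_algHom_apply (σ ^ i),
        minpoly.aeval, map_zero]
  · rw [natDegree_map, natDegree_prod_of_monic _ _ fun i _ => monic_X_sub_C _]
    simp only [natDegree_X_sub_C, sum_const, card_range, smul_eq_mul, mul_one]
    exact (minpoly.natDegree_le π).trans hdeg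

theorem eval_derivative_prod_X_sub_C (s : Finset ℕ) (f : ℕ → F) {a : ℕ} (ha : a ∈ s) :
    (derivative (∏ i ∈ s, (X - C (f i)))).eval (f a) = ∏ i ∈ s.erase a, (f a - f i) := by
  rw [← mul_prod_erase s _ ha, derivative_mul, eval_add, eval_mul, eval_mul, eval_sub, eval_X,
    eval_C, sub_self, zero_mul, add_zero, derivative_X_sub_C, eval_one, one_mul, eval_prod]
  simp

variable [CommRing B] [IsDedekindDomain B] [Algebra R B] [Module.IsTorsionFree R B] [Algebra B F]
  [IsFractionRing B F] [IsScalarTower R B F] [IsIntegralClosure B R F]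
  [Algebra.IsSeparable K F]

/-- The different is generated by the derivative of the minimal polynomial of a uniformizer. -/
theorem multiplicity_differentIdeal (w : IsDedekindDomain.HeightOneSpectrum B) {ϖ : R} {n ℓ N : ℕ}
    (hϖ : ϖ ∈ IsLocalRing.maximalIdeal R) (hw : IsTotRamVal (w.valuation F) ϖ n)
    (hfin : (integralClosure R F).toSubmodule.FG) (σ : F ≃ₐ[K] F) {s : F ≃+* F}
    (hs : ∀ x, s x = σ x) {π : F} {lam : ℕ → ℕ} (h : Tower (w.valuation F) s ℓ N π lam)
    (hdeg : Module.finrank K F ≤ ℓ ^ N) :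
    (multiplicity w.asIdeal (differentIdeal R B) : ℤ) =
      ∑ j ∈ range N, (ℓ - 1) * (ℓ ^ (N - (j + 1)) : ℕ) * ((lam j : ℤ) + 1) := by
  have hπ := h.unif
  have hmem : ∀ x, OrdGE (w.valuation F) 0 x → x ∈ Algebra.adjoin R {π} := fun x hx =>
    hw.mem_adjoin hϖ hfin hπ hx
  obtain ⟨β, rfl⟩ := (IsIntegralClosure.isIntegral_iff (A := B) (R := R)).1
    ((hw.integral_iff π).1 (hπ.ge.mono (by norm_num)))
  have htop : Algebra.adjoin R {β} = ⊤ := by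
    refine eq_top_iff.2 fun b _ => ?_
    have h1 := hmem (algebraMap B F b) ((hw.integral_iff _).2
      (IsIntegralClosure.isIntegral_iff.2 ⟨b, rfl⟩))
    have h2 : (Algebra.adjoin R {β}).map (IsScalarTower.toAlgHom R B F) =
        Algebra.adjoin R {algebraMap B F β} := by
      rw [AlgHom.map_adjoin, Set.image_singleton]; rfl
    rw [← h2] at h1
    obtain ⟨b', hb', hbb⟩ := h1
    rwa [← IsFractionRing.injective B F hbb]
  have hKtop : Algebra.adjoin K {algebraMap B F β} = ⊤ := by
    refine eq_top_iff.2 fun x _ => ?_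
    have hint : ∀ y, OrdGE (w.valuation F) 0 y → y ∈ Algebra.adjoin K {algebraMap B F β} := by
      intro y hy
      refine Algebra.adjoin_induction (R := R) (s := {algebraMap B F β})
        (p := fun z _ => z ∈ Algebra.adjoin K {algebraMap B F β})
        (fun z hz => Algebra.subset_adjoin hz) (fun r => ?_) (fun _ _ _ _ => add_mem)
        (fun _ _ _ _ => mul_mem) (hmem y hy)
      rw [IsScalarTower.algebraMap_apply R K F]
      exact algebraMap_mem _ _
    rcases eq_or_ne x 0 with rfl | hx0
    · exact zero_mem _
    obtain ⟨k, hk⟩ := exists_ordEq (w.valuation F) hx0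
    have h1 := (hk.mul (hw.unif.pow k.natAbs)).ge.mono (m := 0) (by
      have hn : (1 : ℤ) ≤ n := by exact_mod_cast hw.pos
      have hk' : (0 : ℤ) ≤ k.natAbs := by positivity
      have : (k.natAbs : ℤ) * 1 ≤ k.natAbs * n := mul_le_mul_of_nonneg_left hn hk'
      omega)
    have h2 := hint _ h1
    have h3 : x = (algebraMap R K ϖ ^ k.natAbs)⁻¹ • (x * algebraMap R F ϖ ^ k.natAbs) := by
      rw [Algebra.smul_def, map_inv₀, map_pow, ← IsScalarTower.algebraMap_apply R K F, mul_comm x,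
        inv_mul_cancel_left₀ (pow_ne_zero _ hw.unif.ne_zero)]
    rw [h3]
    exact Subalgebra.smul_mem _ h2 _
  have hdiff := conductor_mul_differentIdeal R K F β hKtop
  rw [conductor_eq_top_of_adjoin_eq_top htop, Ideal.top_mul] at hdiff
  set δ := aeval β (derivative (minpoly R β)) with hδ
  have hint : IsIntegral R β := IsIntegralClosure.isIntegral R F β
  have hδF : algebraMap B F δ =
      ∏ i ∈ (range (ℓ ^ N)).erase 0, (algebraMap B F β - (s ^ i) (algebraMap B F β)) := by
    have h0 : 0 ∈ range (ℓ ^ N) := mem_range.2 (pow_pos h.prime.pos _)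
    have h1 := eval_derivative_prod_X_sub_C (range (ℓ ^ N))
      (fun i => (s ^ i) (algebraMap B F β)) h0
    rw [← minpoly_map_eq_prod σ hs h hdeg, minpoly.isIntegrallyClosed_eq_field_fractions K F hint,
      Polynomial.map_map, ← IsScalarTower.algebraMap_eq, derivative_map] at h1
    simp only [pow_zero, RingAut.one_apply] at h1
    rw [← h1, hδ, eval_map_algebraMap, aeval_algebraMap_apply]
  have hord := h.ordEq_prod_sub
  rw [← hδF] at hord
  have hδ0 : δ ≠ 0 := by
    intro hc
    rw [hc, map_zero] at hord
    exact hord.ne_zero rfl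
  rw [OrdEq, w.valuation_of_algebraMap, w.intValuation_eq_exp_neg_multiplicity hδ0, exp_inj,
    neg_inj, ← hdiff] at hord
  exact hord

end Different

end RamifiedTower

/-! ### The layers of a `ℤ_ℓ`-extension -/

namespace RamifiedTower

section Layers

variable {ℓ : ℕ} [Fact ℓ.Prime] {K L : Type*} [Field K] [Field L] [Algebra K L]
  (φ : Gal(L/K) ≃ₜ* Multiplicative ℤ_[ℓ])

theorem mem_layerSubgroup_iff {n : ℕ} {a : Gal(L/K)} :
    a ∈ layerSubgroup φ n ↔ (φ a).toAdd ∈ Ideal.span {(ℓ : ℤ_[ℓ]) ^ n} := Iff.rfl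

theorem gal_mul_comm (φ : Gal(L/K) ≃ₜ* Multiplicative ℤ_[ℓ]) (a b : Gal(L/K)) : a * b = b * a :=
  φ.injective (by rw [map_mul, map_mul, mul_comm])

theorem apply_of_mem_layer {n : ℕ} {x : L} (hx : x ∈ layer φ n) {a : Gal(L/K)}
    (ha : a ∈ layerSubgroup φ n) : a x = x :=
  hx ⟨a, ha⟩

/-- The element of the Galois group which corresponds to `1`, a topological generator. -/
noncomputable def topGen : Gal(L/K) := φ.symm (Multiplicative.ofAdd 1)

theorem apply_topGen_pow (k : ℕ) : (φ (topGen φ ^ k)).toAdd = k := by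
  rw [map_pow, topGen]
  simp

theorem topGen_pow_mem (n : ℕ) : topGen φ ^ ℓ ^ n ∈ layerSubgroup φ n := by
  rw [mem_layerSubgroup_iff, apply_topGen_pow]
  push_cast
  exact Ideal.mem_span_singleton_self _

theorem exists_topGen_pow (n : ℕ) (a : Gal(L/K)) :
    ∃ m : ℕ, ∃ b ∈ layerSubgroup φ n, a = topGen φ ^ m * b := by
  refine ⟨(φ a).toAdd.appr n, (topGen φ ^ (φ a).toAdd.appr n)⁻¹ * a, ?_, by group⟩
  rw [mem_layerSubgroup_iff, map_mul, map_inv, toAdd_mul, toAdd_inv, apply_topGen_pow,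
    neg_add_eq_sub]
  exact PadicInt.appr_spec n _

theorem topGen_pow_mem_iff {n k : ℕ} : topGen φ ^ k ∈ layerSubgroup φ n ↔ ℓ ^ n ∣ k := by
  rw [mem_layerSubgroup_iff, apply_topGen_pow, ← PadicInt.norm_le_pow_iff_mem_span_pow]
  have := PadicInt.norm_int_le_pow_iff_dvd (p := ℓ) (k := (k : ℤ)) (n := n)
  rw [Int.cast_natCast] at this
  rw [this]
  exact_mod_cast Iff.rfl

theorem layer_mono {m n : ℕ} (h : m ≤ n) : layer φ m ≤ layer φ n := by
  rintro x hx ⟨b, hb⟩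
  refine apply_of_mem_layer φ hx ?_
  rw [mem_layerSubgroup_iff] at hb ⊢
  exact Ideal.span_singleton_le_span_singleton.2 (pow_dvd_pow _ h) hb

variable [IsGalois K L]

theorem normal_layer (n : ℕ) : Normal K (layer φ n) := by
  rw [IntermediateField.normal_iff_forall_map_le']
  rintro a _ ⟨x, hx, rfl⟩ ⟨b, hb⟩
  change b (a x) = a x
  rw [← AlgEquiv.mul_apply, gal_mul_comm φ, AlgEquiv.mul_apply, apply_of_mem_layer φ hx hb]

theorem isGalois_layer (n : ℕ) : IsGalois K (layer φ n) :=
  { to_normal := normal_layer φ n }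

/-- The restriction of the topological generator to a layer. -/
noncomputable def layerGen (n : ℕ) : layer φ n ≃ₐ[K] layer φ n :=
  haveI := normal_layer φ n
  AlgEquiv.restrictNormalHom (layer φ n) (topGen φ)

theorem coe_layerGen_pow (n k : ℕ) (x : layer φ n) :
    ((layerGen φ n ^ k) x : L) = (topGen φ ^ k) (x : L) := by
  have := normal_layer φ n
  rw [layerGen, ← map_pow, AlgEquiv.restrictNormalHom_apply]

theorem coe_layerGen (n : ℕ) (x : layer φ n) : (layerGen φ n x : L) = topGen φ (x : L) := by
  simpa using coe_layerGen_pow φ n 1 x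

theorem layerGen_pow_eq_one (n : ℕ) : layerGen φ n ^ ℓ ^ n = 1 := by
  refine AlgEquiv.ext fun x => Subtype.ext ?_
  rw [coe_layerGen_pow, AlgEquiv.one_apply]
  exact apply_of_mem_layer φ x.2 (topGen_pow_mem φ n)

theorem dvd_of_layerGen_pow {n k : ℕ} (h : layerGen φ n ^ k = 1) : ℓ ^ n ∣ k := by
  have hcl : IsClosed (layerSubgroup φ n : Set Gal(L/K)) :=
    Subgroup.isClosed_of_isOpen _ (isOpen_layerSubgroup φ n)
  have h1 := InfiniteGalois.fixingSubgroup_fixedField (K := L) (k := K) ⟨layerSubgroup φ n, hcl⟩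
  rw [← topGen_pow_mem_iff φ]
  change topGen φ ^ k ∈ (⟨layerSubgroup φ n, hcl⟩ : ClosedSubgroup Gal(L/K)).1
  rw [← h1, IntermediateField.mem_fixingSubgroup_iff]
  intro x hx
  have h2 := coe_layerGen_pow φ n k ⟨x, hx⟩
  rw [h, AlgEquiv.one_apply] at h2
  exact h2.symm

theorem orderOf_layerGen (n : ℕ) : orderOf (layerGen φ n) = ℓ ^ n :=
  Nat.dvd_antisymm (orderOf_dvd_of_pow_eq_one (layerGen_pow_eq_one φ n))
    (dvd_of_layerGen_pow φ (pow_orderOf_eq_one _))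

theorem finrank_layer (n : ℕ) : Module.finrank K (layer φ n) = ℓ ^ n := by
  have := isGalois_layer φ n
  have := normal_layer φ n
  rw [← IsGalois.card_aut_eq_finrank, ← orderOf_layerGen φ n]
  refine (orderOf_eq_card_of_forall_mem_zpowers fun τ => ?_).symm
  obtain ⟨a, rfl⟩ := AlgEquiv.restrictNormalHom_surjective (F := K) (K₁ := layer φ n) L τ
  obtain ⟨m, b, hb, rfl⟩ := exists_topGen_pow φ n a
  refine ⟨m, ?_⟩
  have h1 : AlgEquiv.restrictNormalHom (layer φ n) b = 1 := by
    refine AlgEquiv.ext fun x => Subtype.ext ?_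
    rw [AlgEquiv.restrictNormalHom_apply]
    exact apply_of_mem_layer φ x.2 hb
  simp only [zpow_natCast]
  rw [map_mul, h1, mul_one, map_pow, layerGen]

end Layers

end RamifiedTower

/-! ### The ramification breaks of a `ℤ_ℓ`-extension -/

namespace RamifiedTower

open WithZero Finset

section Breaks

/-- The residue field of a totally ramified extension is perfect, being that of `R`. -/
theorem IsTotRamVal.exists_pow_sub {R F : Type*} [CommRing R] [IsLocalRing R] [Field F]
    [Algebra R F] {v : Valuation F ℤᵐ⁰} {ϖ : R} {n ℓ : ℕ} (h : IsTotRamVal v ϖ n)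
    (hϖ : IsLocalRing.maximalIdeal R = Ideal.span {ϖ}) (hp : ℓ.Prime)
    [CharP (IsLocalRing.ResidueField R) ℓ] [PerfectField (IsLocalRing.ResidueField R)] (a : F)
    (ha : OrdGE v 0 a) : ∃ b, OrdGE v 1 (b ^ ℓ - a) := by
  have : Fact ℓ.Prime := ⟨hp⟩
  have : PerfectRing (IsLocalRing.ResidueField R) ℓ := PerfectField.toPerfectRing ℓ
  obtain ⟨r, hr⟩ := h.resid a ha
  obtain ⟨y, hy⟩ := (PerfectRing.bijective_frobenius (R := IsLocalRing.ResidueField R)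
    (p := ℓ)).2 (IsLocalRing.residue R r)
  obtain ⟨s, rfl⟩ := IsLocalRing.residue_surjective y
  have h1 : s ^ ℓ - r ∈ IsLocalRing.maximalIdeal R := by
    rw [← IsLocalRing.residue_eq_zero_iff, map_sub, map_pow, sub_eq_zero]
    exact hy
  rw [hϖ, Ideal.mem_span_singleton] at h1
  obtain ⟨c, hc⟩ := h1
  refine ⟨algebraMap R F s, ?_⟩
  have h2 : OrdGE v 1 (algebraMap R F s ^ ℓ - algebraMap R F r) := by
    rw [← map_pow, ← map_sub, hc, map_mul]
    exact (h.unif.ge.mul (h.ordGE_zero_algebraMap c)).mono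
      (by rw [add_zero]; exact_mod_cast h.pos)
  simpa using h2.sub hr

theorem IsTotRamVal.ordEq_algebraMap_unit_mul_pow {R F : Type*} [CommRing R] [Field F]
    [Algebra R F] {v : Valuation F ℤᵐ⁰} {ϖ : R} {n : ℕ} (h : IsTotRamVal v ϖ n) (u : Rˣ) (k : ℕ) :
    OrdEq v (k * n) (algebraMap R F (u * ϖ ^ k)) := by
  have hu : OrdEq v 0 (algebraMap R F u) := by
    refine (h.ordGE_zero_algebraMap _).lt_or_eq.resolve_left fun hc => ?_
    have h2 := hc.mul (h.ordGE_zero_algebraMap ((u⁻¹ : Rˣ) : R))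
    rw [← map_mul, Units.mul_inv, map_one] at h2
    have := ordEq_one.le_of_ge h2
    omega
  have h1 := hu.mul (h.unif.pow k)
  rw [zero_add] at h1
  rwa [map_mul, map_pow]

/-- The absolute ramification index is positive, as the residue characteristic is not a unit. -/
theorem exists_eq_unit_mul_pow {ℓ : ℕ} {R : Type*} [CommRing R] [IsDomain R]
    [IsDiscreteValuationRing R] [CharP (IsLocalRing.ResidueField R) ℓ] {e : ℕ}
    (he : IsDiscreteValuationRing.addVal R (ℓ : R) = (e : ℕ∞)) {ϖ : R} (hϖ : Irreducible ϖ) :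
    0 < e ∧ ϖ ∣ (ℓ : R) ∧ ∃ u : Rˣ, (ℓ : R) = u * ϖ ^ e := by
  have hℓm : (ℓ : R) ∈ IsLocalRing.maximalIdeal R := by
    rw [← IsLocalRing.residue_eq_zero_iff, map_natCast, CharP.cast_eq_zero]
  have hℓ : ϖ ∣ (ℓ : R) := by
    rwa [hϖ.maximalIdeal_eq, Ideal.mem_span_singleton] at hℓm
  have hℓ0 : (ℓ : R) ≠ 0 := by
    intro hc
    rw [hc, IsDiscreteValuationRing.addVal_zero] at he
    exact ENat.top_ne_natCast e he
  obtain ⟨k, u, hu⟩ := IsDiscreteValuationRing.eq_unit_mul_pow_irreducible hℓ0 hϖ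
  have hke : k = e := by
    have h1 := IsDiscreteValuationRing.addVal_def _ u hϖ k hu
    rw [he] at h1
    exact_mod_cast h1.symm
  subst hke
  refine ⟨Nat.pos_of_ne_zero fun hc => ?_, hℓ, u, hu⟩
  rw [hc, pow_zero, mul_one] at hu
  exact (IsLocalRing.mem_maximalIdeal _).1 hℓm (hu ▸ u.isUnit)

variable {ℓ : ℕ} [Fact ℓ.Prime] {R : Type*} [CommRing R] {K : Type*} [Field K] [Algebra R K]
  {L : Type*} [Field L] [Algebra K L] [Algebra R L] [IsScalarTower R K L] [IsGalois K L]
  (φ : Gal(L/K) ≃ₜ* Multiplicative ℤ_[ℓ])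

/-- The layers are nested, and so their generators are compatible. -/
theorem inclusion_layerGen {m n : ℕ} (h : m ≤ n) (x : layer φ m) :
    IntermediateField.inclusion (layer_mono φ h) (layerGen φ m x) =
      layerGen φ n (IntermediateField.inclusion (layer_mono φ h) x) := by
  refine Subtype.ext ?_
  rw [coe_layerGen, IntermediateField.coe_inclusion, coe_layerGen, IntermediateField.coe_inclusion]

/-- The `j`-th break is already visible in the layer of degree `ℓ ^ (j + 1)`. -/
theorem layer_lam_eq {j n : ℕ} (hj : j < n) {v : Valuation (layer φ n) ℤᵐ⁰}
    {v' : Valuation (layer φ (j + 1)) ℤᵐ⁰} {π : layer φ n} {π' : layer φ (j + 1)}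
    {lam lam' : ℕ → ℕ} {ϖ : R}
    (hv : IsTotRamVal v ϖ (ℓ ^ n)) (hv' : IsTotRamVal v' ϖ (ℓ ^ (j + 1)))
    (hT : Tower v ((layerGen φ n).restrictScalars R).toRingEquiv ℓ n π lam)
    (hT' : Tower v' ((layerGen φ (j + 1)).restrictScalars R).toRingEquiv ℓ (j + 1) π' lam') :
    lam' j = lam j := by
  refine (IsTotRamVal.lam_eq hj hv hv' hT hT'
    ((IntermediateField.inclusion (layer_mono φ hj)).restrictScalars R) fun x => ?_).symm
  exact inclusion_layerGen φ hj x

variable [IsDomain R] [IsDiscreteValuationRing R] [IsFractionRing R K]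

/-- Each layer is a ramified tower, whose breaks determine the exponent of the different. -/
theorem exists_layer_tower (hL : IsTotallyRamified R K L) {ϖ : R} (hϖ : Irreducible ϖ)
    (hℓ : ϖ ∣ (ℓ : R)) (n : ℕ) :
    ∃ (v : Valuation (layer φ n) ℤᵐ⁰) (π : layer φ n) (lam : ℕ → ℕ),
      IsTotRamVal v ϖ (ℓ ^ n) ∧
      Tower v ((layerGen φ n).restrictScalars R).toRingEquiv ℓ n π lam ∧
      ∀ P : Ideal (integralClosure R (layer φ n)), P.IsPrime →
        P.LiesOver (IsLocalRing.maximalIdeal R) → P.ramificationIdx R = ℓ ^ n ∧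
        (multiplicity P (differentIdeal R (integralClosure R (layer φ n))) : ℤ) =
          ∑ j ∈ range n, (ℓ - 1) * (ℓ ^ (n - (j + 1)) : ℕ) * ((lam j : ℤ) + 1) := by
  have hp : ℓ.Prime := Fact.out
  have := isGalois_layer φ n
  have := isDedekindDomain_layer R φ n
  have := isTorsionFree_layer R φ n
  have : IsFractionRing (integralClosure R (layer φ n)) (layer φ n) :=
    integralClosure.isFractionRing_of_finite_extension K (layer φ n)
  have hfinite : Module.Finite R (integralClosure R (layer φ n)) :=
    IsIntegralClosure.finite R K (layer φ n) (integralClosure R (layer φ n))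
  have hfin : (integralClosure R (layer φ n)).toSubmodule.FG := Module.Finite.iff_fg.1 hfinite
  have hϖm : IsLocalRing.maximalIdeal R = Ideal.span {ϖ} := hϖ.maximalIdeal_eq
  have hϖ' : ϖ ∈ IsLocalRing.maximalIdeal R := by
    rw [hϖm]; exact Ideal.mem_span_singleton_self ϖ
  have hrank : Module.finrank R (integralClosure R (layer φ n)) = ℓ ^ n := by
    rw [← finrank_layer φ n]
    exact (IsFractionRing.finrank_eq R K (integralClosure R (layer φ n)) (layer φ n)).symm
  have hidx : ∀ P : Ideal (integralClosure R (layer φ n)), P.IsPrime →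
      P.LiesOver (IsLocalRing.maximalIdeal R) → P.ramificationIdx R = ℓ ^ n := fun P hP hPl => by
    rw [hL (layer φ n) inferInstance P hP hPl, finrank_layer]
  have hram : ∀ P : Ideal (integralClosure R (layer φ n)), P.IsPrime →
      P.LiesOver (IsLocalRing.maximalIdeal R) →
      P.ramificationIdx R = Module.finrank R (integralClosure R (layer φ n)) :=
    fun P hP hPl => by rw [hidx P hP hPl, hrank]
  -- the uniformizer and the breaks are those of an arbitrary prime over `R`; it is the only one
  obtain ⟨⟨P₀, hP₀, hPl₀⟩⟩ := (IsLocalRing.maximalIdeal R).nonempty_primesOver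
    (S := integralClosure R (layer φ n))
  have hne : P₀ ≠ ⊥ := by
    rintro rfl
    refine IsDiscreteValuationRing.not_a_field R ?_
    rw [hPl₀.over]
    exact Ideal.comap_bot_of_injective _ (FaithfulSMul.algebraMap_injective R _)
  let w : IsDedekindDomain.HeightOneSpectrum (integralClosure R (layer φ n)) := ⟨P₀, hP₀, hne⟩
  have hv := exists_isTotRamVal (layer φ n) hϖ hram w hPl₀
  rw [hrank] at hv
  obtain ⟨π, hπ⟩ := w.valuation_exists_uniformizer (layer φ n)
  have hpow : ∀ k, ((layerGen φ n).restrictScalars R) ^ k =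
      (layerGen φ n ^ k).restrictScalars R := by
    intro k
    induction k with
    | zero => rfl
    | succ k ih => rw [pow_succ, pow_succ, ih]; rfl
  obtain ⟨lam, hT⟩ := hv.exists_tower hϖ' hfin hp hℓ hπ ((layerGen φ n).restrictScalars R)
    (by rw [hpow, layerGen_pow_eq_one]; rfl) (fun j hj hc => by
      rw [hpow] at hc
      have h1 : layerGen φ n ^ ℓ ^ j = 1 := AlgEquiv.ext fun x => AlgEquiv.congr_fun hc x
      have h2 := (Nat.pow_dvd_pow_iff_le_right hp.one_lt).1 (dvd_of_layerGen_pow φ h1)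
      omega)
  refine ⟨_, π, lam, hv, hT, fun P hP hPl => ⟨hidx P hP hPl, ?_⟩⟩
  rw [(eq_and_inertiaDeg_eq_one hram hP₀ hPl₀ hP hPl).1]
  exact multiplicity_differentIdeal (K := K) w hϖ' hv hfin (layerGen φ n) (fun _ => rfl) hT
    (finrank_layer φ n).le

/-- The ramification breaks `l` of a totally ramified `ℤ_ℓ`-extension. -/
theorem exists_breaks [CharP (IsLocalRing.ResidueField R) ℓ]
    [PerfectField (IsLocalRing.ResidueField R)] {e : ℕ}
    (he : IsDiscreteValuationRing.addVal R (ℓ : R) = (e : ℕ∞)) (hL : IsTotallyRamified R K L) :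
    0 < e ∧ ∃ l : ℕ → ℕ,
      (∀ n, ∃ (v : Valuation (layer φ n) ℤᵐ⁰) (σ : layer φ n ≃+* layer φ n) (π : layer φ n),
        Tower v σ ℓ n π l ∧ (∀ a, OrdGE v 0 a → ∃ b, OrdGE v 1 (b ^ ℓ - a)) ∧
        OrdEq v (e * ℓ ^ n) (ℓ : layer φ n)) ∧
      ∀ n, ∀ P : Ideal (integralClosure R (layer φ n)), P.IsPrime →
        P.LiesOver (IsLocalRing.maximalIdeal R) → P.ramificationIdx R = ℓ ^ n ∧
        (multiplicity P (differentIdeal R (integralClosure R (layer φ n))) : ℤ) =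
          ∑ j ∈ range n, (ℓ - 1) * (ℓ ^ (n - (j + 1)) : ℕ) * ((l j : ℤ) + 1) := by
  obtain ⟨ϖ, hϖ⟩ := IsDiscreteValuationRing.exists_irreducible R
  obtain ⟨he0, hℓ, u, hu⟩ := exists_eq_unit_mul_pow he hϖ
  choose v π lam hv hT hD using exists_layer_tower φ hL hϖ hℓ
  -- the sequence of all breaks is read off from the smallest layers in which they occur
  have hlam : ∀ n, ∀ j < n, lam (j + 1) j = lam n j := fun n j hj =>
    layer_lam_eq φ hj (hv n) (hv (j + 1)) (hT n) (hT (j + 1))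
  refine ⟨he0, fun j => lam (j + 1) j, fun n => ⟨v n, _, π n, (hT n).congr (hlam n),
    (hv n).exists_pow_sub hϖ.maximalIdeal_eq Fact.out, ?_⟩,
    fun n P hP hPl => ⟨(hD n P hP hPl).1, ?_⟩⟩
  · have h1 := (hv n).ordEq_algebraMap_unit_mul_pow u e
    rw [← hu, map_natCast] at h1
    exact_mod_cast h1
  · rw [(hD n P hP hPl).2]
    exact sum_congr rfl fun j hj => by simp only [hlam n j (mem_range.1 hj)]

end Breaks

end RamifiedTower

/-! ### Valuation of the different -/

namespace RamifiedTower

open Finset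

section Numerics

variable (ℓ : ℕ) (l : ℕ → ℕ)

/-- The `n`-th upper ramification break of a `ℤ_ℓ`-extension with lower ramification breaks `l`. -/
noncomputable def upperNumber (n : ℕ) : ℝ :=
  (l n : ℝ) / (ℓ : ℝ) ^ n + ∑ j ∈ range n, ((ℓ : ℝ) - 1) * l j / (ℓ : ℝ) ^ (j + 1)

/-- The valuation of the different of the `n`-th layer, in terms of the lower ramification breaks
`l`. -/
noncomputable def differentValue (n : ℕ) : ℝ :=
  ∑ j ∈ range n, ((ℓ : ℝ) - 1) * ((l j : ℝ) + 1) / (ℓ : ℝ) ^ (j + 1)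

variable {ℓ l}

theorem upperBreak_eq (hℓ : 0 < ℓ) {N n : ℕ} (hn : n < N) :
    (upperBreak ℓ N l n : ℝ) = (ℓ : ℝ) ^ N * upperNumber ℓ l n := by
  have h0 : (ℓ : ℝ) ≠ 0 := by exact_mod_cast hℓ.ne'
  have hpow : ∀ j < N, ((ℓ : ℝ) ^ N) = (ℓ : ℝ) ^ (N - (j + 1)) * (ℓ : ℝ) ^ (j + 1) := fun j hj => by
    rw [← pow_add]; congr 1; omega
  rw [upperBreak, normShift, upperNumber, mul_add, mul_sum]
  push_cast
  congr 1
  · rw [hpow n hn, pow_succ]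
    field_simp
  · refine sum_congr rfl fun j hj => ?_
    rw [hpow j ((mem_range.1 hj).trans hn)]
    field_simp

theorem differentValue_eq (hℓ : 0 < ℓ) (n : ℕ) :
    differentValue ℓ l n = upperNumber ℓ l n + 1 - ((l n : ℝ) + 1) / (ℓ : ℝ) ^ n := by
  have h0 : (ℓ : ℝ) ≠ 0 := by exact_mod_cast hℓ.ne'
  have h1 : ∑ j ∈ range n, ((ℓ : ℝ) - 1) / (ℓ : ℝ) ^ (j + 1) = 1 - 1 / (ℓ : ℝ) ^ n := by
    induction n with
    | zero => simp
    | succ n ih =>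
      rw [sum_range_succ, ih, pow_succ]
      field_simp
      ring
  have h2 : differentValue ℓ l n = ∑ j ∈ range n, ((ℓ : ℝ) - 1) * l j / (ℓ : ℝ) ^ (j + 1) +
      ∑ j ∈ range n, ((ℓ : ℝ) - 1) / (ℓ : ℝ) ^ (j + 1) := by
    rw [differentValue, ← sum_add_distrib]
    exact sum_congr rfl fun j _ => by ring
  rw [h2, h1, upperNumber]
  ring

/-- The numerical consequences of the growth of the upper breaks. They are at least multiplied by
`ℓ` at each step until `ℓ - 1` times the upper break exceeds `e`, and grow by `e` from there on. -/
theorem exists_constants {e : ℕ} (hℓ : 2 ≤ ℓ) (he : 0 < e) (hl : ∀ n, 1 ≤ l n)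
    (hle : ∀ n, ((ℓ : ℝ) - 1) * l n ≤ e * (ℓ : ℝ) ^ (n + 1))
    (hmin : ∀ n, min (upperNumber ℓ l n + e) (ℓ * upperNumber ℓ l n) ≤ upperNumber ℓ l (n + 1))
    (hmax : ∀ n, (e : ℝ) ≤ ((ℓ : ℝ) - 1) * upperNumber ℓ l n →
      upperNumber ℓ l (n + 1) ≤ upperNumber ℓ l n + e) :
    ∃ c₁ c₂ : ℕ → ℝ,
      (∀ n : ℕ,
        |c₁ n| ≤ 6 * (e : ℝ) ^ 2 ∧
        |c₂ n| ≤ 2 * ((ℓ : ℝ) * e / ((ℓ : ℝ) - 1)) ^ 2 - 1 ∧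
        2 * ((ℓ : ℝ) * e / ((ℓ : ℝ) - 1)) ^ 2 - 1 ≤ 8 * (e : ℝ) ^ 2 ∧
        differentValue ℓ l n = (e : ℝ) * n + c₁ n + ((ℓ : ℝ) ^ n)⁻¹ * c₂ n) ∧
      ∃ κ : ℕ, (ℓ : ℝ) ^ κ ≤ (ℓ : ℝ) * e / ((ℓ : ℝ) - 1) ∧
        ∀ n : ℕ, κ ≤ n → c₁ n = c₁ κ ∧ c₂ n = c₂ κ := by
  have hℓ2 : (2 : ℝ) ≤ ℓ := by exact_mod_cast hℓ
  have he1 : (1 : ℝ) ≤ e := by exact_mod_cast he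
  have hl1 : ∀ n, (1 : ℝ) ≤ l n := fun n => by exact_mod_cast hl n
  have hpos : (0 : ℝ) < (ℓ : ℝ) - 1 := by linarith
  have hpow : ∀ n, (0 : ℝ) < (ℓ : ℝ) ^ n := fun n => by positivity
  set u := upperNumber ℓ l with hu
  set x : ℝ := (ℓ : ℝ) * e / ((ℓ : ℝ) - 1) with hx
  have hxmul : x * (ℓ - 1) = ℓ * e := div_mul_cancel₀ _ hpos.ne'
  have hx2 : x ≤ 2 * e := by rw [hx, div_le_iff₀ hpos]; nlinarith
  have hxe : (e : ℝ) ≤ x := by rw [hx, le_div_iff₀ hpos]; nlinarith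
  have hsum : ∀ n, 0 ≤ ∑ j ∈ range n, ((ℓ : ℝ) - 1) * l j / (ℓ : ℝ) ^ (j + 1) := fun n =>
    sum_nonneg fun j _ => by positivity
  have hsum' : ∀ n, ∑ j ∈ range n, ((ℓ : ℝ) - 1) * l j / (ℓ : ℝ) ^ (j + 1) ≤ e * n := fun n => by
    refine (sum_le_sum (g := fun _ => (e : ℝ)) fun j _ => ?_).trans (by simp [mul_comm])
    rw [div_le_iff₀ (hpow _)]
    exact hle j
  have hldiv : ∀ n, (l n : ℝ) / (ℓ : ℝ) ^ n ≤ x := fun n => by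
    rw [div_le_iff₀ (hpow n), ← mul_le_mul_iff_right₀ hpos]
    refine (hle n).trans_eq ?_
    rw [← mul_assoc, mul_comm _ x, hxmul, pow_succ]
    ring
  have hun : ∀ n, u n = (l n : ℝ) / (ℓ : ℝ) ^ n +
      ∑ j ∈ range n, ((ℓ : ℝ) - 1) * l j / (ℓ : ℝ) ^ (j + 1) := fun n => rfl
  have hu0 : ∀ n, 0 < u n := fun n => by
    rw [hun]
    have := hsum n
    have := hl1 n
    positivity
  -- growth of the upper breaks below the threshold
  have hgrow : ∀ n, (∀ m < n, ((ℓ : ℝ) - 1) * u m < e) → (ℓ : ℝ) ^ n ≤ u n := by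
    intro n
    induction n with
    | zero =>
      intro _
      rw [hun]
      simpa using hl1 0
    | succ n ih =>
      intro h
      have h1 := ih fun m hm => h m (by omega)
      have h2 := h n (by omega)
      have h3 := hmin n
      rw [min_eq_right (by linarith)] at h3
      rw [pow_succ]
      nlinarith
  have hex : ∃ n, (e : ℝ) ≤ ((ℓ : ℝ) - 1) * u n := by
    by_contra! hc
    obtain ⟨n, hn⟩ := pow_unbounded_of_one_lt (e : ℝ) (by linarith : (1 : ℝ) < ℓ)
    have h1 := hgrow n fun m _ => hc m
    have h2 := hc n
    nlinarith [hu0 n]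
  classical
  set κ := Nat.find hex with hκ
  have hκ1 : (e : ℝ) ≤ ((ℓ : ℝ) - 1) * u κ := Nat.find_spec hex
  have hκ2 : ∀ m < κ, ((ℓ : ℝ) - 1) * u m < e := fun m hm => not_le.1 (Nat.find_min hex hm)
  have hκx : (ℓ : ℝ) ^ κ ≤ x := by
    rcases Nat.eq_zero_or_pos κ with h0 | h0
    · rw [h0, pow_zero]; linarith
    · obtain ⟨m, hm⟩ : ∃ m, κ = m + 1 := ⟨κ - 1, by omega⟩
      have h1 := hgrow m fun j hj => hκ2 j (by omega)
      have h2 := hκ2 m (by omega)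
      rw [hm, pow_succ, hx, le_div_iff₀ hpos]
      have h3 : ((ℓ : ℝ) - 1) * (ℓ : ℝ) ^ m ≤ e := by nlinarith
      nlinarith
  have hκe : (κ : ℝ) ≤ 2 * e := by
    have h1 : (κ : ℝ) ≤ 2 ^ κ := by exact_mod_cast Nat.lt_two_pow_self.le
    have h2 : (2 : ℝ) ^ κ ≤ (ℓ : ℝ) ^ κ := pow_le_pow_left₀ (by norm_num) hℓ2 κ
    linarith
  -- from the threshold on, the upper breaks form an arithmetic progression
  have hbig : ∀ n, κ ≤ n → (e : ℝ) ≤ ((ℓ : ℝ) - 1) * u n ∧ u n = u κ + e * ((n : ℝ) - κ) := by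
    intro n hn
    induction n, hn using Nat.le_induction with
    | base => exact ⟨hκ1, by simp⟩
    | succ n hn ih =>
      have h1 := hmin n
      have h2 := hmax n ih.1
      rw [min_eq_left (by linarith [ih.1])] at h1
      have h3 : u (n + 1) = u n + e := le_antisymm h2 h1
      refine ⟨?_, ?_⟩
      · rw [h3]; nlinarith [ih.1]
      · rw [h3, ih.2]; push_cast; ring
  -- `x * ℓ ^ n - (l n + 1)`, the numerator of the term in `1 / ℓ ^ n`, becomes constant because
  -- `l (n + 1) - l n = e * ℓ ^ (n + 1)`
  have hc2 : ∀ n, κ ≤ n → x * (ℓ : ℝ) ^ n - (l n + 1) = x * (ℓ : ℝ) ^ κ - (l κ + 1) := by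
    intro n hn
    induction n, hn using Nat.le_induction with
    | base => rfl
    | succ n hn ih =>
      have h1 := (hbig (n + 1) (by omega)).2
      rw [Nat.cast_succ, add_sub_right_comm, mul_add, ← add_assoc, ← (hbig n hn).2, hun, hun,
        sum_range_succ] at h1
      have h2 : (l (n + 1) : ℝ) - l n = e * (ℓ : ℝ) ^ (n + 1) := by
        have h0 := (hpow n).ne'
        have h0' : (ℓ : ℝ) ≠ 0 := by positivity
        rw [pow_succ] at h1 ⊢
        field_simp at h1
        linarith
      rw [← ih, pow_succ]
      rw [pow_succ] at h2
      linear_combination (ℓ : ℝ) ^ n * hxmul - h2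
  have hD0 : ∀ n, 0 ≤ differentValue ℓ l n := fun n => sum_nonneg fun j _ => by positivity
  have hDle : ∀ n, differentValue ℓ l n ≤ e * n + 1 := fun n => by
    rw [differentValue_eq (by omega), ← hu, hun, add_div]
    have := hsum' n
    have : 0 < 1 / (ℓ : ℝ) ^ n := by positivity
    linarith
  -- below the threshold the whole deviation from `e * n` is put into `c₁`
  refine ⟨fun n => if κ ≤ n then u κ - e * κ + 1 - x else differentValue ℓ l n - e * n,
    fun n => if κ ≤ n then x * (ℓ : ℝ) ^ κ - (l κ + 1) else 0, fun n => ⟨?_, ?_, ?_, ?_⟩,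
    κ, hκx, fun n hn => by simp [hn]⟩
  · simp only [abs_le]
    split_ifs with h
    · have h1 := hldiv κ
      have h2 := hsum' κ
      have h3 := hu0 κ
      have h4 := hun κ
      constructor <;> nlinarith
    · have h1 := hD0 n
      have h2 := hDle n
      have h3 : (n : ℝ) ≤ κ := by exact_mod_cast (not_le.1 h).le
      constructor <;> nlinarith
  · simp only [abs_le]
    split_ifs with h
    · have h1 := hldiv κ
      rw [div_le_iff₀ (hpow κ)] at h1
      have h2 := hl1 κ
      have h3 : x * (ℓ : ℝ) ^ κ ≤ x * x := mul_le_mul_of_nonneg_left hκx (by linarith)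
      constructor <;> nlinarith
    · constructor <;> nlinarith
  · nlinarith
  · dsimp only
    split_ifs with h
    · rw [← hc2 n h, differentValue_eq (by omega), ← hu, (hbig n h).2]
      have h0 := (hpow n).ne'
      field_simp
      ring
    · ring

end Numerics

end RamifiedTower

theorem mainTheorem7 (ℓ : ℕ) [Fact ℓ.Prime]
    -- `R` is the ring of integers of the complete discretely valued field `K`
    (R : Type*) [CommRing R] [IsDomain R] [IsDiscreteValuationRing R]
    [IsAdicComplete (IsLocalRing.maximalIdeal R) R]
    [CharP (IsLocalRing.ResidueField R) ℓ] [PerfectField (IsLocalRing.ResidueField R)]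
    (e : ℕ) (he : IsDiscreteValuationRing.addVal R (ℓ : R) = (e : ℕ∞))
    (K : Type*) [Field K] [Algebra R K] [IsFractionRing R K]
    -- `L` is a totally ramified Galois extension of `K` with group `ℤ_ℓ`
    (L : Type*) [Field L] [Algebra K L] [Algebra R L] [IsScalarTower R K L] [IsGalois K L]
    (φ : Gal(L/K) ≃ₜ* Multiplicative ℤ_[ℓ])
    (hL : RamifiedTower.IsTotallyRamified R K L) :
    ∃ c₁ c₂ : ℕ → ℝ,
      (∀ n : ℕ,
        |c₁ n| ≤ 6 * (e : ℝ) ^ 2 ∧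
        |c₂ n| ≤ 2 * ((ℓ : ℝ) * e / ((ℓ : ℝ) - 1)) ^ 2 - 1 ∧
        2 * ((ℓ : ℝ) * e / ((ℓ : ℝ) - 1)) ^ 2 - 1 ≤ 8 * (e : ℝ) ^ 2 ∧
        -- `P` runs over the maximal ideal of the ring of integers of `K_n`
        ∀ P : Ideal (integralClosure R (RamifiedTower.layer φ n)), P.IsPrime →
          P.LiesOver (IsLocalRing.maximalIdeal R) →
            RamifiedTower.idealVal R P
                (differentIdeal R (integralClosure R (RamifiedTower.layer φ n))) =
              (e : ℝ) * n + c₁ n + ((ℓ : ℝ) ^ n)⁻¹ * c₂ n) ∧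
      -- from an explicitly bounded rank on, `c₁` and `c₂` do not depend on `n`
      ∃ κ : ℕ, (ℓ : ℝ) ^ κ ≤ (ℓ : ℝ) * e / ((ℓ : ℝ) - 1) ∧
        ∀ n : ℕ, κ ≤ n → c₁ n = c₁ κ ∧ c₂ n = c₂ κ := by
  have hp : ℓ.Prime := Fact.out
  obtain ⟨he0, l, hT, hD⟩ := RamifiedTower.exists_breaks φ he hL
  have hpow : ∀ n, (0 : ℝ) < (ℓ : ℝ) ^ n := fun n => pow_pos (by exact_mod_cast hp.pos) n
  have hl : ∀ n, 1 ≤ l n := fun n => by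
    obtain ⟨v, σ, π, h, -, -⟩ := hT (n + 1)
    exact h.lam_pos (by omega)
  have hle : ∀ n, ((ℓ : ℝ) - 1) * l n ≤ e * (ℓ : ℝ) ^ (n + 1) := fun n => by
    obtain ⟨v, σ, π, h, -, hE⟩ := hT (n + 1)
    have := h.mul_lam_le hE (n := n) (by omega)
    rw [Nat.sub_self, pow_zero, Nat.cast_one, mul_one] at this
    exact_mod_cast this
  have hmin : ∀ n, min (RamifiedTower.upperNumber ℓ l n + e)
      (ℓ * RamifiedTower.upperNumber ℓ l n) ≤ RamifiedTower.upperNumber ℓ l (n + 1) := fun n => by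
    obtain ⟨v, σ, π, h, hperf, hE⟩ := hT (n + 2)
    have h1 := h.min_le_upperBreak_of_perfect hperf hE (n := n) (by omega)
    have h2 : ((min (RamifiedTower.upperBreak ℓ (n + 2) l n + e * ℓ ^ (n + 2))
        (ℓ * RamifiedTower.upperBreak ℓ (n + 2) l n) : ℤ) : ℝ) ≤
        RamifiedTower.upperBreak ℓ (n + 2) l (n + 1) := by exact_mod_cast h1
    push_cast at h2
    rw [RamifiedTower.upperBreak_eq hp.pos (by omega),
      RamifiedTower.upperBreak_eq hp.pos (by omega),
      mul_comm (e : ℝ), ← mul_add, mul_left_comm, ← mul_min_of_nonneg _ _ (hpow _).le] at h2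
    exact le_of_mul_le_mul_left h2 (hpow _)
  have hmax : ∀ n, (e : ℝ) ≤ ((ℓ : ℝ) - 1) * RamifiedTower.upperNumber ℓ l n →
      RamifiedTower.upperNumber ℓ l (n + 1) ≤ RamifiedTower.upperNumber ℓ l n + e := fun n hn => by
    obtain ⟨v, σ, π, h, hperf, hE⟩ := hT (n + 2)
    have hlarge : ((e * ℓ ^ (n + 2) : ℤ) : ℝ) ≤
        (((ℓ - 1) * RamifiedTower.upperBreak ℓ (n + 2) l n : ℤ) : ℝ) := by
      push_cast
      rw [RamifiedTower.upperBreak_eq hp.pos (by omega), mul_left_comm, mul_comm (e : ℝ)]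
      exact mul_le_mul_of_nonneg_left hn (hpow _).le
    have h1 := h.upperBreak_succ_le_of_perfect hperf hE (n := n) (by omega)
      (by exact_mod_cast hlarge)
    have h2 : (RamifiedTower.upperBreak ℓ (n + 2) l (n + 1) : ℝ) ≤
        ((RamifiedTower.upperBreak ℓ (n + 2) l n + e * ℓ ^ (n + 2) : ℤ) : ℝ) := by
      exact_mod_cast h1
    push_cast at h2
    rw [RamifiedTower.upperBreak_eq hp.pos (by omega),
      RamifiedTower.upperBreak_eq hp.pos (by omega),
      mul_comm (e : ℝ), ← mul_add] at h2
    exact le_of_mul_le_mul_left h2 (hpow _)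
  obtain ⟨c₁, c₂, hc, hκ⟩ := RamifiedTower.exists_constants hp.two_le he0 hl hle hmin hmax
  refine ⟨c₁, c₂, fun n => ⟨(hc n).1, (hc n).2.1, (hc n).2.2.1, fun P hP hPl => ?_⟩, hκ⟩
  rw [← (hc n).2.2.2, RamifiedTower.idealVal, (hD n P hP hPl).1]
  have h1 := congrArg (Int.cast : ℤ → ℝ) (hD n P hP hPl).2
  rw [Int.cast_natCast] at h1
  rw [h1, RamifiedTower.differentValue, div_eq_iff (by exact_mod_cast (hpow n).ne'), Finset.sum_mul]
  push_cast
  refine Finset.sum_congr rfl fun j hj => ?_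
  have h0 : (ℓ : ℝ) ≠ 0 := by exact_mod_cast hp.ne_zero
  have h2 : (ℓ : ℝ) ^ n = (ℓ : ℝ) ^ (n - (j + 1)) * (ℓ : ℝ) ^ (j + 1) := by
    rw [← pow_add]
    congr 1
    have := Finset.mem_range.1 hj
    omega
  rw [h2]
  field_simp
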